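/- Let $d\ge 4$ and $K_d=\frac{d(d+3)}2$. For a point $a=(a_{k,m,n})_{k+m+n=d}$ of the complex projective space $\mathbb P^{K_d}$ let $C_a\subset\mathbb P^2$ be the plane curve of degree $d$ given by $F(a,z)=\sum_{k+m+n=d}a_{k,m,n}z_1^kz_2^mz_3^n=0$. For an integer $r\ge 1$, a point $p\in C_a$ is called an $r$-tuple inflection point of $C_a$ if $p$ is a smooth point of $C_a$ (that is, the partial derivatives $\partial F/\partial z_i$ do not all vanish at $p$) and the tangent line $L$ to $C_a$ at $p$ meets $C_a$ at $p$ with intersection number $(L,C_a)_p=r+2$; it is called multiple if $r\ge 2$. Let $\mathcal M_d\subset\mathbb P^{K_d}$ be the Zariski closure of the set of all $a$ such that $C_a$ has a multiple inflection point. Then $\mathcal M_d$ is an irreducible hypersurface in $\mathbb P^{K_d}$. Moreover, there is a non-empty Zariski open subset $\mathfrak M_d$ of $\mathcal M_d$ such that for every $a\in\mathfrak M_d$ the curve $C_a$ is non-singular, it has exactly $3d(d-2)-1$ inflection points, and exactly one of them is multiple, namely a $2$-tuple inflection point. -/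

import Mathlib

open MvPolynomial

noncomputable section

/-- The complex projective space with homogeneous coordinates indexed by `ι`. -/
def CProj (ι : Type*) : Type _ := Projectivization ℂ (ι → ℂ)

namespace CProj

variable {ι : Type*}

/-- A vector of homogeneous coordinates of a point. -/
def coords (x : CProj ι) : ι → ℂ := Projectivization.rep x

/-- The point with given homogeneous coordinates. -/
def mk (v : ι → ℂ) (hv : v ≠ 0) : CProj ι := Projectivization.mk ℂ v hv

/-- Vanishing of a homogeneous polynomial at a point does not depend on the choice of homogeneous
coordinates. -/
theorem eval_coords_mk_eq_zero_iff {G : MvPolynomial ι ℂ} {n : ℕ} (hG : G.IsHomogeneous n)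
    (v : ι → ℂ) (hv : v ≠ 0) : eval (mk v hv).coords G = 0 ↔ eval v G = 0 := by
  obtain ⟨c, hc⟩ := Projectivization.exists_smul_eq_mk_rep ℂ v hv
  have h : (mk v hv).coords = (c : ℂ) • v := hc.symm
  have h2 : eval ((c : ℂ) • v) G = (c : ℂ) ^ n * eval v G := by
    rw [eval_eq, eval_eq, Finset.mul_sum]
    refine Finset.sum_congr rfl fun e he => ?_
    have hn : ∑ i ∈ e.support, e i = n := by
      simpa [Finsupp.weight_apply, Finsupp.sum] using hG (mem_support_iff.mp he)
    simp only [Pi.smul_apply, smul_eq_mul, mul_pow, Finset.prod_mul_distrib,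
      Finset.prod_pow_eq_pow_sum, hn]
    ring
  rw [h, h2]
  simp

/-- The common zero locus in projective space of a set of (homogeneous) polynomials. -/
def zeroLocus (S : Set (MvPolynomial ι ℂ)) : Set (CProj ι) :=
  {x | ∀ G ∈ S, eval x.coords G = 0}

/-- Zariski closed sets: common zero loci of sets of homogeneous polynomials. -/
def IsZariskiClosed (Z : Set (CProj ι)) : Prop :=
  ∃ S : Set (MvPolynomial ι ℂ), (∀ G ∈ S, ∃ n, G.IsHomogeneous n) ∧ Z = zeroLocus S

/-- The Zariski topology on projective space. -/
instance : TopologicalSpace (CProj ι) :=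
  TopologicalSpace.ofClosed {Z | IsZariskiClosed Z}
    ⟨{1}, by rintro G rfl; exact ⟨0, isHomogeneous_one ι ℂ⟩, by
      ext x; simp [zeroLocus]⟩
    (by
      intro A hA
      refine ⟨{G | (∃ n, G.IsHomogeneous n) ∧ ∃ Z ∈ A, ∀ x ∈ Z, eval x.coords G = 0},
        fun G hG => hG.1, ?_⟩
      ext x
      simp only [Set.mem_sInter, zeroLocus, Set.mem_ofPred_eq]
      constructor
      · rintro hx G ⟨-, Z, hZ, hG⟩
        exact hG x (hx Z hZ)
      · intro hx Z hZ
        obtain ⟨S, hS, rfl⟩ := hA hZ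
        exact fun G hG => hx G ⟨hS G hG, _, hZ, fun y hy => hy G hG⟩)
    (by
      rintro _ ⟨S, hS, rfl⟩ _ ⟨T, hT, rfl⟩
      refine ⟨{P | ∃ G ∈ S, ∃ H ∈ T, P = G * H}, ?_, ?_⟩
      · rintro _ ⟨G, hG, H, hH, rfl⟩
        obtain ⟨m, hm⟩ := hS G hG
        obtain ⟨n, hn⟩ := hT H hH
        exact ⟨m + n, hm.mul hn⟩
      · ext x
        simp only [Set.mem_union, zeroLocus, Set.mem_ofPred_eq]
        constructor
        · rintro (h | h) _ ⟨G, hG, H, hH, rfl⟩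
          · simp [h G hG]
          · simp [h H hH]
        · intro h
          by_contra! hc
          obtain ⟨⟨G, hG, hG0⟩, ⟨H, hH, hH0⟩⟩ := hc
          have := h _ ⟨G, hG, H, hH, rfl⟩
          simp [hG0, hH0] at this)

/-- A hypersurface: the zero locus of one nonzero homogeneous polynomial of positive degree. -/
def IsHypersurface (X : Set (CProj ι)) : Prop :=
  ∃ (G : MvPolynomial ι ℂ) (n : ℕ), 0 < n ∧ G ≠ 0 ∧ G.IsHomogeneous n ∧ X = zeroLocus {G}

end CProj

namespace PlaneCurve

/-- The exponents `(k, m, n)` with `k + m + n = d`. -/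
abbrev Exponent (d : ℕ) : Type :=
  {e : Fin 3 →₀ ℕ // e ∈ Finset.finsuppAntidiag (Finset.univ : Finset (Fin 3)) d}

/-- The parameter space has dimension `K_d = d (d + 3) / 2`. -/
theorem card_exponent (d : ℕ) : Fintype.card (Exponent d) = d * (d + 3) / 2 + 1 := by
  rw [Fintype.card_coe, Finset.card_finsuppAntidiag_nat_eq_choose]
  have h : d * (d + 3) + 2 = (d + 2) * (d + 1) := by ring
  have h2 : (d + 2).choose d = (d + 2) * (d + 1) / 2 := by
    rw [Nat.choose_symm_add, Nat.choose_two_right]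
    rfl
  simp only [Finset.card_univ, Fintype.card_fin]
  have h3 : 3 + d - 1 = d + 2 := by omega
  rw [h3, h2, ← h]
  omega

/-- The projective space `ℙ^{K_d}` of plane curves of degree `d`; the coordinates of a point are
the coefficients of an equation. -/
abbrev Param (d : ℕ) : Type := CProj (Exponent d)

/-- The projective plane. -/
abbrev Plane : Type := CProj (Fin 3)

variable {d : ℕ}

/-- The form `F(a, z) = ∑ a_{k,m,n} z₁^k z₂^m z₃^n` defining the curve `C_a`. -/
def form (a : Param d) : MvPolynomial (Fin 3) ℂ :=
  ∑ e : Exponent d, monomial e.1 (a.coords e)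

/-- The point `p` lies on `C_a`. -/
def OnCurve (a : Param d) (p : Plane) : Prop := eval p.coords (form a) = 0

/-- The `i`-th partial derivative of the equation of `C_a` at `p`. -/
def grad (a : Param d) (p : Plane) (i : Fin 3) : ℂ := eval p.coords (pderiv i (form a))

/-- `p` is a smooth point of `C_a`. -/
def IsSmoothPoint (a : Param d) (p : Plane) : Prop := OnCurve a p ∧ grad a p ≠ 0

/-- `C_a` is non-singular: all of its points are smooth points. -/
def IsNonsingular (a : Param d) : Prop := ∀ p, OnCurve a p → IsSmoothPoint a p

/-- The tangent line to `C_a` at a smooth point `p`. -/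
def tangentLine (a : Param d) (p : Plane) : Set Plane :=
  {q | ∑ i, grad a p i * q.coords i = 0}

/-- The intersection number `(L, C_a)_p` at `p` of `C_a` with the line `L` through `p` and another
point `q`: the order of vanishing at `t = 0` of the restriction `F(a, p + t q)` of the equation of
`C_a` to `L` (it is `⊤` if `L` is a component of `C_a`). -/
def lineIntersection (a : Param d) (p q : Plane) : ℕ∞ :=
  emultiplicity (Polynomial.X : Polynomial ℂ)
    (aeval (fun i => Polynomial.C (p.coords i) + Polynomial.X * Polynomial.C (q.coords i))
      (form a))

/-- `p` is an `r`-tuple inflection point of `C_a`: a smooth point at which the tangent line `L`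
satisfies `(L, C_a)_p = r + 2`, where `1 ≤ r`. The number `(L, C_a)_p` does not depend on the point
`q ≠ p` that is used to parametrize `L`. -/
def IsInflection (a : Param d) (r : ℕ) (p : Plane) : Prop :=
  1 ≤ r ∧ IsSmoothPoint a p ∧
    ∃ q ∈ tangentLine a p, q ≠ p ∧ lineIntersection a p q = ((r + 2 : ℕ) : ℕ∞)

/-- The set of inflection points of `C_a`. -/
def inflectionPoints (a : Param d) : Set Plane := {p | ∃ r, IsInflection a r p}

/-- The set of multiple (`2 ≤ r`) inflection points of `C_a`. -/
def multipleInflectionPoints (a : Param d) : Set Plane :=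
  {p | ∃ r, 2 ≤ r ∧ IsInflection a r p}

/-- The Zariski closure `M_d` of the locus of curves having a multiple inflection point. -/
def multipleLocus (d : ℕ) : Set (Param d) :=
  closure {a | (multipleInflectionPoints a).Nonempty}

end PlaneCurve

end

/-! Call a point where some line meets the curve with order at least four a hyperflex. Moving the
flag (point, line) to (1:0:0) on z₃ = 0 turns a hyperflex into the vanishing of the four
coefficients of z₁^(d-k) z₂^k, k < 4 (`supported_iff`). So every curve with a multiple inflection
point is F ∘ g with g a matrix and F in one fixed linear space, and a general F ∘ g has such a
point. The polynomials vanishing on all F ∘ g form the kernel of a map into a polynomial ring, the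
prime ideal `hyperflexIdeal`; primality gives irreducibility.

Flags depend on three parameters and a hyperflex costs four conditions, so codimension one is
expected. A dimension count produces a nonzero equation (`hyperflexIdeal_ne_bot`). Conversely, a
derivative computed at one explicit form shows that the coefficients other than that of z₁^d satisfy
no relation on the family (`hyperflexIdeal_elim`). A nonzero prime ideal containing no nonzero
polynomial free of one given variable is principal, by Gauss's lemma and a resultant
(`exists_prime_span_of_elim`). Its generator is homogeneous because the family is stable under
scaling, and it cuts out the closure.

For the general member, consider forms with a hyperflex on the standard flag. A singular point, or a
hyperflex at another point, imposes more conditions than its position has parameters; this is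
checked cell by cell relative to the standard flag (`exists_isGenericHyperflex`). Chevalley's
theorem carries the resulting open condition from the pairs (g, F) to an open subset of the locus
(`exists_open_multipleLocus`).

To count, take a smooth curve containing no line. Its inflection points are its intersections with
the Hessian curve. Along a branch y = α(x) the Hessian equals (d-1)² (∂F/∂z₃)³ α'', so its order of
vanishing is exactly the r of an r-tuple inflection point (`IsBranch.isFlex_iff`). In general
coordinates, eliminating z₃ from F and its Hessian gives a polynomial of degree 3d(d-2) whose root
multiplicities are these r (`exists_flexes`). On the general member one r is 2 and the others are 1,
so there are 3d(d-2) - 1 points. -/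

noncomputable section

namespace PlaneCurve

/-! ### Linear substitutions in ternary forms. -/

section Substitution

variable {R S : Type*} [CommRing R] [CommRing S]

/-- The linear substitution `F(z) ↦ F(A z)`. -/
def subst (A : Matrix (Fin 3) (Fin 3) R) : MvPolynomial (Fin 3) R →ₐ[R] MvPolynomial (Fin 3) R :=
  aeval fun i => ∑ j, C (A i j) * X j

theorem aeval_subst {T : Type*} [CommRing T] [Algebra R T] (A : Matrix (Fin 3) (Fin 3) R)
    (f : Fin 3 → T) (F : MvPolynomial (Fin 3) R) :
    aeval f (subst A F) = aeval (fun i => ∑ j, algebraMap R T (A i j) * f j) F := by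
  rw [subst, ← AlgHom.comp_apply, comp_aeval]
  simp [algHom_C]

theorem subst_subst (A B : Matrix (Fin 3) (Fin 3) R) (F : MvPolynomial (Fin 3) R) :
    subst B (subst A F) = subst (A * B) F := by
  have h : (fun i => ∑ j, algebraMap R (MvPolynomial (Fin 3) R) (A i j) *
      ∑ k, C (B j k) * X k) = fun i => ∑ j, C ((A * B) i j) * X j := by
    funext i
    simp only [algebraMap_eq, Finset.mul_sum, Matrix.mul_apply, map_sum, map_mul, Finset.sum_mul]
    rw [Finset.sum_comm]
    simp only [mul_assoc]
  have h2 := aeval_subst A (fun j => ∑ k, C (B j k) * X k) F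
  rw [h] at h2
  exact h2

theorem subst_one (F : MvPolynomial (Fin 3) R) : subst 1 F = F := by
  have : (fun i => ∑ j, C ((1 : Matrix (Fin 3) (Fin 3) R) i j) * X j) =
      (X : Fin 3 → MvPolynomial (Fin 3) R) := by
    funext i
    simp [Matrix.one_apply]
  rw [subst, this, aeval_X_left, AlgHom.id_apply]

theorem map_subst (φ : R →+* S) (A : Matrix (Fin 3) (Fin 3) R) (F : MvPolynomial (Fin 3) R) :
    map φ (subst A F) = subst (A.map φ) (map φ F) := by
  induction F using MvPolynomial.induction_on with
  | C a => simp [algHom_C, map_C]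
  | add p q hp hq => simp [hp, hq]
  | mul_X p i hp =>
    rw [map_mul, map_mul, hp, map_mul, map_mul]
    congr 1
    simp [subst]

theorem isHomogeneous_subst {F : MvPolynomial (Fin 3) R} {n : ℕ} (hF : F.IsHomogeneous n)
    (A : Matrix (Fin 3) (Fin 3) R) : (subst A F).IsHomogeneous n := by
  have := hF.aeval (n := 1) (fun i => ∑ j, C (A i j) * X j : Fin 3 → MvPolynomial (Fin 3) R)
    fun i => IsHomogeneous.sum _ _ _ fun j _ => isHomogeneous_C_mul_X _ _
  simpa [subst] using this

end Substitution

/-! ### Forms as coefficient vectors. -/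

section Coefficients

variable {R S : Type*} [CommRing R] [CommRing S] {d : ℕ}

/-- The ternary form of degree `d` with given coefficients. -/
def ofCoeffs (c : Exponent d → R) : MvPolynomial (Fin 3) R := ∑ e : Exponent d, monomial e.1 (c e)

theorem sum_exponent (e : Exponent d) : e.1 0 + e.1 1 + e.1 2 = d := by
  have := (Finset.mem_finsuppAntidiag.mp e.2).1
  simpa [Fin.sum_univ_three] using this

theorem mem_exponent {e : Fin 3 →₀ ℕ} (h : e 0 + e 1 + e 2 = d) :
    e ∈ Finset.finsuppAntidiag (Finset.univ : Finset (Fin 3)) d := by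
  rw [Finset.mem_finsuppAntidiag]
  exact ⟨by simpa [Fin.sum_univ_three] using h, Finset.subset_univ _⟩

theorem degree_exponent (e : Exponent d) : e.1.degree = d := by
  rw [Finsupp.degree_eq_sum, Fin.sum_univ_three, sum_exponent]

@[simp]
theorem coeff_ofCoeffs (c : Exponent d → R) (e : Exponent d) : coeff e.1 (ofCoeffs c) = c e := by
  rw [ofCoeffs, coeff_sum, Finset.sum_eq_single e]
  · simp
  · intro b _ hb
    rw [coeff_monomial, if_neg]
    exact fun h => hb (Subtype.ext h)
  · simp

theorem isHomogeneous_ofCoeffs (c : Exponent d → R) : (ofCoeffs c).IsHomogeneous d :=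
  IsHomogeneous.sum _ _ _ fun e _ => isHomogeneous_monomial _ (degree_exponent e)

theorem ofCoeffs_coeff {F : MvPolynomial (Fin 3) R} (hF : F.IsHomogeneous d) :
    ofCoeffs (fun e : Exponent d => coeff e.1 F) = F := by
  ext m
  by_cases hm : m.degree = d
  · have h : m ∈ Finset.finsuppAntidiag (Finset.univ : Finset (Fin 3)) d := by
      apply mem_exponent
      rw [← hm, Finsupp.degree_eq_sum, Fin.sum_univ_three]
    exact coeff_ofCoeffs (fun e : Exponent d => coeff e.1 F) ⟨m, h⟩
  · rw [hF.coeff_eq_zero hm, (isHomogeneous_ofCoeffs _).coeff_eq_zero hm]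

theorem map_ofCoeffs (φ : R →+* S) (c : Exponent d → R) :
    map φ (ofCoeffs c) = ofCoeffs fun e => φ (c e) := by
  simp [ofCoeffs, map_monomial]

theorem ofCoeffs_smul (r : R) (c : Exponent d → R) : ofCoeffs (r • c) = C r * ofCoeffs c := by
  simp [ofCoeffs, Finset.mul_sum, C_mul_monomial]

/-- The coefficients of the form `F(A z)`, where `F` has coefficients `c`. -/
def act (A : Matrix (Fin 3) (Fin 3) R) (c : Exponent d → R) : Exponent d → R :=
  fun e => coeff e.1 (subst A (ofCoeffs c))

theorem ofCoeffs_act (A : Matrix (Fin 3) (Fin 3) R) (c : Exponent d → R) :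
    ofCoeffs (act A c) = subst A (ofCoeffs c) :=
  ofCoeffs_coeff (isHomogeneous_subst (isHomogeneous_ofCoeffs c) A)

theorem act_act (A B : Matrix (Fin 3) (Fin 3) R) (c : Exponent d → R) :
    act B (act A c) = act (A * B) c := by
  funext e
  rw [act, ofCoeffs_act, subst_subst, act]

theorem act_one (c : Exponent d → R) : act 1 c = c := by
  funext e
  rw [act, subst_one, coeff_ofCoeffs]

theorem act_smul (A : Matrix (Fin 3) (Fin 3) R) (r : R) (c : Exponent d → R) :
    act A (r • c) = r • act A c := by
  funext e
  simp [act, ofCoeffs_smul, algHom_C]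

theorem map_act (φ : R →+* S) (A : Matrix (Fin 3) (Fin 3) R) (c : Exponent d → R)
    (e : Exponent d) : φ (act A c e) = act (A.map φ) (fun e => φ (c e)) e := by
  rw [act, ← coeff_map, map_subst, map_ofCoeffs, act]

/-- Extension by zero of coefficients on a set of exponents. -/
def extend (s : Finset (Exponent d)) (v : s → R) : Exponent d → R :=
  fun e => if h : e ∈ s then v ⟨e, h⟩ else 0

theorem extend_of_mem {s : Finset (Exponent d)} (v : s → R) {e : Exponent d} (h : e ∈ s) :
    extend s v e = v ⟨e, h⟩ := dif_pos h

theorem extend_of_notMem {s : Finset (Exponent d)} (v : s → R) {e : Exponent d} (h : e ∉ s) :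
    extend s v e = 0 := dif_neg h

theorem extend_restrict {s : Finset (Exponent d)} {c : Exponent d → R} (h : ∀ e ∉ s, c e = 0) :
    extend s (fun e => c e) = c := by
  funext e
  by_cases he : e ∈ s
  · rw [extend_of_mem _ he]
  · rw [extend_of_notMem _ he, h e he]

theorem map_extend (φ : R →+* S) {s : Finset (Exponent d)} (v : s → R) (e : Exponent d) :
    φ (extend s v e) = extend s (fun x => φ (v x)) e := by
  by_cases he : e ∈ s <;> simp [extend, he]

/-- The exponent of the monomial `z_i ^ (d - k) z_j ^ k`. -/
def mon (d : ℕ) (i j : Fin 3) (k : Fin (d + 1)) : Exponent d :=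
  ⟨Finsupp.single i (d - k) + Finsupp.single j k.1, by
    have h := k.2
    rw [Finset.mem_finsuppAntidiag]
    refine ⟨?_, Finset.subset_univ _⟩
    simp only [Finsupp.coe_add, Pi.add_apply, Finset.sum_add_distrib, Finsupp.univ_sum_single_apply]
    omega⟩

end Coefficients

/-! ### Restriction to lines and order of contact. -/

section Lines

/-- The restriction `F(p + X q)` of a polynomial to the line through `p` and `q`. -/
def lineRestr (F : MvPolynomial (Fin 3) ℂ) (p q : Fin 3 → ℂ) : Polynomial ℂ :=
  aeval (fun i => Polynomial.C (p i) + Polynomial.X * Polynomial.C (q i)) F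

theorem lineRestr_subst (A : Matrix (Fin 3) (Fin 3) ℂ) (F : MvPolynomial (Fin 3) ℂ)
    (p q : Fin 3 → ℂ) :
    lineRestr (subst A F) p q = lineRestr F (A.mulVec p) (A.mulVec q) := by
  rw [lineRestr, aeval_subst, lineRestr]
  congr 2
  funext i
  simp only [Matrix.mulVec, dotProduct, Fin.sum_univ_three, Polynomial.algebraMap_eq, map_add,
    map_mul]
  ring

theorem aeval_line {T : Type*} [CommRing T] [Algebra ℂ T] (F : MvPolynomial (Fin 3) ℂ)
    (p q : Fin 3 → ℂ) (w : T) :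
    aeval (fun i => algebraMap ℂ T (p i) + w * algebraMap ℂ T (q i)) F =
      Polynomial.aeval w (lineRestr F p q) := by
  rw [lineRestr, ← AlgHom.comp_apply, comp_aeval]
  simp only [map_add, map_mul, Polynomial.aeval_X, Polynomial.aeval_C]

theorem eval_line (F : MvPolynomial (Fin 3) ℂ) (p q : Fin 3 → ℂ) (t : ℂ) :
    eval (fun i => p i + t * q i) F = (lineRestr F p q).eval t := by
  have := aeval_line F p q t
  simpa [aeval_eq_eval, Polynomial.aeval_def, Polynomial.eval₂_eq_eval_map] using this

theorem aeval_smul_of_isHomogeneous {T : Type*} [CommRing T] [Algebra ℂ T] {ι : Type*}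
    {F : MvPolynomial ι ℂ}
    {n : ℕ} (hF : F.IsHomogeneous n) (s : T) (v : ι → T) :
    aeval (fun i => s * v i) F = s ^ n * aeval v F := by
  rw [aeval_def, eval₂_eq, aeval_def, eval₂_eq, Finset.mul_sum]
  refine Finset.sum_congr rfl fun e he => ?_
  have hn : ∑ i ∈ e.support, e i = n := by
    simpa [Finsupp.weight_apply, Finsupp.sum] using hF (mem_support_iff.mp he)
  simp only [mul_pow, Finset.prod_mul_distrib, Finset.prod_pow_eq_pow_sum, hn]
  ring

theorem coe_X_pow_dvd_iff {P : Polynomial ℂ} {m : ℕ} :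
    (PowerSeries.X : PowerSeries ℂ) ^ m ∣ (P : PowerSeries ℂ) ↔ Polynomial.X ^ m ∣ P := by
  rw [PowerSeries.X_pow_dvd_iff, Polynomial.X_pow_dvd_iff]
  simp

/-- The order of contact with a line does not depend on the parametrization of the line. -/
theorem X_pow_dvd_lineRestr {F : MvPolynomial (Fin 3) ℂ} {n : ℕ} (hF : F.IsHomogeneous n) {m : ℕ}
    {p q : Fin 3 → ℂ} (h : Polynomial.X ^ m ∣ lineRestr F p q) {l : ℂ} (hl : l ≠ 0) (a b : ℂ) :
    Polynomial.X ^ m ∣ lineRestr F (l • p) (a • p + b • q) := by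
  rw [← coe_X_pow_dvd_iff]
  -- The new parametrization is l p + X (a p + b q) = s (p + w q), where s = l + a X is a unit and w
  -- = b X / s is divisible by X. Homogeneity pulls out s ^ n.
  let s : PowerSeries ℂ := PowerSeries.C l + PowerSeries.C a * PowerSeries.X
  have hs : IsUnit s := by
    rw [PowerSeries.isUnit_iff_constantCoeff]
    simpa [s] using hl
  obtain ⟨u, hu⟩ := hs.exists_right_inv
  let w : PowerSeries ℂ := u * (PowerSeries.C b * PowerSeries.X)
  have h1 : ((lineRestr F (l • p) (a • p + b • q) : Polynomial ℂ) : PowerSeries ℂ) =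
      s ^ n * Polynomial.aeval w (lineRestr F p q) := by
    have hco : ∀ P : Polynomial ℂ, (P : PowerSeries ℂ) =
        Polynomial.coeToPowerSeries.algHom ℂ P := fun P => by
      simp [Polynomial.coeToPowerSeries.algHom_apply]
    rw [← aeval_line, ← aeval_smul_of_isHomogeneous hF, lineRestr, hco, ← AlgHom.comp_apply,
      comp_aeval]
    congr 2
    funext i
    have : s * (algebraMap ℂ (PowerSeries ℂ) (p i) + w * algebraMap ℂ (PowerSeries ℂ) (q i)) =
      s * PowerSeries.C (p i) + (s * u) * (PowerSeries.C b * PowerSeries.X) *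
        PowerSeries.C (q i) := by
      simp only [w, PowerSeries.algebraMap_apply]
      simp
      ring
    rw [this, hu]
    simp [s]
    ring
  obtain ⟨K, hK⟩ := h
  rw [h1, hK, map_mul, map_pow, Polynomial.aeval_X]
  refine Dvd.dvd.mul_left (Dvd.dvd.mul_right (pow_dvd_pow_of_dvd ?_ m) _) _
  exact Dvd.dvd.mul_left (Dvd.dvd.mul_left dvd_rfl _) _

/-- Only monomials free of the third variable survive on a coordinate line, so contact conditions
there are the vanishing of single coefficients. -/
theorem lineRestr_basis {d : ℕ} (c : Exponent d → ℂ) {i j : Fin 3} (hij : i ≠ j)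
    (k : Fin (d + 1)) :
    (lineRestr (ofCoeffs c) (Pi.single i 1) (Pi.single j 1)).coeff k = c (mon d i j k) := by
  obtain ⟨l, hli, hlj, hl⟩ : ∃ l : Fin 3, l ≠ i ∧ l ≠ j ∧
      (Finset.univ : Finset (Fin 3)) = {i, j, l} := by
    revert i j; decide
  have key : ∀ (e : Fin 3 →₀ ℕ) (a : ℂ),
      aeval (fun m : Fin 3 => Polynomial.C ((Pi.single i 1 : Fin 3 → ℂ) m) +
        Polynomial.X * Polynomial.C ((Pi.single j 1 : Fin 3 → ℂ) m)) (monomial e a) =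
      if e l = 0 then Polynomial.C a * Polynomial.X ^ (e j) else 0 := by
    intro e a
    rw [aeval_monomial, Finsupp.prod_fintype _ _ (by simp), hl,
      Finset.prod_insert (by simp [hij, hli.symm]), Finset.prod_insert (by simp [hlj.symm]),
      Finset.prod_singleton]
    split_ifs with h <;> simp [hij, hli, hlj, hij.symm, h]
  have hsum : ∀ e : Exponent d, e.1 i + e.1 j + e.1 l = d := by
    rintro ⟨e, he⟩
    have := (Finset.mem_finsuppAntidiag.mp he).1
    rw [hl, Finset.sum_insert (by simp [hij, hli.symm]), Finset.sum_insert (by simp [hlj.symm]),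
      Finset.sum_singleton] at this
    simp only
    omega
  rw [lineRestr, ofCoeffs, map_sum, Finset.sum_congr rfl fun e _ => key e.1 (c e),
    Polynomial.finsetSum_coeff, Finset.sum_eq_single (mon d i j k)]
  · simp [mon, hli, hlj, hij.symm]
  · intro e _ he
    split_ifs with h
    · rw [Polynomial.coeff_C_mul_X_pow, if_neg]
      intro hk
      apply he
      have h1 := hsum e
      apply Subtype.ext
      ext m
      have hm : m ∈ ({i, j, l} : Finset (Fin 3)) := hl ▸ Finset.mem_univ m
      simp only [Finset.mem_insert, Finset.mem_singleton] at hm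
      rcases hm with rfl | rfl | rfl
      · simp [mon, hij]; omega
      · simp [mon, hij.symm]; omega
      · simp [mon, h, hli.symm, hlj.symm]
    · simp
  · simp

end Lines


/-! ### Dimension counts and forms with a hyperflex on the standard flag. -/

theorem eval_aeval {σ τ : Type*} (x : σ → ℂ) (Γ : τ → MvPolynomial σ ℂ) (H : MvPolynomial τ ℂ) :
    eval x (aeval Γ H) = eval (fun e => eval x (Γ e)) H := by
  induction H using MvPolynomial.induction_on with
  | C a => simp
  | add p q hp hq => simp only [map_add, hp, hq]
  | mul_X p i hp => simp only [map_mul, hp, aeval_X, eval_X]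

/-- A polynomial map from an affine space to one of larger dimension is not dominant. -/
theorem exists_aeval_eq_zero_of_card_lt {σ τ : Type} [Fintype σ] [Fintype τ]
    (h : Fintype.card σ < Fintype.card τ) (Γ : τ → MvPolynomial σ ℂ) :
    ∃ H : MvPolynomial τ ℂ, H ≠ 0 ∧ aeval Γ H = 0 := by
  have hn : ¬ AlgebraicIndependent ℂ Γ := by
    intro hi
    have h1 := hi.cardinalMk_le_trdeg
    rw [MvPolynomial.trdeg_of_isDomain, Cardinal.lift_id, Cardinal.mk_fintype, Cardinal.mk_fintype]
      at h1
    exact absurd (by exact_mod_cast h1) (not_le.mpr h)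
  rw [algebraicIndependent_iff] at hn
  push Not at hn
  obtain ⟨H, h1, h2⟩ := hn
  exact ⟨H, h2, h1⟩

variable {d : ℕ}

/-- The forms with coefficients in `s` that acquire `E.card` vanishing coefficients after some
substitution from a family with fewer than `E.card` parameters lie in a proper closed subset. -/
theorem exists_ne_zero_of_family (s E : Finset (Exponent d)) (hE : E ⊆ s) {n : ℕ} (hn : n < E.card)
    (M N : Matrix (Fin 3) (Fin 3) (MvPolynomial (Fin n) ℂ)) (hMN : M * N = 1) :
    ∃ h : MvPolynomial s ℂ, h ≠ 0 ∧ ∀ (c : Exponent d → ℂ) (t : Fin n → ℂ),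
      (∀ e ∉ s, act (M.map (eval t)) c e = 0) → (∀ e ∈ E, act (M.map (eval t)) c e = 0) →
      eval (fun e : s => c e) h = 0 := by
  classical
  -- Undoing the substitution, a bad form is `act` of N(t) on a vector supported on s \ E. The bad
  -- forms thus lie in the image of an affine space of dimension n + |s| - |E| < |s|.
  let σ := Fin n ⊕ ↥(s \ E)
  let Γ : s → MvPolynomial σ ℂ := fun e =>
    act (N.map (rename Sum.inl)) (extend (s \ E) fun x => X (Sum.inr x)) e
  have hcard : Fintype.card σ < Fintype.card s := by
    simp only [σ, Fintype.card_sum, Fintype.card_fin, Fintype.card_coe,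
      Finset.card_sdiff_of_subset hE]
    have := Finset.card_le_card hE
    omega
  obtain ⟨h, h0, hh⟩ := exists_aeval_eq_zero_of_card_lt hcard Γ
  refine ⟨h, h0, fun c t h1 h2 => ?_⟩
  set c' := act (M.map (eval t)) c with hc'
  have hc : act (N.map (eval t)) c' = c := by
    have : M.map (eval t) * N.map (eval t) = 1 := by
      rw [← Matrix.map_mul, hMN, Matrix.map_one _ (map_zero _) (map_one _)]
    rw [hc', act_act, this, act_one]
  have hsupp : ∀ e ∉ s \ E, c' e = 0 := by
    intro e he
    rw [Finset.mem_sdiff, not_and_or, not_not] at he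
    exact he.elim (h1 e) (h2 e)
  let x : σ → ℂ := Sum.elim t fun e => c' e
  have hx : ∀ e : s, eval x (Γ e) = c e := by
    intro e
    simp only [Γ]
    rw [map_act]
    have h3 : (N.map (rename Sum.inl)).map (eval x) = N.map (eval t) := by
      ext i j
      simp only [Matrix.map_apply, eval_rename]
      rfl
    have h4 : (fun e => eval x (extend (s \ E) (fun y => (X (Sum.inr y) : MvPolynomial σ ℂ)) e)) =
        c' := by
      funext e
      rw [map_extend]
      simp only [eval_X, x, Sum.elim_inr]
      rw [extend_restrict hsupp]
    rw [h3, h4, hc]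
  have h5 := congrArg (eval x) hh
  simpa only [map_zero, eval_aeval, hx] using h5

/-- The exponents of the forms whose restriction to the line `z₃ = 0` vanishes to order at least
four at the point `(1 : 0 : 0)`. -/
def hyperflexExponents (d : ℕ) : Finset (Exponent d) :=
  Finset.univ.filter fun e => ¬ (e.1 2 = 0 ∧ e.1 1 < 4)

theorem mem_hyperflexExponents {e : Exponent d} :
    e ∈ hyperflexExponents d ↔ ¬ (e.1 2 = 0 ∧ e.1 1 < 4) := by simp [hyperflexExponents]

theorem eq_mon_of_notMem {e : Exponent d} (he : e ∉ hyperflexExponents d) :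
    ∃ k : Fin (d + 1), k.1 < 4 ∧ e = mon d 0 1 k := by
  rw [mem_hyperflexExponents, not_not] at he
  have h := sum_exponent e
  refine ⟨⟨e.1 1, by omega⟩, he.2, Subtype.ext (Finsupp.ext fun i => ?_)⟩
  fin_cases i
  · simp [mon]; omega
  · simp [mon]
  · simp [mon, he.1]

theorem coeff_mon_eq_zero {c : Exponent d → ℂ} {i j : Fin 3} (hij : i ≠ j) {m : ℕ}
    (h : Polynomial.X ^ m ∣ lineRestr (ofCoeffs c) (Pi.single i 1) (Pi.single j 1))
    {k : Fin (d + 1)} (hk : k.1 < m) : c (mon d i j k) = 0 := by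
  rw [← lineRestr_basis c hij k]
  exact Polynomial.X_pow_dvd_iff.mp h k hk

theorem X_pow_dvd_of_coeff_mon {c : Exponent d → ℂ} {i j : Fin 3} (hij : i ≠ j) {m : ℕ}
    (hm : m ≤ d + 1) (h : ∀ k : Fin (d + 1), k.1 < m → c (mon d i j k) = 0) :
    Polynomial.X ^ m ∣ lineRestr (ofCoeffs c) (Pi.single i 1) (Pi.single j 1) := by
  rw [Polynomial.X_pow_dvd_iff]
  intro k hk
  exact (lineRestr_basis c hij ⟨k, by omega⟩).trans (h _ hk)

theorem supported_iff (hd : 4 ≤ d) {c : Exponent d → ℂ} :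
    (∀ e ∉ hyperflexExponents d, c e = 0) ↔
      Polynomial.X ^ 4 ∣ lineRestr (ofCoeffs c) (Pi.single 0 1) (Pi.single 1 1) := by
  constructor
  · intro h
    refine X_pow_dvd_of_coeff_mon (by decide) (by omega) fun k hk => h _ ?_
    rw [mem_hyperflexExponents]
    simp [mon, hk]
  · intro h e he
    obtain ⟨k, hk, rfl⟩ := eq_mon_of_notMem he
    exact coeff_mon_eq_zero (by decide) h hk

/-- Upper triangular substitutions preserve the forms supported in `hyperflexExponents`. -/
theorem supported_act (hd : 4 ≤ d) {c : Exponent d → ℂ} (hc : ∀ e ∉ hyperflexExponents d, c e = 0)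
    (A : Matrix (Fin 3) (Fin 3) ℂ) (h00 : A 0 0 ≠ 0) (h10 : A 1 0 = 0) (h20 : A 2 0 = 0)
    (h21 : A 2 1 = 0) : ∀ e ∉ hyperflexExponents d, act A c e = 0 := by
  rw [supported_iff hd] at hc ⊢
  rw [ofCoeffs_act, lineRestr_subst]
  have h1 : A.mulVec (Pi.single 0 1) = A 0 0 • Pi.single 0 1 := by
    ext i; fin_cases i <;> simp [h10, h20]
  have h2 : A.mulVec (Pi.single 1 1) = A 0 1 • Pi.single 0 1 + A 1 1 • Pi.single 1 1 := by
    ext i; fin_cases i <;> simp [h21]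
  rw [h1, h2]
  exact X_pow_dvd_lineRestr (isHomogeneous_ofCoeffs c) hc h00 _ _


/-! ### Excluding further singularities and hyperflexes, cell by cell. -/

variable {d : ℕ}

theorem mon_injective {i j : Fin 3} (hij : i ≠ j) : Function.Injective (mon d i j) := by
  intro k l h
  have := DFunLike.congr_fun (congrArg Subtype.val h) j
  simp only [mon, Finsupp.add_apply, Finsupp.single_eq_same, Finsupp.single_apply, if_neg hij,
    zero_add] at this
  exact Fin.ext this

/-- Version of `exists_ne_zero_of_family` for upper triangular families. -/
theorem exists_ne_zero_of_upper (hd : 4 ≤ d) (E : Finset (Exponent d))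
    (hE : E ⊆ hyperflexExponents d) {n : ℕ} (hn : n < E.card)
    (M N : Matrix (Fin 3) (Fin 3) (MvPolynomial (Fin n) ℂ)) (hMN : M * N = 1)
    (h00 : M 0 0 = 1) (h10 : M 1 0 = 0) (h20 : M 2 0 = 0) (h21 : M 2 1 = 0) :
    ∃ h : MvPolynomial (hyperflexExponents d) ℂ, h ≠ 0 ∧ ∀ (c : Exponent d → ℂ),
      (∀ e ∉ hyperflexExponents d, c e = 0) →
      eval (fun e : hyperflexExponents d => c e) h ≠ 0 →
      ∀ t : Fin n → ℂ, ¬ ∀ e ∈ E, act (M.map (eval t)) c e = 0 := by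
  obtain ⟨h, h0, hh⟩ := exists_ne_zero_of_family _ E hE hn M N hMN
  refine ⟨h, h0, fun c hc hne t hv => hne (hh c t (supported_act hd hc _ ?_ ?_ ?_ ?_) hv)⟩ <;>
  simp [h00, h10, h20, h21]

/-- A contact of order m along a moved coordinate line is m linear conditions on the moved form,
against n < m parameters of motion. Upper triangular motions fix the standard flag and so keep the
moved form in the family. -/
theorem exists_ne_zero_of_line (hd : 4 ≤ d) {n m : ℕ} (hnm : n < m) (hm : m ≤ d + 1) {i j : Fin 3}
    (hij : i ≠ j) (hmem : ∀ k : Fin (d + 1), k.1 < m → mon d i j k ∈ hyperflexExponents d)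
    (M N : Matrix (Fin 3) (Fin 3) (MvPolynomial (Fin n) ℂ)) (hMN : M * N = 1)
    (h00 : M 0 0 = 1) (h10 : M 1 0 = 0) (h20 : M 2 0 = 0) (h21 : M 2 1 = 0) :
    ∃ h : MvPolynomial (hyperflexExponents d) ℂ, h ≠ 0 ∧ ∀ (c : Exponent d → ℂ),
      (∀ e ∉ hyperflexExponents d, c e = 0) →
      eval (fun e : hyperflexExponents d => c e) h ≠ 0 →
      ∀ t : Fin n → ℂ, ¬ Polynomial.X ^ m ∣ lineRestr (ofCoeffs c)
        ((M.map (eval t)).mulVec (Pi.single i 1)) ((M.map (eval t)).mulVec (Pi.single j 1)) := by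
  classical
  let f : Fin m → Exponent d := fun k => mon d i j ⟨k, by omega⟩
  have hf : Function.Injective f := by
    intro k l h
    have := mon_injective hij h
    simpa [Fin.ext_iff] using this
  obtain ⟨h, h0, hh⟩ := exists_ne_zero_of_upper hd (Finset.univ.image f) (by
      intro e he
      obtain ⟨k, -, rfl⟩ := Finset.mem_image.mp he
      exact hmem _ k.2) (by simpa [Finset.card_image_of_injective _ hf] using hnm)
    M N hMN h00 h10 h20 h21
  refine ⟨h, h0, fun c hc hne t hv => hh c hc hne t fun e he => ?_⟩
  obtain ⟨k, -, rfl⟩ := Finset.mem_image.mp he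
  refine coeff_mon_eq_zero hij ?_ (m := m) k.2
  rwa [ofCoeffs_act, lineRestr_subst]

/-- A singularity at (0:0:1) means that z₃^d, z₁ z₃^(d-1) and z₂ z₃^(d-1) have zero coefficients:
three conditions, against two parameters for a point off z₃ = 0. -/
theorem generic_singular_affine (hd : 4 ≤ d) :
    ∃ h : MvPolynomial (hyperflexExponents d) ℂ, h ≠ 0 ∧ ∀ (c : Exponent d → ℂ),
      (∀ e ∉ hyperflexExponents d, c e = 0) →
      eval (fun e : hyperflexExponents d => c e) h ≠ 0 →
      ∀ x y : ℂ, ¬ ∀ w, Polynomial.X ^ 2 ∣ lineRestr (ofCoeffs c) ![x, y, 1] w := by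
  classical
  let a : Exponent d := mon d 2 0 ⟨0, by omega⟩
  let b : Exponent d := mon d 2 0 ⟨1, by omega⟩
  let e : Exponent d := mon d 2 1 ⟨1, by omega⟩
  have hab : a ≠ b := fun h => by simpa using mon_injective (by decide) h
  have hae : a ≠ e := fun h => by
    have := DFunLike.congr_fun (congrArg Subtype.val h) 1
    simp [a, e, mon] at this
  have hbe : b ≠ e := fun h => by
    have := DFunLike.congr_fun (congrArg Subtype.val h) 1
    simp [b, e, mon] at this
  obtain ⟨h, h0, hh⟩ := exists_ne_zero_of_upper hd {a, b, e} (by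
      intro x hx
      simp only [Finset.mem_insert, Finset.mem_singleton] at hx
      rw [mem_hyperflexExponents]
      rcases hx with rfl | rfl | rfl <;> simp [a, b, e, mon] <;> omega) (n := 2)
    (by rw [Finset.card_eq_three.mpr ⟨a, b, e, hab, hae, hbe, rfl⟩]; norm_num)
    !![1, 0, X 0; 0, 1, X 1; 0, 0, 1] !![1, 0, -X 0; 0, 1, -X 1; 0, 0, 1]
    (by ext i j; fin_cases i <;> fin_cases j <;> simp [Matrix.mul_apply, Fin.sum_univ_three])
    (by simp) (by simp) (by simp) (by simp)
  refine ⟨h, h0, fun c hc hne x y hs => hh c hc hne ![x, y] ?_⟩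
  have hM : ∀ w, Polynomial.X ^ 2 ∣ lineRestr (ofCoeffs (act
      ((!![1, 0, X 0; 0, 1, X 1; 0, 0, 1] : Matrix (Fin 3) (Fin 3) (MvPolynomial (Fin 2) ℂ)).map
        (eval ![x, y])) c)) (Pi.single 2 1) w := by
    intro w
    rw [ofCoeffs_act, lineRestr_subst]
    convert hs _ using 2
    ext i; fin_cases i <;> simp
  intro k hk
  simp only [Finset.mem_insert, Finset.mem_singleton] at hk
  rcases hk with rfl | rfl | rfl
  · exact coeff_mon_eq_zero (by decide) (hM _) (by simp)
  · exact coeff_mon_eq_zero (by decide) (hM _) (by simp)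
  · exact coeff_mon_eq_zero (by decide) (hM _) (by simp)

/-- One parameter for a point of z₃ = 0 other than (1:0:0). Tangency to a single transversal line
already gives two conditions. -/
theorem generic_singular_line (hd : 4 ≤ d) :
    ∃ h : MvPolynomial (hyperflexExponents d) ℂ, h ≠ 0 ∧ ∀ (c : Exponent d → ℂ),
      (∀ e ∉ hyperflexExponents d, c e = 0) →
      eval (fun e : hyperflexExponents d => c e) h ≠ 0 →
      ∀ x : ℂ, ¬ Polynomial.X ^ 2 ∣ lineRestr (ofCoeffs c) ![x, 1, 0] (Pi.single 2 1) := by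
  obtain ⟨h, h0, hh⟩ := exists_ne_zero_of_line hd (n := 1) (m := 2) (by norm_num) (by omega)
    (i := 1) (j := 2) (by decide) (by
      intro k hk
      rw [mem_hyperflexExponents]
      simp only [mon, Finsupp.add_apply, Finsupp.single_apply]
      simp only [Fin.isValue, Fin.reduceEq, if_true, if_false]
      omega)
    !![1, X 0, 0; 0, 1, 0; 0, 0, 1] !![1, -X 0, 0; 0, 1, 0; 0, 0, 1]
    (by ext i j; fin_cases i <;> fin_cases j <;> simp [Matrix.mul_apply, Fin.sum_univ_three])
    (by simp) (by simp) (by simp) (by simp)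
  refine ⟨h, h0, fun c hc hne x hs => hh c hc hne ![x] ?_⟩
  convert hs using 2 <;> ext i <;> fin_cases i <;> simp

/-- Cell of flags with the point on z₃ = 0, away from (1:0:0), and another line: two parameters, so
contact three is enough for the count. -/
theorem generic_flag_line_transversal (hd : 4 ≤ d) :
    ∃ h : MvPolynomial (hyperflexExponents d) ℂ, h ≠ 0 ∧ ∀ (c : Exponent d → ℂ),
      (∀ e ∉ hyperflexExponents d, c e = 0) →
      eval (fun e : hyperflexExponents d => c e) h ≠ 0 →
      ∀ x y : ℂ, ¬ Polynomial.X ^ 3 ∣ lineRestr (ofCoeffs c) ![x, 1, 0] ![y, 0, 1] := by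
  obtain ⟨h, h0, hh⟩ := exists_ne_zero_of_line hd (n := 2) (m := 3) (by norm_num) (by omega)
    (i := 1) (j := 2) (by decide) (by
      intro k hk
      rw [mem_hyperflexExponents]
      simp only [mon, Finsupp.add_apply, Finsupp.single_apply]
      simp only [Fin.isValue, Fin.reduceEq, if_true, if_false]
      omega)
    !![1, X 0, X 1; 0, 1, 0; 0, 0, 1] !![1, -X 0, -X 1; 0, 1, 0; 0, 0, 1]
    (by ext i j; fin_cases i <;> fin_cases j <;> simp [Matrix.mul_apply, Fin.sum_univ_three])
    (by simp) (by simp) (by simp) (by simp)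
  refine ⟨h, h0, fun c hc hne x y hs => hh c hc hne ![x, y] ?_⟩
  convert hs using 2 <;> ext i <;> fin_cases i <;> simp

/-- Cell of flags with line z₃ = 0 and a point other than (1:0:0): one parameter, two conditions.
The count needs z₁ z₂^(d-1) to be a free monomial, which fails for d = 4. In that case the
restriction to z₃ = 0 is a multiple of z₂⁴, with no zero off (1:0:0) unless it is identically zero.
-/
theorem generic_flag_line_tangent (hd : 4 ≤ d) :
    ∃ h : MvPolynomial (hyperflexExponents d) ℂ, h ≠ 0 ∧ ∀ (c : Exponent d → ℂ),
      (∀ e ∉ hyperflexExponents d, c e = 0) →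
      eval (fun e : hyperflexExponents d => c e) h ≠ 0 →
      ∀ x : ℂ, ¬ Polynomial.X ^ 2 ∣ lineRestr (ofCoeffs c) ![x, 1, 0] (Pi.single 0 1) := by
  rcases hd.eq_or_lt with hd4 | hd5
  · -- a quartic in the family restricts to a multiple of `z₂ ^ 4`
    have hmem : mon d 0 1 ⟨4, by omega⟩ ∈ hyperflexExponents d := by
      rw [mem_hyperflexExponents]
      simp [mon]
    refine ⟨X ⟨_, hmem⟩, X_ne_zero _, fun c hc hne x hs => hne ?_⟩
    rw [eval_X]
    set M : Matrix (Fin 3) (Fin 3) ℂ := !![1, x, 0; 0, 1, 0; 0, 0, 1] with hM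
    have h0 : M.mulVec (Pi.single 0 1) = Pi.single 0 1 := by
      ext i; fin_cases i <;> simp [hM]
    have h1 : M.mulVec (Pi.single 1 1) = ![x, 1, 0] := by
      ext i; fin_cases i <;> simp [hM]
    have h2 := (supported_iff hd).mp
      (supported_act hd hc M (by simp [hM]) (by simp [hM]) (by simp [hM]) (by simp [hM]))
    have h3 : act M c (mon d 1 0 ⟨0, by omega⟩) = 0 :=
      coeff_mon_eq_zero (m := 2) (by decide)
        (by rw [ofCoeffs_act, lineRestr_subst, h0, h1]; exact hs) (by simp)
    have h4 : mon d 1 0 ⟨0, by omega⟩ = mon d 0 1 ⟨4, by omega⟩ := by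
      apply Subtype.ext
      simp [mon, ← hd4]
    have h5 : Polynomial.X ^ 5 ∣ lineRestr (ofCoeffs (act M c)) (Pi.single 0 1) (Pi.single 1 1) :=
      X_pow_dvd_of_coeff_mon (by decide) (by omega) fun k hk => by
        rcases (show k.1 ≤ 4 by omega).eq_or_lt with h | h
        · rw [← h3, h4]
          congr 2
          exact Fin.ext h
        · exact coeff_mon_eq_zero (by decide) h2 h
    rw [ofCoeffs_act, lineRestr_subst, h0, h1] at h5
    have h6 := X_pow_dvd_lineRestr (isHomogeneous_ofCoeffs c) h5 one_ne_zero (-x) 1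
    refine coeff_mon_eq_zero (m := 5) (by decide) ?_ (by simp)
    convert h6 using 2
    · simp
    · ext i; fin_cases i <;> simp
  · obtain ⟨h, h0, hh⟩ := exists_ne_zero_of_line hd (n := 1) (m := 2) (by norm_num) (by omega)
      (i := 1) (j := 0) (by decide) (by
        intro k hk
        rw [mem_hyperflexExponents]
        simp [mon]; omega)
      !![1, X 0, 0; 0, 1, 0; 0, 0, 1] !![1, -X 0, 0; 0, 1, 0; 0, 0, 1]
      (by ext i j; fin_cases i <;> fin_cases j <;> simp [Matrix.mul_apply, Fin.sum_univ_three])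
      (by simp) (by simp) (by simp) (by simp)
    refine ⟨h, h0, fun c hc hne x hs => hh c hc hne ![x] ?_⟩
    convert hs using 2 <;> ext i <;> fin_cases i <;> simp

/-- Open cell: the point is off z₃ = 0 and the line avoids (1:0:0). Three parameters against four
conditions, so the full contact order four is needed here. -/
theorem generic_flag_affine (hd : 4 ≤ d) :
    ∃ h : MvPolynomial (hyperflexExponents d) ℂ, h ≠ 0 ∧ ∀ (c : Exponent d → ℂ),
      (∀ e ∉ hyperflexExponents d, c e = 0) →
      eval (fun e : hyperflexExponents d => c e) h ≠ 0 →
      ∀ x y s : ℂ, ¬ Polynomial.X ^ 4 ∣ lineRestr (ofCoeffs c) ![x, y, 1] ![s, 1, 0] := by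
  obtain ⟨h, h0, hh⟩ := exists_ne_zero_of_line hd (n := 3) (m := 4) (by norm_num) (by omega)
    (i := 2) (j := 1) (by decide) (by
      intro k hk
      rw [mem_hyperflexExponents]
      simp [mon]; omega)
    !![1, X 2, X 0; 0, 1, X 1; 0, 0, 1] !![1, -X 2, X 2 * X 1 - X 0; 0, 1, -X 1; 0, 0, 1]
    (Matrix.ext fun i j => by
      fin_cases i <;> fin_cases j <;> simp [Matrix.mul_apply, Fin.sum_univ_three]
      ring)
    (by simp) (by simp) (by simp) (by simp)
  refine ⟨h, h0, fun c hc hne x y s hs => hh c hc hne ![x, y, s] ?_⟩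
  convert hs using 2 <;> ext i <;> fin_cases i <;> simp

/-- Last cell: the point is off z₃ = 0 and its line passes through (1:0:0), so only the two
parameters of the point remain. -/
theorem generic_flag_affine_horizontal (hd : 4 ≤ d) :
    ∃ h : MvPolynomial (hyperflexExponents d) ℂ, h ≠ 0 ∧ ∀ (c : Exponent d → ℂ),
      (∀ e ∉ hyperflexExponents d, c e = 0) →
      eval (fun e : hyperflexExponents d => c e) h ≠ 0 →
      ∀ x y : ℂ, ¬ Polynomial.X ^ 3 ∣ lineRestr (ofCoeffs c) ![x, y, 1] (Pi.single 0 1) := by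
  obtain ⟨h, h0, hh⟩ := exists_ne_zero_of_line hd (n := 2) (m := 3) (by norm_num) (by omega)
    (i := 2) (j := 0) (by decide) (by
      intro k hk
      rw [mem_hyperflexExponents]
      simp [mon]; omega)
    !![1, 0, X 0; 0, 1, X 1; 0, 0, 1] !![1, 0, -X 0; 0, 1, -X 1; 0, 0, 1]
    (by ext i j; fin_cases i <;> fin_cases j <;> simp [Matrix.mul_apply, Fin.sum_univ_three])
    (by simp) (by simp) (by simp) (by simp)
  refine ⟨h, h0, fun c hc hne x y hs => hh c hc hne ![x, y] ?_⟩
  convert hs using 2 <;> ext i <;> fin_cases i <;> simp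

/-- A nonsingular form whose only contact of order at least four with a line is a contact of order
exactly four at a point `p` with the line through `p` and `q`. -/
structure IsGenericHyperflex (F : MvPolynomial (Fin 3) ℂ) (p q : Fin 3 → ℂ) : Prop where
  nonsingular : ∀ z : Fin 3 → ℂ, z ≠ 0 → ¬ ∀ w, Polynomial.X ^ 2 ∣ lineRestr F z w
  unique : ∀ z w : Fin 3 → ℂ, (∀ s t : ℂ, s • z + t • w = 0 → s = 0 ∧ t = 0) →
    Polynomial.X ^ 4 ∣ lineRestr F z w → ∃ l : ℂ, z = l • p
  order_ge : Polynomial.X ^ 4 ∣ lineRestr F p q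
  order_lt : ¬ Polynomial.X ^ 5 ∣ lineRestr F p q

/-- The general form with a contact of order four along `z₃ = 0` at `(1 : 0 : 0)` has no other
singularity or contact of that order. -/
theorem exists_isGenericHyperflex (hd : 4 ≤ d) :
    ∃ h : MvPolynomial (hyperflexExponents d) ℂ, h ≠ 0 ∧ ∀ (c : Exponent d → ℂ),
      (∀ e ∉ hyperflexExponents d, c e = 0) →
      eval (fun e : hyperflexExponents d => c e) h ≠ 0 →
      IsGenericHyperflex (ofCoeffs c) (Pi.single 0 1) (Pi.single 1 1) := by
  obtain ⟨h1, h10, hh1⟩ := generic_singular_affine hd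
  obtain ⟨h2, h20, hh2⟩ := generic_singular_line hd
  obtain ⟨h3, h30, hh3⟩ := generic_flag_line_transversal hd
  obtain ⟨h4, h40, hh4⟩ := generic_flag_line_tangent hd
  obtain ⟨h5, h50, hh5⟩ := generic_flag_affine hd
  obtain ⟨h6, h60, hh6⟩ := generic_flag_affine_horizontal hd
  have m7 : mon d 0 2 ⟨1, by omega⟩ ∈ hyperflexExponents d := by
    rw [mem_hyperflexExponents]
    simp [mon]
  have m8 : mon d 0 1 ⟨4, by omega⟩ ∈ hyperflexExponents d := by
    rw [mem_hyperflexExponents]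
    simp [mon]
  -- The last two factors are the coefficients of z₁^(d-1) z₃, which makes (1:0:0) smooth, and of
  -- z₁^(d-4) z₂⁴, which makes the contact there exactly four.
  refine ⟨h1 * h2 * h3 * h4 * h5 * h6 * X ⟨_, m7⟩ * X ⟨_, m8⟩, by
    simp [h10, h20, h30, h40, h50, h60, X_ne_zero], fun c hc hne => ?_⟩
  simp only [map_mul, mul_ne_zero_iff, eval_X] at hne
  obtain ⟨⟨⟨⟨⟨⟨⟨e1, e2⟩, e3⟩, e4⟩, e5⟩, e6⟩, e7⟩, e8⟩ := hne
  have hF := isHomogeneous_ofCoeffs c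
  refine ⟨?_, ?_, (supported_iff hd).mp hc, ?_⟩
  · intro z hz hs
    by_cases hz2 : z 2 = 0
    · by_cases hz1 : z 1 = 0
      · have hz0 : z 0 ≠ 0 := by
          intro h; apply hz; ext i; fin_cases i <;> simp [h, hz1, hz2]
        apply e7
        refine coeff_mon_eq_zero (m := 2) (by decide) ?_ (by simp)
        convert X_pow_dvd_lineRestr hF (hs (Pi.single 2 1)) (inv_ne_zero hz0) 0 1 using 2
        · ext i; fin_cases i <;> simp [hz0, hz1, hz2]
        · simp
      · apply hh2 c hc e2 (z 0 / z 1)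
        convert X_pow_dvd_lineRestr hF (hs (Pi.single 2 1)) (inv_ne_zero hz1) 0 1 using 2
        · ext i; fin_cases i <;> simp [hz1, hz2]; field_simp
        · simp
    · apply hh1 c hc e1 (z 0 / z 2) (z 1 / z 2)
      intro w
      convert X_pow_dvd_lineRestr hF (hs w) (inv_ne_zero hz2) 0 1 using 2
      · ext i; fin_cases i <;> simp [hz2] <;> field_simp
      · simp
  · intro z w hind hs
    -- The flag spanned by z and w is sorted into its cell: is z on z₃ = 0, and is its line z₃ = 0
    -- itself or a line through (1:0:0)? The scalars passed to `X_pow_dvd_lineRestr` normalize z and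
    -- w to the representatives of that cell.
    by_cases hz2 : z 2 = 0
    · by_cases hz1 : z 1 = 0
      · exact ⟨z 0, by ext i; fin_cases i <;> simp [hz1, hz2]⟩
      · exfalso
        by_cases hw2 : w 2 = 0
        · have hD : w 0 * z 1 - w 1 * z 0 ≠ 0 := by
            intro hD
            have := hind (w 1) (-z 1) (by
              ext i; fin_cases i <;> simp [hz2, hw2]
              · linear_combination -hD
              · ring)
            exact hz1 (by simpa using this.2)
          apply hh4 c hc e4 (z 0 / z 1)
          refine (pow_dvd_pow _ (by norm_num : 2 ≤ 4)).trans ?_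
          convert X_pow_dvd_lineRestr hF hs (inv_ne_zero hz1) (-w 1 / (w 0 * z 1 - w 1 * z 0))
            (z 1 / (w 0 * z 1 - w 1 * z 0)) using 2
          · ext i; fin_cases i <;> simp [hz1, hz2]; field_simp
          · ext i; fin_cases i <;> simp [hz2, hw2] <;> field_simp <;> ring
        · apply hh3 c hc e3 (z 0 / z 1) ((w 0 - w 1 / z 1 * z 0) / w 2)
          refine (pow_dvd_pow _ (by norm_num : 3 ≤ 4)).trans ?_
          convert X_pow_dvd_lineRestr hF hs (inv_ne_zero hz1) (-w 1 / (z 1 * w 2)) (1 / w 2)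
            using 2
          · ext i; fin_cases i <;> simp [hz1, hz2]; field_simp
          · ext i; fin_cases i <;> simp [hz2, hw2] <;> field_simp <;> ring
    · exfalso
      by_cases hw1 : w 1 - w 2 / z 2 * z 1 = 0
      · have hD : w 0 - w 2 / z 2 * z 0 ≠ 0 := by
          intro hD
          have := hind (-w 2 / z 2) 1 (by
            ext i; fin_cases i <;> simp
            · linear_combination hD
            · linear_combination hw1
            · field_simp; ring)
          exact one_ne_zero this.2
        apply hh6 c hc e6 (z 0 / z 2) (z 1 / z 2)
        refine (pow_dvd_pow _ (by norm_num : 3 ≤ 4)).trans ?_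
        convert X_pow_dvd_lineRestr hF hs (inv_ne_zero hz2)
          (-(w 2 / z 2) / (w 0 - w 2 / z 2 * z 0)) (1 / (w 0 - w 2 / z 2 * z 0)) using 2
        · ext i; fin_cases i <;> simp [hz2] <;> field_simp
        · generalize hE : w 0 - w 2 / z 2 * z 0 = E at hD ⊢
          ext i; fin_cases i <;> simp
          · field_simp; rw [← hE]; field_simp; ring
          · field_simp; field_simp at hw1; linear_combination -hw1
          · field_simp; ring
      · apply hh5 c hc e5 (z 0 / z 2) (z 1 / z 2)
          ((w 0 - w 2 / z 2 * z 0) / (w 1 - w 2 / z 2 * z 1))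
        convert X_pow_dvd_lineRestr hF hs (inv_ne_zero hz2)
          (-(w 2 / z 2) / (w 1 - w 2 / z 2 * z 1)) (1 / (w 1 - w 2 / z 2 * z 1)) using 2
        · ext i; fin_cases i <;> simp [hz2] <;> field_simp
        · generalize hE : w 1 - w 2 / z 2 * z 1 = E at hw1 ⊢
          ext i; fin_cases i <;> simp
          · field_simp; ring
          · field_simp; rw [← hE]; field_simp; ring
          · field_simp; ring
  · intro h
    exact e8 (coeff_mon_eq_zero (by decide) h (by simp))


/-! ### The family of pairs (matrix, form) and its vanishing ideal. -/

variable {d : ℕ}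

/-- Index type for the entries of a `3 × 3` matrix and the coefficients of a form supported in
`hyperflexExponents d`. -/
abbrev FlagParam (d : ℕ) : Type := (Fin 3 × Fin 3) ⊕ hyperflexExponents d

/-- The matrix part of a point of the parameter space. -/
def matrixOf {R : Type*} (x : FlagParam d → R) : Matrix (Fin 3) (Fin 3) R :=
  Matrix.of fun i j => x (Sum.inl (i, j))

/-- The form part of a point of the parameter space. -/
def coeffsOf {R : Type*} [CommRing R] (x : FlagParam d → R) : Exponent d → R :=
  extend _ fun e => x (Sum.inr e)

/-- Composition with the map `(g, F) ↦ F ∘ g`. -/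
def pullback (d : ℕ) : MvPolynomial (Exponent d) ℂ →ₐ[ℂ] MvPolynomial (FlagParam d) ℂ :=
  aeval (act (matrixOf X) (coeffsOf X))

theorem eval_pullback (x : FlagParam d → ℂ) (P : MvPolynomial (Exponent d) ℂ) :
    eval x (pullback d P) = eval (act (matrixOf x) (coeffsOf x)) P := by
  have h1 : (matrixOf (X : FlagParam d → MvPolynomial (FlagParam d) ℂ)).map (eval x) =
      matrixOf x := by
    ext i j; simp [matrixOf]
  have h2 : (fun e => eval x (coeffsOf (X : FlagParam d → MvPolynomial (FlagParam d) ℂ) e)) =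
      coeffsOf x := by
    funext e
    rw [coeffsOf, map_extend]
    simp only [eval_X, coeffsOf]
  have h3 : (fun e => eval x (act (matrixOf X) (coeffsOf X) e)) =
      act (matrixOf x) (coeffsOf x) := by
    funext e
    rw [map_act, h1, h2]
  rw [pullback, eval_aeval, h3]

theorem coeffsOf_supported (x : FlagParam d → ℂ) :
    ∀ e ∉ hyperflexExponents d, coeffsOf x e = 0 := fun _ he => extend_of_notMem _ he

/-- The ideal of polynomials vanishing on the forms with a contact of order four with a line. -/
def hyperflexIdeal (d : ℕ) : Ideal (MvPolynomial (Exponent d) ℂ) := RingHom.ker (pullback d)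

instance : (hyperflexIdeal d).IsPrime := RingHom.ker_isPrime _

theorem mem_hyperflexIdeal {P : MvPolynomial (Exponent d) ℂ} :
    P ∈ hyperflexIdeal d ↔ ∀ x, eval (act (matrixOf x) (coeffsOf x)) P = 0 := by
  rw [hyperflexIdeal, RingHom.mem_ker]
  simp only [← eval_pullback]
  exact ⟨fun h x => by rw [h, map_zero], fun h => MvPolynomial.funext fun x => by rw [h, map_zero]⟩

/-- The point of the parameter space given by a matrix and a form. -/
def flagPoint (g : Matrix (Fin 3) (Fin 3) ℂ) (c : Exponent d → ℂ) : FlagParam d → ℂ :=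
  Sum.elim (fun ij => g ij.1 ij.2) fun e => c e

@[simp]
theorem matrixOf_flagPoint (g : Matrix (Fin 3) (Fin 3) ℂ) (c : Exponent d → ℂ) :
    matrixOf (flagPoint g c) = g := rfl

theorem coeffsOf_flagPoint (g : Matrix (Fin 3) (Fin 3) ℂ) {c : Exponent d → ℂ}
    (hc : ∀ e ∉ hyperflexExponents d, c e = 0) : coeffsOf (flagPoint g c) = c :=
  extend_restrict hc

/-- A general matrix is upper triangular times lower unitriangular, and upper triangular ones
preserve the linear space of forms. So three parameters suffice to make four coefficients vanish,
and the dimension count applies. -/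
theorem hyperflexIdeal_ne_bot (hd : 4 ≤ d) : hyperflexIdeal d ≠ ⊥ := by
  classical
  let f : Fin 4 → Exponent d := fun k => mon d 0 1 ⟨k, by omega⟩
  have hf : Function.Injective f := by
    intro k l h
    have := mon_injective (by decide) h
    simpa [Fin.ext_iff] using this
  obtain ⟨h, h0, hh⟩ := exists_ne_zero_of_family (Finset.univ : Finset (Exponent d))
    (Finset.univ.image f) (Finset.subset_univ _) (n := 3)
    (by simp [Finset.card_image_of_injective _ hf])
    !![1, 0, 0; X 0, 1, 0; X 1, X 2, 1] !![1, 0, 0; -X 0, 1, 0; X 0 * X 2 - X 1, -X 2, 1]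
    (Matrix.ext fun i j => by
      fin_cases i <;> fin_cases j <;> simp [Matrix.mul_apply, Fin.sum_univ_three]
      ring)
  rw [Submodule.ne_bot_iff]
  refine ⟨rename Subtype.val h, ?_, fun h' => h0 (rename_injective _ Subtype.val_injective
    (by rw [h', map_zero]))⟩
  let g : Matrix (Fin 3) (Fin 3) (MvPolynomial (FlagParam d) ℂ) := matrixOf X
  -- Product of the trailing principal minors of g. Where it is nonzero the triangular factorization
  -- exists, and it can be cancelled from a polynomial identity.
  let D : MvPolynomial (FlagParam d) ℂ := g 2 2 * (g 1 1 * g 2 2 - g 1 2 * g 2 1) * g.det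
  have hD : D ≠ 0 := by
    intro h
    have := congrArg (eval (flagPoint 1 0)) h
    simp [D, g, matrixOf, flagPoint, Matrix.det_fin_three] at this
  have key : pullback d (rename Subtype.val h) * D = 0 := by
    refine MvPolynomial.funext fun x => ?_
    rw [map_mul, map_zero, eval_pullback, mul_eq_zero, or_iff_not_imp_right]
    intro hDx
    set A : Matrix (Fin 3) (Fin 3) ℂ := matrixOf x with hA
    have hDx' : A 2 2 * (A 1 1 * A 2 2 - A 1 2 * A 2 1) * A.det ≠ 0 := by
      convert hDx using 1
      simp [D, g, matrixOf, hA, Matrix.det_fin_three]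
    obtain ⟨⟨hA2, hA1⟩, hA0⟩ : (A 2 2 ≠ 0 ∧ (A 1 1 * A 2 2 - A 1 2 * A 2 1) ≠ 0) ∧ A.det ≠ 0 := by
      simpa [mul_ne_zero_iff] using hDx'
    set Δ := A 1 1 * A 2 2 - A 1 2 * A 2 1 with hΔ
    -- Cramer's rule for the three equations making A * M upper triangular.
    set t : Fin 3 → ℂ := ![(A 1 2 * A 2 0 - A 1 0 * A 2 2) / Δ,
      (A 1 0 * A 2 1 - A 1 1 * A 2 0) / Δ, -A 2 1 / A 2 2] with ht
    set M : Matrix (Fin 3) (Fin 3) ℂ :=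
      (!![1, 0, 0; X 0, 1, 0; X 1, X 2, 1] : Matrix _ _ (MvPolynomial (Fin 3) ℂ)).map (eval t)
      with hM
    have hM' : M = !![1, 0, 0; t 0, 1, 0; t 1, t 2, 1] := by
      ext i j; fin_cases i <;> fin_cases j <;> simp [hM]
    have hB := supported_act hd (coeffsOf_supported x) (A * M)
      (by
        have : (A * M) 0 0 = A.det / Δ := by
          simp [hM', Matrix.mul_apply, Fin.sum_univ_three, ht, Matrix.det_fin_three]
          field_simp
          rw [hΔ]; ring
        rw [this]
        exact div_ne_zero hA0 hA1)
      (by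
        simp [hM', Matrix.mul_apply, Fin.sum_univ_three, ht]
        field_simp
        rw [hΔ]; ring)
      (by
        simp [hM', Matrix.mul_apply, Fin.sum_univ_three, ht]
        field_simp
        rw [hΔ]; ring)
      (by
        simp [hM', Matrix.mul_apply, Fin.sum_univ_three, ht]
        field_simp
        ring)
    rw [eval_rename]
    refine hh (act A (coeffsOf x)) t (by simp) fun e he => ?_
    rw [← hM, act_act]
    apply hB
    obtain ⟨k, -, rfl⟩ := Finset.mem_image.mp he
    rw [mem_hyperflexExponents]
    simp [f, mon]
  exact (mul_eq_zero.mp key).resolve_right hD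


/-! ### Codimension at most one, from a derivative at one form. -/

/-- A polynomial vanishing on a neighbourhood of a point is zero. -/
theorem eq_zero_of_eventually_eval_eq_zero {τ : Type*} [Fintype τ] {P : MvPolynomial τ ℂ}
    {y : τ → ℂ} (h : ∀ᶠ z in nhds y, eval z P = 0) : P = 0 := by
  obtain ⟨ε, hε, hb⟩ := Metric.eventually_nhds_iff_ball.mp h
  refine MvPolynomial.funext_set (fun i => Metric.ball (y i) ε)
    (fun i => infinite_of_mem_nhds (y i) (Metric.ball_mem_nhds _ hε)) fun z hz => ?_
  rw [map_zero]
  apply hb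
  rwa [ball_pi _ hε]

/-- A polynomial map whose derivative is onto at some point is dominant. -/
theorem eq_zero_of_aeval_eq_zero {σ τ : Type*} [Fintype σ] [Fintype τ]
    (Γ : τ → MvPolynomial σ ℂ) (x : σ → ℂ)
    (hsurj : ∀ W : Submodule ℂ (τ → ℂ), (∀ (w : σ → ℂ) (y : τ → ℂ),
      (∀ e, HasDerivAt (fun s : ℂ => eval (x + s • w) (Γ e)) (y e) 0) → y ∈ W) → W = ⊤)
    {P : MvPolynomial τ ℂ} (hP : aeval Γ P = 0) : P = 0 := by
  let Ψ : (σ → ℂ) → (τ → ℂ) := fun x e => eval x (Γ e)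
  have hΨ : AnalyticAt ℂ Ψ x := by
    rw [analyticAt_pi_iff]
    intro e
    exact AnalyticOnNhd.eval_mvPolynomial (Γ e) x (Set.mem_univ x)
  have hstrict := hΨ.hasStrictFDerivAt
  have hrange : (fderiv ℂ Ψ x).range = ⊤ := by
    apply hsurj
    intro w y hy
    refine ⟨w, ?_⟩
    have h1 : HasDerivAt (fun s : ℂ => Ψ (x + s • w)) y 0 := hasDerivAt_pi.mpr hy
    have h2 : HasDerivAt (fun s : ℂ => Ψ (x + s • w)) (fderiv ℂ Ψ x w) 0 :=
      hstrict.hasFDerivAt.hasLineDerivAt w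
    exact h2.unique h1
  -- A surjective derivative makes the map open at x, so P vanishes on a whole neighbourhood of the
  -- image point.
  have hmap := hstrict.map_nhds_eq_of_surj hrange
  apply eq_zero_of_eventually_eval_eq_zero (y := Ψ x)
  rw [← hmap, Filter.eventually_map]
  refine Filter.Eventually.of_forall fun z => ?_
  have := congrArg (eval z) hP
  rwa [eval_aeval, map_zero] at this

variable {d : ℕ}

/-- The form `z₁ ^ (d - 1) z₃ + z₁ ^ (d - 2) z₂ z₃ + z₁ ^ (d - 4) z₂ ^ 4`, at which the family of
forms with a contact of order four is immersed. -/
def baseForm (d : ℕ) : MvPolynomial (Fin 3) ℂ :=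
  X 0 ^ (d - 1) * X 2 + X 0 ^ (d - 2) * X 1 * X 2 + X 0 ^ (d - 4) * X 1 ^ 4

theorem isHomogeneous_baseForm (hd : 4 ≤ d) : (baseForm d).IsHomogeneous d := by
  have h0 := fun n => isHomogeneous_X_pow (R := ℂ) (0 : Fin 3) n
  refine ((?_ : IsHomogeneous _ _).add ?_).add ?_
  · convert (h0 (d - 1)).mul (isHomogeneous_X ℂ (2 : Fin 3)) using 1; omega
  · convert ((h0 (d - 2)).mul (isHomogeneous_X ℂ (1 : Fin 3))).mul
      (isHomogeneous_X ℂ (2 : Fin 3)) using 1; omega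
  · convert (h0 (d - 4)).mul (isHomogeneous_X_pow (1 : Fin 3) 4) using 1; omega

theorem X_pow_mul_X_pow (i j : Fin 3) (k : Fin (d + 1)) :
    (X i ^ (d - k.1) * X j ^ k.1 : MvPolynomial (Fin 3) ℂ) = monomial (mon d i j k).1 1 := by
  rw [X_pow_eq_monomial, X_pow_eq_monomial, monomial_mul, one_mul]
  rfl

theorem baseForm_supported (hd : 4 ≤ d) :
    ∀ e ∉ hyperflexExponents d, coeff e.1 (baseForm d) = 0 := by
  rw [supported_iff hd, ofCoeffs_coeff (isHomogeneous_baseForm hd)]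
  simp only [lineRestr, baseForm, map_add, map_mul, map_pow, aeval_X]
  simp

/-- The lower unitriangular matrix with given entries. -/
def lowerMatrix {R : Type*} [CommRing R] (a b c : R) : Matrix (Fin 3) (Fin 3) R :=
  !![1, 0, 0; a, 1, 0; b, c, 1]

theorem lowerMatrix_zero {R : Type*} [CommRing R] : lowerMatrix (0 : R) 0 0 = 1 := by
  ext i j; fin_cases i <;> fin_cases j <;> simp [lowerMatrix]

theorem subst_lowerMatrix_baseForm (a b c : ℂ) :
    subst (lowerMatrix a b c) (baseForm d) =
      X 0 ^ (d - 1) * (C b * X 0 + C c * X 1 + X 2) +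
        X 0 ^ (d - 2) * (C a * X 0 + X 1) * (C b * X 0 + C c * X 1 + X 2) +
        X 0 ^ (d - 4) * (C a * X 0 + X 1) ^ 4 := by
  simp [subst, baseForm, lowerMatrix, Fin.sum_univ_three]

/-- Dropping the coefficient of z₁^d, the family is still dominant: its derivative at `baseForm` is
onto. The coefficient directions give every monomial of `hyperflexExponents`, and the three lower
triangular directions supply the missing z₁^(d-k) z₂^k for k = 1, 2, 3. -/
theorem hyperflexIdeal_elim (hd : 4 ≤ d)
    {P : MvPolynomial {e : Exponent d // e ≠ mon d 0 1 0} ℂ}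
    (hP : rename Subtype.val P ∈ hyperflexIdeal d) : P = 0 := by
  classical
  let σ := Fin 3 ⊕ hyperflexExponents d
  let xl : Fin 3 → MvPolynomial σ ℂ := fun i => X (Sum.inl i)
  let c : Exponent d → MvPolynomial σ ℂ := extend _ fun e => X (Sum.inr e)
  let Γ : {e : Exponent d // e ≠ mon d 0 1 0} → MvPolynomial σ ℂ := fun e =>
    act (lowerMatrix (xl 0) (xl 1) (xl 2)) c e
  let cx : (σ → ℂ) → Exponent d → ℂ := fun x => extend _ fun e => x (Sum.inr e)
  have hΓ : ∀ x e, eval x (Γ e) = act (lowerMatrix (x (Sum.inl 0)) (x (Sum.inl 1))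
      (x (Sum.inl 2))) (cx x) e := by
    intro x e
    simp only [Γ]
    rw [map_act]
    have h1 : (lowerMatrix (xl 0) (xl 1) (xl 2)).map (eval x) =
        lowerMatrix (x (Sum.inl 0)) (x (Sum.inl 1)) (x (Sum.inl 2)) := by
      ext i j; fin_cases i <;> fin_cases j <;> simp [lowerMatrix, xl]
    have h2 : (fun e => eval x (c e)) = cx x := by
      funext e
      simp only [c, cx]
      rw [map_extend]
      simp only [eval_X]
    rw [h1, h2]
  have hv : aeval Γ P = 0 := by
    refine MvPolynomial.funext fun x => ?_
    rw [eval_aeval, map_zero]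
    have h1 := mem_hyperflexIdeal.mp hP (flagPoint (lowerMatrix (x (Sum.inl 0)) (x (Sum.inl 1))
      (x (Sum.inl 2))) (cx x))
    rw [eval_rename, matrixOf_flagPoint,
      coeffsOf_flagPoint _ (fun e he => extend_of_notMem _ he)] at h1
    simp only [hΓ]
    exact h1
  let c₀ : Exponent d → ℂ := fun e => coeff e.1 (baseForm d)
  let x₀ : σ → ℂ := Sum.elim 0 fun e => c₀ e
  have hcx₀ : cx x₀ = c₀ := extend_restrict (baseForm_supported hd)
  have hof : ofCoeffs c₀ = baseForm d := ofCoeffs_coeff (isHomogeneous_baseForm hd)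
  refine eq_zero_of_aeval_eq_zero Γ x₀ (fun W hW => ?_) hv
  have hinl : ∀ (i : Fin 3) (s : ℂ) (e),
      eval (x₀ + s • Pi.single (Sum.inl i) 1) (Γ e) =
      coeff e.1.1 (subst (lowerMatrix ((Pi.single i s : Fin 3 → ℂ) 0) ((Pi.single i s : Fin 3 → ℂ) 1)
        ((Pi.single i s : Fin 3 → ℂ) 2)) (baseForm d)) := by
    intro i s e
    rw [hΓ, act]
    have h1 : cx (x₀ + s • Pi.single (Sum.inl i) 1) = c₀ := by
      rw [← hcx₀]
      simp [cx]
    have h2 : ∀ j, (x₀ + s • Pi.single (Sum.inl i) 1 : σ → ℂ) (Sum.inl j) =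
        (Pi.single i s : Fin 3 → ℂ) j := by
      intro j
      simp [x₀, Pi.single_apply]
    rw [h1, h2, h2, h2, hof]
  -- directions along the coefficients
  have hin : ∀ e : {e : Exponent d // e ≠ mon d 0 1 0}, e.1 ∈ hyperflexExponents d →
      Pi.single e 1 ∈ W := by
    intro e he
    apply hW (Pi.single (Sum.inr ⟨e.1, he⟩) 1)
    intro e'
    have h1 : ∀ s : ℂ, eval (x₀ + s • Pi.single (Sum.inr ⟨e.1, he⟩) 1) (Γ e') =
        c₀ e' + s * (Pi.single e 1 : _ → ℂ) e' := by
      intro s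
      rw [hΓ]
      have h2 : ∀ j, (x₀ + s • Pi.single (Sum.inr ⟨e.1, he⟩) 1 : σ → ℂ) (Sum.inl j) = 0 := by
        intro j
        simp [x₀]
      rw [h2, h2, h2, lowerMatrix_zero, act_one]
      by_cases h : e'.1 ∈ hyperflexExponents d
      · simp only [cx]
        rw [extend_of_mem _ h]
        by_cases h3 : e' = e
        · subst h3
          simp [x₀]
        · have h4 : (⟨e'.1, h⟩ : hyperflexExponents d) ≠ ⟨e.1, he⟩ :=
            fun h5 => h3 (Subtype.ext (by simpa using h5))
          simp [x₀, h3, h4]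
      · simp only [cx]
        rw [extend_of_notMem _ h]
        have h3 : e' ≠ e := by rintro rfl; exact h he
        simp [c₀, baseForm_supported hd _ h, h3]
    simp only [h1]
    simpa using ((hasDerivAt_id (0 : ℂ)).mul_const ((Pi.single e 1 : _ → ℂ) e')).const_add (c₀ e')
  obtain ⟨m, rfl⟩ : ∃ m, d = m + 4 := ⟨d - 4, by omega⟩
  have hX : ∀ (i j : Fin 3) (k : Fin (m + 4 + 1)) (e : Exponent (m + 4)),
      coeff e.1 (X i ^ (m + 4 - k.1) * X j ^ k.1 : MvPolynomial (Fin 3) ℂ) =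
        if e = mon (m + 4) i j k then 1 else 0 := by
    intro i j k e
    rw [X_pow_mul_X_pow, coeff_monomial]
    simp only [Subtype.ext_iff, eq_comm]
  have hne : ∀ k (hk : k < m + 4 + 1), k ≠ 0 → mon (m + 4) 0 1 ⟨k, hk⟩ ≠ mon (m + 4) 0 1 0 := by
    intro k hk h0 h
    simpa [Fin.ext_iff, h0] using mon_injective (by decide) h
  -- Only the part linear in s contributes at s = 0; K₁, K₂ and K₃ absorb the higher powers.
  have hdir : ∀ (i : Fin 3) (G K₁ K₂ K₃ : MvPolynomial (Fin 3) ℂ),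
      (∀ s : ℂ, subst (lowerMatrix ((Pi.single i s : Fin 3 → ℂ) 0) ((Pi.single i s : Fin 3 → ℂ) 1)
        ((Pi.single i s : Fin 3 → ℂ) 2)) (baseForm (m + 4)) =
        baseForm (m + 4) + C s * G + C (s ^ 2) * K₁ + C (s ^ 3) * K₂ + C (s ^ 4) * K₃) →
      (fun e : {e : Exponent (m + 4) // e ≠ mon (m + 4) 0 1 0} => coeff e.1.1 G) ∈ W := by
    intro i G K₁ K₂ K₃ h
    apply hW (Pi.single (Sum.inl i) 1)
    intro e
    simp only [hinl, h, coeff_add, coeff_C_mul]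
    have h1 := (hasDerivAt_id (0 : ℂ)).mul_const (coeff e.1.1 G)
    have h2 := fun n => (hasDerivAt_pow n (0 : ℂ))
    simpa using (((h1.const_add (coeff e.1.1 (baseForm (m + 4)))).fun_add
      ((h2 2).mul_const (coeff e.1.1 K₁))).fun_add ((h2 3).mul_const (coeff e.1.1 K₂))).fun_add
      ((h2 4).mul_const (coeff e.1.1 K₃))
  -- Entry b, sending z₃ to z₃ + b z₁, has derivative z₁^d + z₁^(d-1) z₂, whose first term is the
  -- discarded coordinate.
  have hb : Pi.single ⟨mon (m + 4) 0 1 ⟨1, by omega⟩, hne _ _ (by simp)⟩ 1 ∈ W := by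
    have h := hdir 1 (X 0 ^ (m + 4 - (0 : Fin (m + 4 + 1)).1) * X 1 ^ (0 : Fin (m + 4 + 1)).1 +
      X 0 ^ (m + 4 - (⟨1, by omega⟩ : Fin (m + 4 + 1)).1) *
        X 1 ^ (⟨1, by omega⟩ : Fin (m + 4 + 1)).1) 0 0 0 (by
      intro s
      rw [subst_lowerMatrix_baseForm, baseForm]
      simp
      ring)
    convert h using 1
    funext e
    rw [coeff_add, hX, hX, if_neg e.2, zero_add, Pi.single_apply]
    simp only [Subtype.ext_iff]
  -- Entry c, sending z₃ to z₃ + c z₂, gives z₁^(d-2) z₂² + z₁^(d-1) z₂; the second term is already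
  -- in W.
  have hc : Pi.single ⟨mon (m + 4) 0 1 ⟨2, by omega⟩, hne _ _ (by simp)⟩ 1 ∈ W := by
    have h := hdir 2 (X 0 ^ (m + 4 - (⟨2, by omega⟩ : Fin (m + 4 + 1)).1) *
        X 1 ^ (⟨2, by omega⟩ : Fin (m + 4 + 1)).1 +
      X 0 ^ (m + 4 - (⟨1, by omega⟩ : Fin (m + 4 + 1)).1) *
        X 1 ^ (⟨1, by omega⟩ : Fin (m + 4 + 1)).1) 0 0 0 (by
      intro s
      rw [subst_lowerMatrix_baseForm, baseForm]
      simp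
      ring)
    convert W.sub_mem h hb using 1
    funext e
    rw [Pi.sub_apply, coeff_add, hX, hX, Pi.single_apply, Pi.single_apply]
    simp only [Subtype.ext_iff]
    ring
  -- Entry a, sending z₂ to z₂ + a z₁, gives 4 z₁^(d-3) z₂³ + z₁^(d-1) z₃, whose second term is a
  -- coefficient direction.
  have ha : Pi.single ⟨mon (m + 4) 0 1 ⟨3, by omega⟩, hne _ _ (by simp)⟩ 1 ∈ W := by
    have hne2 : mon (m + 4) 0 2 ⟨1, by omega⟩ ≠ mon (m + 4) 0 1 0 := by
      intro h
      have h1 := DFunLike.congr_fun (congrArg Subtype.val h) 2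
      simp [mon] at h1
    have h := hdir 0 (C 4 * (X 0 ^ (m + 4 - (⟨3, by omega⟩ : Fin (m + 4 + 1)).1) *
        X 1 ^ (⟨3, by omega⟩ : Fin (m + 4 + 1)).1) +
      X 0 ^ (m + 4 - (⟨1, by omega⟩ : Fin (m + 4 + 1)).1) *
        X 2 ^ (⟨1, by omega⟩ : Fin (m + 4 + 1)).1) (6 * X 0 ^ (m + 2) * X 1 ^ 2)
        (4 * X 0 ^ (m + 3) * X 1) (X 0 ^ (m + 4)) (by
      intro s
      rw [subst_lowerMatrix_baseForm, baseForm]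
      have h4 : (C 4 : MvPolynomial (Fin 3) ℂ) = 4 := rfl
      simp [h4]
      ring)
    have h2 := hin ⟨mon (m + 4) 0 2 ⟨1, by omega⟩, hne2⟩ (by
      rw [mem_hyperflexExponents]
      simp [mon])
    convert W.smul_mem (1 / 4 : ℂ) (W.sub_mem h h2) using 1
    funext e
    rw [Pi.smul_apply, Pi.sub_apply, coeff_add, coeff_C_mul, hX, hX, Pi.single_apply,
      Pi.single_apply]
    simp only [Subtype.ext_iff, smul_eq_mul]
    ring
  rw [eq_top_iff]
  rintro y -
  rw [pi_eq_sum_univ' y]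
  refine W.sum_mem fun e _ => W.smul_mem _ ?_
  by_cases he : e.1 ∈ hyperflexExponents (m + 4)
  · exact hin e he
  · obtain ⟨k, hk, hek⟩ := eq_mon_of_notMem he
    obtain ⟨e, he0⟩ := e
    obtain ⟨k, hk5⟩ := k
    simp only at hk hek
    subst hek
    have hk0 : k ≠ 0 := by
      rintro rfl
      exact he0 rfl
    have : k = 1 ∨ k = 2 ∨ k = 3 := by omega
    rcases this with rfl | rfl | rfl
    · exact hb
    · exact hc
    · exact ha

end PlaneCurve

/-! ### Homogeneous coordinates of points. -/

namespace CProj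

theorem coords_ne_zero {ι : Type*} (x : CProj ι) : x.coords ≠ 0 := Projectivization.rep_nonzero x

theorem exists_coords_mk {ι : Type*} (v : ι → ℂ) (hv : v ≠ 0) :
    ∃ l : ℂ, l ≠ 0 ∧ (mk v hv).coords = l • v := by
  obtain ⟨c, hc⟩ := Projectivization.exists_smul_eq_mk_rep ℂ v hv
  exact ⟨c, c.ne_zero, hc.symm⟩

theorem mk_coords {ι : Type*} (x : CProj ι) : mk x.coords x.coords_ne_zero = x :=
  Projectivization.mk_rep x

theorem mk_eq_mk_iff {ι : Type*} {v w : ι → ℂ} (hv : v ≠ 0) (hw : w ≠ 0) :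
    mk v hv = mk w hw ↔ ∃ l : ℂ, l • w = v :=
  Projectivization.mk_eq_mk_iff' ℂ v w hv hw

theorem linearIndependent_coords_iff {ι : Type*} {x y : CProj ι} :
    LinearIndependent ℂ ![x.coords, y.coords] ↔ x ≠ y := by
  rw [LinearIndependent.pair_iff]
  constructor
  · rintro h rfl
    exact one_ne_zero (h 1 (-1) (by simp)).1
  · intro h s t hst
    have ht : t = 0 := by
      by_contra ht
      apply h
      rw [← mk_coords x, ← mk_coords y]
      have hs : s ≠ 0 := by
        rintro rfl
        rw [zero_smul, zero_add, smul_eq_zero] at hst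
        exact hst.elim ht y.coords_ne_zero
      rw [mk_eq_mk_iff]
      refine ⟨-t / s, ?_⟩
      have h1 : s • x.coords = -(t • y.coords) := eq_neg_of_add_eq_zero_left hst
      rw [div_eq_inv_mul, mul_smul, neg_smul, ← h1, inv_smul_smul₀ hs]
    refine ⟨?_, ht⟩
    rw [ht, zero_smul, add_zero, smul_eq_zero] at hst
    exact hst.resolve_right x.coords_ne_zero

end CProj

/-! ### Inflection points in terms of vectors and contact orders. -/

namespace PlaneCurve

theorem coeff_zero_lineRestr (F : MvPolynomial (Fin 3) ℂ) (p w : Fin 3 → ℂ) :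
    (lineRestr F p w).coeff 0 = eval p F := by
  rw [Polynomial.coeff_zero_eq_eval_zero, ← eval_line]
  simp

theorem coeff_one_lineRestr (F : MvPolynomial (Fin 3) ℂ) (p w : Fin 3 → ℂ) :
    (lineRestr F p w).coeff 1 = ∑ i, eval p (pderiv i F) * w i := by
  induction F using MvPolynomial.induction_on with
  | C a => simp [lineRestr, algHom_C]
  | add f g hf hg =>
    have : lineRestr (f + g) p w = lineRestr f p w + lineRestr g p w := map_add _ _ _
    rw [this, Polynomial.coeff_add, hf, hg, ← Finset.sum_add_distrib]
    simp [add_mul]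
  | mul_X f i hf =>
    have : lineRestr (f * X i) p w = lineRestr f p w *
        (Polynomial.C (p i) + Polynomial.X * Polynomial.C (w i)) := by
      simp [lineRestr]
    rw [this, Polynomial.mul_coeff_one, hf, coeff_zero_lineRestr]
    fin_cases i <;> simp [Fin.sum_univ_three, Polynomial.mul_coeff_one, pderiv_X] <;> ring

theorem X_sq_dvd_lineRestr_iff (F : MvPolynomial (Fin 3) ℂ) (p w : Fin 3 → ℂ) :
    Polynomial.X ^ 2 ∣ lineRestr F p w ↔
      eval p F = 0 ∧ ∑ i, eval p (pderiv i F) * w i = 0 := by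
  rw [Polynomial.X_pow_dvd_iff, ← coeff_one_lineRestr, ← coeff_zero_lineRestr F p w]
  constructor
  · exact fun h => ⟨h 0 (by norm_num), h 1 (by norm_num)⟩
  · rintro ⟨h0, h1⟩ k hk
    interval_cases k
    exacts [h0, h1]

/-- The linear term along w is the gradient paired with w, so smoothness means that some line
through p is not tangent. -/
theorem exists_not_X_sq_dvd_iff (F : MvPolynomial (Fin 3) ℂ) (p : Fin 3 → ℂ) (hp : eval p F = 0) :
    (∃ w, ¬ Polynomial.X ^ 2 ∣ lineRestr F p w) ↔ (fun i => eval p (pderiv i F)) ≠ 0 := by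
  simp only [X_sq_dvd_lineRestr_iff, hp, true_and]
  constructor
  · rintro ⟨w, hw⟩ h
    exact hw (Finset.sum_eq_zero fun i _ => by rw [show eval p (pderiv i F) = 0 from
      congrFun h i, zero_mul])
  · intro h
    obtain ⟨i, hi⟩ := Function.ne_iff.mp h
    exact ⟨Pi.single i 1, by simpa [Pi.single_apply] using hi⟩

theorem X_pow_dvd_lineRestr_iff {F : MvPolynomial (Fin 3) ℂ} {n : ℕ} (hF : F.IsHomogeneous n)
    {m : ℕ} {p q : Fin 3 → ℂ} {l b : ℂ} (hl : l ≠ 0) (a : ℂ) (hb : b ≠ 0) :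
    Polynomial.X ^ m ∣ lineRestr F (l • p) (a • p + b • q) ↔
      Polynomial.X ^ m ∣ lineRestr F p q := by
  refine ⟨fun h => ?_, fun h => X_pow_dvd_lineRestr hF h hl a b⟩
  convert X_pow_dvd_lineRestr hF h (inv_ne_zero hl) (-a / (l * b)) b⁻¹ using 2
  · rw [inv_smul_smul₀ hl]
  · rw [smul_add, smul_smul, smul_smul, smul_smul, inv_mul_cancel₀ hb, one_smul, ← add_assoc,
      ← add_smul]
    have : -a / (l * b) * l + b⁻¹ * a = 0 := by field_simp; ring
    rw [this, zero_smul, zero_add]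

/-- The vector `p` represents an `r`-tuple inflection point of the curve `F = 0`. -/
def IsFlex (F : MvPolynomial (Fin 3) ℂ) (r : ℕ) (p : Fin 3 → ℂ) : Prop :=
  1 ≤ r ∧ (∃ w, ¬ Polynomial.X ^ 2 ∣ lineRestr F p w) ∧
    ∃ q, LinearIndependent ℂ ![p, q] ∧ Polynomial.X ^ (r + 2) ∣ lineRestr F p q ∧
      ¬ Polynomial.X ^ (r + 3) ∣ lineRestr F p q

theorem linearIndependent_pair_smul {p q : Fin 3 → ℂ} {l b : ℂ} (hl : l ≠ 0) (hb : b ≠ 0)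
    (h : LinearIndependent ℂ ![p, q]) : LinearIndependent ℂ ![l • p, b • q] := by
  rw [LinearIndependent.pair_iff] at h ⊢
  intro s t hst
  have := h (s * l) (t * b) (by rwa [mul_smul, mul_smul])
  simpa [hl, hb] using this

theorem IsFlex.smul {F : MvPolynomial (Fin 3) ℂ} {n : ℕ} (hF : F.IsHomogeneous n) {r : ℕ}
    {p : Fin 3 → ℂ} (h : IsFlex F r p) {l : ℂ} (hl : l ≠ 0) : IsFlex F r (l • p) := by
  obtain ⟨hr, ⟨w, hw⟩, q, hpq, h1, h2⟩ := h
  have key : ∀ (m : ℕ) (v : Fin 3 → ℂ), Polynomial.X ^ m ∣ lineRestr F (l • p) v ↔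
      Polynomial.X ^ m ∣ lineRestr F p v := by
    intro m v
    have := X_pow_dvd_lineRestr_iff hF (m := m) (p := p) (q := v) hl 0 one_ne_zero
    simpa using this
  refine ⟨hr, ⟨w, fun h => hw ((key 2 w).mp h)⟩, q, ?_, (key (r + 2) q).mpr h1,
    fun h => h2 ((key (r + 3) q).mp h)⟩
  simpa using linearIndependent_pair_smul hl one_ne_zero hpq

theorem linearIndependent_mulVec {A B : Matrix (Fin 3) (Fin 3) ℂ} (hBA : B * A = 1)
    {p q : Fin 3 → ℂ} (h : LinearIndependent ℂ ![p, q]) :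
    LinearIndependent ℂ ![A.mulVec p, A.mulVec q] := by
  rw [LinearIndependent.pair_iff] at h ⊢
  intro s t hst
  apply h
  have := congrArg B.mulVec hst
  simpa [Matrix.mulVec_add, Matrix.mulVec_smul, hBA] using this

theorem IsFlex.of_subst {F : MvPolynomial (Fin 3) ℂ} {A B : Matrix (Fin 3) (Fin 3) ℂ}
    (hBA : B * A = 1) {r : ℕ} {p : Fin 3 → ℂ} (h : IsFlex (subst A F) r p) :
    IsFlex F r (A.mulVec p) := by
  obtain ⟨hr, ⟨w, hw⟩, q, hpq, h1, h2⟩ := h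
  rw [lineRestr_subst] at hw h1 h2
  exact ⟨hr, ⟨_, hw⟩, _, linearIndependent_mulVec hBA hpq, h1, h2⟩

theorem isFlex_subst_iff {F : MvPolynomial (Fin 3) ℂ} {A B : Matrix (Fin 3) (Fin 3) ℂ}
    (hBA : B * A = 1) {r : ℕ} {p : Fin 3 → ℂ} :
    IsFlex (subst A F) r p ↔ IsFlex F r (A.mulVec p) := by
  refine ⟨IsFlex.of_subst hBA, fun h => ?_⟩
  have hAB : A * B = 1 := mul_eq_one_comm.mp hBA
  have h1 : IsFlex (subst B (subst A F)) r (A.mulVec p) := by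
    rwa [subst_subst, hAB, subst_one]
  have := h1.of_subst hAB
  rwa [Matrix.mulVec_mulVec, hBA, Matrix.one_mulVec] at this

variable {d : ℕ}

theorem form_eq (a : Param d) : form a = ofCoeffs a.coords := rfl

theorem isHomogeneous_form (a : Param d) : (form a).IsHomogeneous d :=
  isHomogeneous_ofCoeffs a.coords

/-- Tangency of the line need not be required in `IsFlex`: contact of order at least two with a line
forces it to lie in the kernel of the gradient. -/
theorem isInflection_iff (a : Param d) (r : ℕ) (p : Plane) :
    IsInflection a r p ↔ IsFlex (form a) r p.coords := by
  have hF := isHomogeneous_form a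
  constructor
  · rintro ⟨hr, ⟨hp, hg⟩, q, -, hq, hi⟩
    have hi' := emultiplicity_eq_coe.mp hi
    refine ⟨hr, (exists_not_X_sq_dvd_iff _ _ hp).mpr hg, q.coords, ?_, hi'.1, hi'.2⟩
    exact CProj.linearIndependent_coords_iff.mpr hq.symm
  · rintro ⟨hr, hw, q, hpq, h1, h2⟩
    have hq0 : q ≠ 0 := by simpa using hpq.ne_zero 1
    obtain ⟨l, hl, hlq⟩ := CProj.exists_coords_mk q hq0
    have key : ∀ m : ℕ, Polynomial.X ^ m ∣ lineRestr (form a) p.coords (CProj.mk q hq0).coords ↔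
        Polynomial.X ^ m ∣ lineRestr (form a) p.coords q := by
      intro m
      have := X_pow_dvd_lineRestr_iff hF (m := m) (p := p.coords) (q := q) one_ne_zero 0 hl
      simpa [hlq] using this
    have h3 := (X_sq_dvd_lineRestr_iff (form a) p.coords (CProj.mk q hq0).coords).mp
      ((key 2).mpr ((pow_dvd_pow _ (by omega)).trans h1))
    refine ⟨hr, ⟨h3.1, (exists_not_X_sq_dvd_iff _ _ h3.1).mp hw⟩, CProj.mk q hq0, h3.2, ?_,
      emultiplicity_eq_coe.mpr ⟨(key _).mpr h1, fun h => h2 ((key _).mp h)⟩⟩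
    rw [ne_comm, ← CProj.linearIndependent_coords_iff, hlq]
    simpa using linearIndependent_pair_smul one_ne_zero hl hpq

/-- Two independent vectors are the first two columns of an invertible matrix. -/
theorem exists_matrix_of_pair {p q : Fin 3 → ℂ} (h : LinearIndependent ℂ ![p, q]) :
    ∃ A B : Matrix (Fin 3) (Fin 3) ℂ, A * B = 1 ∧ B * A = 1 ∧
      A.mulVec (Pi.single 0 1) = p ∧ A.mulVec (Pi.single 1 1) = q := by
  obtain ⟨i, hi⟩ := Function.ne_iff.mp (crossProduct_ne_zero_iff_linearIndependent.mpr h)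
  let w : Fin 3 → ℂ := Pi.single i 1
  let A : Matrix (Fin 3) (Fin 3) ℂ := (Matrix.of ![p, q, w]).transpose
  have hdet : A.det ≠ 0 := by
    have h1 : A.det = crossProduct p q ⬝ᵥ w := by
      rw [Matrix.det_transpose, dotProduct_comm, triple_product_permutation,
        triple_product_eq_det]
      rfl
    rw [h1]
    simpa [w] using hi
  refine ⟨A, A⁻¹, Matrix.mul_nonsing_inv _ hdet.isUnit, Matrix.nonsing_inv_mul _ hdet.isUnit,
    ?_, ?_⟩ <;>
  · ext j; simp [A]


/-! ### Height one primes are principal. -/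

section Principal

/-- A nonzero prime ideal of a polynomial ring over a factorial ring that contains no nonzero
constant is principal. -/
theorem exists_prime_span_of_comap_C_eq_bot {A : Type*} [CommRing A] [IsDomain A]
    [UniqueFactorizationMonoid A] (J : Ideal (Polynomial A)) [hJ : J.IsPrime] (h0 : J ≠ ⊥)
    (hC : ∀ a : A, Polynomial.C a ∈ J → a = 0) : ∃ G, Prime G ∧ J = Ideal.span {G} := by
  classical
  obtain ⟨G, hGJ, hG⟩ := hJ.exists_mem_prime_of_ne_bot h0
  refine ⟨G, hG, le_antisymm (fun H hH => ?_) ((Ideal.span_singleton_le_iff_mem _).mpr hGJ)⟩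
  rw [Ideal.mem_span_singleton]
  let K := FractionRing A
  let _ : NormalizedGCDMonoid A := Nonempty.some inferInstance
  have hGdeg : G.natDegree ≠ 0 := by
    intro h
    rw [Polynomial.eq_C_of_natDegree_eq_zero h] at hGJ hG
    exact hG.ne_zero (by rw [hC _ hGJ, map_zero])
  have hGprim : G.IsPrimitive := hG.irreducible.isPrimitive hGdeg
  rw [Polynomial.IsPrimitive.dvd_iff_fraction_map_dvd_fraction_map K hGprim]
  have hirr := (hGprim.irreducible_iff_irreducible_map_fraction_map (K := K)).mp hG.irreducible
  rw [← not_not (a := _ ∣ _), ← hirr.coprime_iff_not_dvd]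
  -- If G and H were coprime over the fraction field, their resultant would be a nonzero constant.
  -- It is a combination of G and H, hence lies in J, which contains no nonzero constant.
  intro hcop
  obtain ⟨p, q, -, -, hpq⟩ := Polynomial.exists_mul_add_mul_eq_C_resultant G H le_rfl
    le_rfl (Or.inl hGdeg)
  have hr : G.resultant H = 0 := by
    apply hC
    rw [← hpq]
    exact J.add_mem (J.mul_mem_right _ hGJ) (J.mul_mem_right _ hH)
  have hr' := congrArg (algebraMap A K) hr
  rw [← Polynomial.resultant_map_map, map_zero] at hr'
  have hinj : Function.Injective (algebraMap A K) := IsFractionRing.injective A K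
  rw [← Polynomial.natDegree_map_eq_of_injective hinj G,
    ← Polynomial.natDegree_map_eq_of_injective hinj H] at hr'
  exact (Polynomial.resultant_eq_zero_iff.mp hr').2 hcop

theorem exists_prime_span_of_elim {ι : Type*} [DecidableEq ι] (i₀ : ι)
    (I : Ideal (MvPolynomial ι ℂ)) [I.IsPrime] (h0 : I ≠ ⊥)
    (hI : ∀ P : MvPolynomial {i // i ≠ i₀} ℂ, rename Subtype.val P ∈ I → P = 0) :
    ∃ G, Prime G ∧ I = Ideal.span {G} := by
  let φ : MvPolynomial ι ℂ ≃ₐ[ℂ] Polynomial (MvPolynomial {i // i ≠ i₀} ℂ) :=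
    (renameEquiv ℂ (Equiv.optionSubtypeNe i₀).symm).trans (optionEquivLeft ℂ {i // i ≠ i₀})
  have hφ : ∀ P, φ (rename Subtype.val P) = Polynomial.C P := by
    intro P
    induction P using MvPolynomial.induction_on with
    | C a => simp [φ, optionEquivLeft_C]
    | add p q hp hq => simp only [map_add, hp, hq]
    | mul_X p i hp =>
      have hX : φ (X i.1) = Polynomial.C (X i) := by
        rw [← optionEquivLeft_X_some]
        simp only [φ, AlgEquiv.trans_apply, renameEquiv_apply, rename_X,
          Equiv.optionSubtypeNe_symm_of_ne i.2]
      rw [map_mul, map_mul, hp, map_mul, rename_X, hX]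
  let J : Ideal (Polynomial (MvPolynomial {i // i ≠ i₀} ℂ)) := I.comap (φ.symm : _ →+* _)
  have : J.IsPrime := Ideal.comap_isPrime _ _
  obtain ⟨G, hG, hJ⟩ := exists_prime_span_of_comap_C_eq_bot J (by
    obtain ⟨P, hP, hP0⟩ := (Submodule.ne_bot_iff _).mp h0
    refine (Submodule.ne_bot_iff _).mpr ⟨φ P, ?_, by simpa using hP0⟩
    simpa [J, Ideal.mem_comap] using hP) (by
    intro P hP
    apply hI
    rw [← hφ] at hP
    simpa [J, Ideal.mem_comap] using hP)
  refine ⟨φ.symm G, (MulEquiv.prime_iff φ.symm).mpr hG, ?_⟩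
  ext P
  have h1 : P ∈ I ↔ φ P ∈ J := by simp [J, Ideal.mem_comap]
  rw [h1, hJ, Ideal.mem_span_singleton, Ideal.mem_span_singleton]
  constructor
  · intro h
    simpa using map_dvd φ.symm h
  · intro h
    simpa using map_dvd φ h

end Principal

/-! ### A homogeneous generator of the ideal. -/

section Generator

variable {d : ℕ}

/-- The family is stable under scaling the form. So P(l y) vanishes for every l, and its
coefficients as a polynomial in l are the values of the homogeneous components. -/
theorem homogeneousComponent_mem_hyperflexIdeal {P : MvPolynomial (Exponent d) ℂ}
    (hP : P ∈ hyperflexIdeal d) (n : ℕ) : homogeneousComponent n P ∈ hyperflexIdeal d := by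
  rw [mem_hyperflexIdeal]
  intro x
  let y := act (matrixOf x) (coeffsOf x)
  let Q : Polynomial ℂ := ∑ k ∈ Finset.range (P.totalDegree + 1),
    Polynomial.C (eval y (homogeneousComponent k P)) * Polynomial.X ^ k
  have hQ : Q = 0 := by
    refine Polynomial.funext fun l => ?_
    have h1 := mem_hyperflexIdeal.mp hP (flagPoint (matrixOf x) (l • coeffsOf x))
    rw [matrixOf_flagPoint, coeffsOf_flagPoint _ (fun e he => by
      rw [Pi.smul_apply, coeffsOf_supported x e he, smul_zero]), act_smul] at h1
    conv at h1 => lhs; rw [← sum_homogeneousComponent P]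
    rw [map_sum] at h1
    rw [Polynomial.eval_zero, ← h1, Polynomial.eval_finsetSum]
    refine Finset.sum_congr rfl fun k _ => ?_
    have := aeval_smul_of_isHomogeneous (homogeneousComponent_isHomogeneous k P) l y
    rw [aeval_eq_eval, aeval_eq_eval] at this
    simp only [Polynomial.eval_mul, Polynomial.eval_C, Polynomial.eval_pow, Polynomial.eval_X]
    rw [mul_comm]
    exact this.symm
  by_cases hn : n < P.totalDegree + 1
  · have := congrArg (fun R => Polynomial.coeff R n) hQ
    simpa [Q, Polynomial.finsetSum_coeff, Polynomial.coeff_C_mul_X_pow, Finset.sum_ite_eq,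
      Finset.mem_range, hn, y] using this
  · rw [homogeneousComponent_eq_zero _ _ (by omega), map_zero]

/-- Each homogeneous component of a generator lies in the ideal, hence is a multiple of the
generator. Degrees then rule out every component but the top one. -/
theorem exists_hyperflexIdeal_eq_span (hd : 4 ≤ d) : ∃ (G : MvPolynomial (Exponent d) ℂ) (n : ℕ),
    0 < n ∧ G ≠ 0 ∧ G.IsHomogeneous n ∧ hyperflexIdeal d = Ideal.span {G} := by
  classical
  obtain ⟨G, hG, hI⟩ := exists_prime_span_of_elim (mon d 0 1 0) (hyperflexIdeal d)
    (hyperflexIdeal_ne_bot hd) fun P hP => hyperflexIdeal_elim hd hP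
  have hcomp : ∀ n, n ≠ G.totalDegree → homogeneousComponent n G = 0 := by
    intro n hn
    by_contra h0
    have hmem : homogeneousComponent n G ∈ hyperflexIdeal d :=
      homogeneousComponent_mem_hyperflexIdeal (hI ▸ Ideal.mem_span_singleton_self G) n
    rw [hI, Ideal.mem_span_singleton] at hmem
    obtain ⟨Q, hQ⟩ := hmem
    have hQ0 : Q ≠ 0 := by rintro rfl; exact h0 (by rw [hQ, mul_zero])
    have h1 := (homogeneousComponent_isHomogeneous n G).totalDegree h0
    rw [hQ, totalDegree_mul_of_isDomain hG.ne_zero hQ0] at h1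
    have h2 : ¬ G.totalDegree < n := fun h => h0 (homogeneousComponent_eq_zero _ _ h)
    omega
  have hhom : G.IsHomogeneous G.totalDegree := by
    have h := sum_homogeneousComponent G
    rw [Finset.sum_eq_single G.totalDegree (fun n _ hn => hcomp n hn) (by simp)] at h
    rw [← h]
    convert homogeneousComponent_isHomogeneous G.totalDegree G using 1
    rw [h]
  refine ⟨G, G.totalDegree, Nat.pos_of_ne_zero fun h => ?_, hG.ne_zero, hhom, hI⟩
  rw [totalDegree_eq_zero_iff_eq_C] at h
  apply hG.not_isUnit
  rw [h]
  apply IsUnit.map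
  refine isUnit_iff_ne_zero.mpr fun h' => hG.ne_zero ?_
  rw [h, h', map_zero]

end Generator


/-! ### Lifting general points, by Chevalley's theorem. -/

/-- The image of a nonempty open subset of an affine space under a polynomial map contains a
nonempty open subset of its closure. -/
theorem exists_forall_mem_image {ι σ : Type*} [Finite ι] [Finite σ]
    (φ : MvPolynomial ι ℂ →ₐ[ℂ] MvPolynomial σ ℂ) {b : MvPolynomial σ ℂ} (hb : b ≠ 0) :
    ∃ h, h ∉ RingHom.ker φ ∧ ∀ y : ι → ℂ, (∀ P ∈ RingHom.ker φ, eval y P = 0) → eval y h ≠ 0 →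
      ∃ x : σ → ℂ, eval x b ≠ 0 ∧ ∀ P, eval x (φ P) = eval y P := by
  have hfin : (φ : MvPolynomial ι ℂ →+* MvPolynomial σ ℂ).FinitePresentation := by
    rw [← RingHom.FinitePresentation.of_finiteType]
    refine RingHom.FiniteType.of_comp_finiteType (f := (C : ℂ →+* MvPolynomial ι ℂ)) ?_
    have : (φ : MvPolynomial ι ℂ →+* MvPolynomial σ ℂ).comp C = C := by
      ext a
      simp
    rw [this, ← algebraMap_eq, RingHom.finiteType_algebraMap]
    infer_instance
  obtain ⟨T, hT⟩ := PrimeSpectrum.exists_constructibleSetData_iff.mpr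
    (PrimeSpectrum.isConstructible_comap_image hfin
      (PrimeSpectrum.isConstructible_basicOpen (f := b)))
  -- The image contains the generic point of the zero set of ker φ, so some basic constructible
  -- piece does. That piece contains every point of the zero set where its polynomial f is nonzero,
  -- and f is not in ker φ.
  have hgen : PrimeSpectrum.comap (φ : MvPolynomial ι ℂ →+* MvPolynomial σ ℂ) ⊥ ∈ T.toSet := by
    rw [hT]
    exact ⟨⊥, by simpa using hb, rfl⟩
  simp only [PrimeSpectrum.ConstructibleSetData.toSet, Set.mem_iUnion] at hgen
  obtain ⟨D, hD, hDmem⟩ := hgen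
  simp only [PrimeSpectrum.BasicConstructibleSetData.toSet, Set.mem_sdiff,
    PrimeSpectrum.mem_zeroLocus, Set.singleton_subset_iff] at hDmem
  refine ⟨D.f, fun h => hDmem.2 ?_, fun y hy hh => ?_⟩
  · simpa using h
  let m : PrimeSpectrum (MvPolynomial ι ℂ) := ⟨vanishingIdeal ℂ {y}, inferInstance⟩
  have hm : m ∈ T.toSet := by
    simp only [PrimeSpectrum.ConstructibleSetData.toSet, Set.mem_iUnion]
    refine ⟨D, hD, ?_⟩
    simp only [PrimeSpectrum.BasicConstructibleSetData.toSet, Set.mem_sdiff,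
      PrimeSpectrum.mem_zeroLocus, Set.singleton_subset_iff]
    constructor
    · intro P hP
      have hP' : P ∈ RingHom.ker φ := by simpa using hDmem.1 hP
      rw [SetLike.mem_coe, mem_vanishingIdeal_singleton_iff, aeval_eq_eval]
      exact hy P hP'
    · rw [SetLike.mem_coe, mem_vanishingIdeal_singleton_iff, aeval_eq_eval]
      exact hh
  rw [hT] at hm
  obtain ⟨q, hq, hqm⟩ := hm
  -- The preimage q may be a nonclosed point; the Nullstellensatz provides a closed point of its
  -- zero set where b is nonzero.
  have hbq : b ∉ vanishingIdeal ℂ (zeroLocus ℂ q.asIdeal) := by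
    rw [IsPrime.vanishingIdeal_zeroLocus]
    exact hq
  rw [mem_vanishingIdeal_iff] at hbq
  push Not at hbq
  obtain ⟨x, hx, hbx⟩ := hbq
  refine ⟨x, by simpa [aeval_eq_eval] using hbx, fun P => ?_⟩
  have h1 : φ (P - C (eval y P)) ∈ q.asIdeal := by
    have : P - C (eval y P) ∈ m.asIdeal := by
      rw [mem_vanishingIdeal_singleton_iff, aeval_eq_eval]
      simp
    rw [← hqm] at this
    exact this
  have h2 := hx _ h1
  simpa [aeval_eq_eval, sub_eq_zero] using h2

/-! ### The closure: irreducible hypersurface, and its general member. -/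

variable {d : ℕ}

/-- The curves with a multiple inflection point. -/
abbrev multipleSet (d : ℕ) : Set (Param d) := {a | (multipleInflectionPoints a).Nonempty}

theorem mem_multipleSet_iff {a : Param d} :
    a ∈ multipleSet d ↔ ∃ p : Plane, ∃ r, 2 ≤ r ∧ IsFlex (form a) r p.coords := by
  simp only [Set.mem_ofPred_eq, Set.Nonempty, multipleInflectionPoints, isInflection_iff]

/-- A coordinate change moves the given hyperflex flag to the standard one; its inverse is the
matrix part of the parameter. -/
theorem exists_coords_eq_act (hd : 4 ≤ d) {a : Param d} (ha : a ∈ multipleSet d) :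
    ∃ x : FlagParam d → ℂ, a.coords = act (matrixOf x) (coeffsOf x) := by
  obtain ⟨p, r, hr, -, -, q, hpq, h, -⟩ := mem_multipleSet_iff.mp ha
  obtain ⟨A, B, hAB, hBA, hp, hq⟩ := exists_matrix_of_pair hpq
  have hs : ∀ e ∉ hyperflexExponents d, act A a.coords e = 0 := by
    rw [supported_iff hd, ofCoeffs_act, lineRestr_subst, hp, hq]
    exact (pow_dvd_pow _ (by omega)).trans h
  refine ⟨flagPoint B (act A a.coords), ?_⟩
  rw [matrixOf_flagPoint, coeffsOf_flagPoint _ hs, act_act, hAB, act_one]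

theorem linearIndependent_single :
    LinearIndependent ℂ ![(Pi.single 0 1 : Fin 3 → ℂ), Pi.single 1 1] := by
  rw [LinearIndependent.pair_iff]
  intro s t h
  have h0 := congrFun h 0
  have h1 := congrFun h 1
  simp at h0 h1
  exact ⟨h0, h1⟩

/-- The conditions on a form with a contact of order at least four that make the point of contact a
2-tuple inflection point. -/
theorem isFlex_two_of_supported (hd : 4 ≤ d) {c : Exponent d → ℂ}
    (hc : ∀ e ∉ hyperflexExponents d, c e = 0) (h1 : c (mon d 0 2 ⟨1, by omega⟩) ≠ 0)
    (h4 : c (mon d 0 1 ⟨4, by omega⟩) ≠ 0) : IsFlex (ofCoeffs c) 2 (Pi.single 0 1) := by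
  refine ⟨by norm_num, ⟨Pi.single 2 1, fun h => h1 (coeff_mon_eq_zero (by decide) h (by simp))⟩,
    Pi.single 1 1, linearIndependent_single, (supported_iff hd).mp hc,
    fun h => h4 (coeff_mon_eq_zero (by decide) h (by simp))⟩

theorem mem_multipleSet_of_coords (hd : 4 ≤ d) {a : Param d} {g : Matrix (Fin 3) (Fin 3) ℂ}
    (hg : g.det ≠ 0) {c : Exponent d → ℂ} (ha : a.coords = act g c)
    (hc : ∀ e ∉ hyperflexExponents d, c e = 0) (h1 : c (mon d 0 2 ⟨1, by omega⟩) ≠ 0)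
    (h4 : c (mon d 0 1 ⟨4, by omega⟩) ≠ 0) : a ∈ multipleSet d := by
  have hgi := Matrix.mul_nonsing_inv g hg.isUnit
  have hig := Matrix.nonsing_inv_mul g hg.isUnit
  have h := isFlex_two_of_supported hd hc h1 h4
  have h2 : IsFlex (form a) 2 ((g⁻¹).mulVec (Pi.single 0 1)) := by
    rw [form_eq, ha, ofCoeffs_act, isFlex_subst_iff hig, Matrix.mulVec_mulVec, hgi,
      Matrix.one_mulVec]
    exact h
  have h0 : (g⁻¹).mulVec (Pi.single 0 1) ≠ 0 := by
    obtain ⟨-, -, q, hq, -⟩ := h2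
    simpa using hq.ne_zero 0
  obtain ⟨l, hl, hlp⟩ := CProj.exists_coords_mk _ h0
  refine mem_multipleSet_iff.mpr ⟨CProj.mk _ h0, 2, le_rfl, ?_⟩
  rw [hlp]
  exact h2.smul (isHomogeneous_form a) hl

/-- The polynomial cutting out the degenerate points of the parameter space. -/
def flagDiscr (hd : 4 ≤ d) : MvPolynomial (FlagParam d) ℂ :=
  (matrixOf X).det * coeffsOf X (mon d 0 2 ⟨1, by omega⟩) * coeffsOf X (mon d 0 1 ⟨4, by omega⟩)

theorem eval_flagDiscr (hd : 4 ≤ d) (x : FlagParam d → ℂ) : eval x (flagDiscr hd) =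
    (matrixOf x).det * coeffsOf x (mon d 0 2 ⟨1, by omega⟩) *
      coeffsOf x (mon d 0 1 ⟨4, by omega⟩) := by
  have h1 : ∀ e, eval x (coeffsOf (X : FlagParam d → MvPolynomial (FlagParam d) ℂ) e) =
      coeffsOf x e := by
    intro e
    rw [coeffsOf, map_extend]
    simp only [eval_X, coeffsOf]
  have h2 : eval x (matrixOf (X : FlagParam d → MvPolynomial (FlagParam d) ℂ)).det =
      (matrixOf x).det := by
    simp [Matrix.det_fin_three, matrixOf]
  rw [flagDiscr, map_mul, map_mul, h1, h1, h2]

theorem flagDiscr_ne_zero (hd : 4 ≤ d) : flagDiscr hd ≠ 0 := by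
  intro h
  have h1 := congrArg (eval (flagPoint 1 fun _ => 1)) h
  rw [eval_flagDiscr, map_zero, matrixOf_flagPoint, coeffsOf,
    extend_of_mem _ (by rw [mem_hyperflexExponents]; simp [mon]),
    extend_of_mem _ (by rw [mem_hyperflexExponents]; simp [mon])] at h1
  simp [flagPoint] at h1

/-- Where `flagDiscr` is nonzero, F ∘ g has a 2-tuple inflection point. So the pullback of P
vanishes on a nonempty open set of parameters, hence identically. -/
theorem mem_hyperflexIdeal_of_vanishing (hd : 4 ≤ d) {P : MvPolynomial (Exponent d) ℂ} {n : ℕ}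
    (hP : P.IsHomogeneous n) (h : ∀ a ∈ multipleSet d, eval a.coords P = 0) :
    P ∈ hyperflexIdeal d := by
  have key : pullback d P * flagDiscr hd = 0 := by
    refine MvPolynomial.funext fun x => ?_
    rw [map_mul, map_zero, mul_eq_zero, or_iff_not_imp_right, eval_flagDiscr, eval_pullback]
    intro hx
    simp only [mul_eq_zero, not_or] at hx
    obtain ⟨⟨hx1, hx2⟩, hx3⟩ := hx
    set y := act (matrixOf x) (coeffsOf x) with hy
    have hy0 : y ≠ 0 := by
      intro h0
      have := congrArg (act (matrixOf x)⁻¹) (hy.symm.trans h0)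
      rw [act_act, Matrix.mul_nonsing_inv _ (Ne.isUnit hx1), act_one] at this
      apply hx2
      rw [this]
      simp [act, ofCoeffs]
    obtain ⟨l, hl, hla⟩ := CProj.exists_coords_mk y hy0
    have := h (CProj.mk y hy0) (mem_multipleSet_of_coords hd (g := matrixOf x)
      (c := l • coeffsOf x) hx1 (by rw [hla, act_smul])
      (fun e he => by rw [Pi.smul_apply, coeffsOf_supported x e he, smul_zero])
      (by simpa using ⟨hl, hx2⟩) (by simpa using ⟨hl, hx3⟩))
    exact (CProj.eval_coords_mk_eq_zero_iff hP y hy0).mp this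
  exact (mul_eq_zero.mp key).resolve_right (flagDiscr_ne_zero hd)

theorem eval_coords_eq_zero_of_mem (hd : 4 ≤ d) {P : MvPolynomial (Exponent d) ℂ}
    (hP : P ∈ hyperflexIdeal d) {a : Param d} (ha : a ∈ multipleSet d) :
    eval a.coords P = 0 := by
  obtain ⟨x, hx⟩ := exists_coords_eq_act hd ha
  rw [hx]
  exact mem_hyperflexIdeal.mp hP x

theorem isClosed_iff {ι : Type*} {Z : Set (CProj ι)} : IsClosed Z ↔ CProj.IsZariskiClosed Z := by
  rw [← isOpen_compl_iff]
  change CProj.IsZariskiClosed Zᶜᶜ ↔ _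
  rw [compl_compl]

theorem isOpen_ne_zero {ι : Type*} {P : MvPolynomial ι ℂ} {n : ℕ} (hP : P.IsHomogeneous n) :
    IsOpen {a : CProj ι | eval a.coords P ≠ 0} := by
  rw [← isClosed_compl_iff, isClosed_iff]
  refine ⟨{P}, by rintro _ rfl; exact ⟨n, hP⟩, ?_⟩
  ext a
  simp [CProj.zeroLocus]

theorem exists_mem_of_notMem_ideal (hd : 4 ≤ d) {P : MvPolynomial (Exponent d) ℂ} {n : ℕ}
    (hP : P.IsHomogeneous n) (h : P ∉ hyperflexIdeal d) :
    ∃ a ∈ multipleSet d, eval a.coords P ≠ 0 := by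
  by_contra! hc
  exact h (mem_hyperflexIdeal_of_vanishing hd hP hc)

theorem multipleLocus_eq_zeroLocus (hd : 4 ≤ d) {G : MvPolynomial (Exponent d) ℂ} {n : ℕ}
    (hG : G.IsHomogeneous n) (hI : hyperflexIdeal d = Ideal.span {G}) :
    multipleLocus d = CProj.zeroLocus {G} := by
  apply le_antisymm
  · refine closure_minimal (fun a ha => ?_) (isClosed_iff.mpr
      ⟨{G}, by rintro _ rfl; exact ⟨n, hG⟩, rfl⟩)
    rintro _ rfl
    exact eval_coords_eq_zero_of_mem hd (hI ▸ Ideal.mem_span_singleton_self _) ha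
  · intro a ha
    rw [multipleLocus, closure, Set.mem_sInter]
    rintro Z ⟨hZ, hsub⟩
    obtain ⟨S, hS, rfl⟩ := isClosed_iff.mp hZ
    intro P hP
    obtain ⟨m, hm⟩ := hS P hP
    have h1 : P ∈ hyperflexIdeal d := mem_hyperflexIdeal_of_vanishing hd hm fun b hb => hsub hb P hP
    rw [hI, Ideal.mem_span_singleton] at h1
    obtain ⟨Q, rfl⟩ := h1
    rw [map_mul, ha G rfl, zero_mul]

theorem isHypersurface_multipleLocus (hd : 4 ≤ d) : CProj.IsHypersurface (multipleLocus d) := by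
  obtain ⟨G, n, hn, hG0, hG, hI⟩ := exists_hyperflexIdeal_eq_span hd
  exact ⟨G, n, hn, hG0, hG, multipleLocus_eq_zeroLocus hd hG hI⟩

/-- An open set meeting the locus contains the nonvanishing set of a form outside the prime ideal.
The product of two such forms is still outside, so it is nonzero at some member. -/
theorem isIrreducible_multipleLocus (hd : 4 ≤ d) : IsIrreducible (multipleLocus d) := by
  refine IsIrreducible.closure ⟨?_, ?_⟩
  · obtain ⟨a, ha, -⟩ := exists_mem_of_notMem_ideal hd (isHomogeneous_one _ ℂ)
      ((Ideal.ne_top_iff_one _).mp (Ideal.IsPrime.ne_top (I := hyperflexIdeal d) inferInstance))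
    exact ⟨a, ha⟩
  · have key : ∀ u : Set (Param d), IsOpen u → (multipleSet d ∩ u).Nonempty →
        ∃ (P : MvPolynomial (Exponent d) ℂ) (n : ℕ), P.IsHomogeneous n ∧ P ∉ hyperflexIdeal d ∧
          ∀ a : Param d, eval a.coords P ≠ 0 → a ∈ u := by
      rintro u hu ⟨a, ha, hau⟩
      obtain ⟨S, hS, hSu⟩ := isClosed_iff.mp hu.isClosed_compl
      have : a ∉ CProj.zeroLocus S := by rw [← hSu]; exact fun h => h hau
      simp only [CProj.zeroLocus, Set.mem_ofPred_eq] at this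
      push Not at this
      obtain ⟨P, hPS, hPa⟩ := this
      obtain ⟨n, hn⟩ := hS P hPS
      refine ⟨P, n, hn, fun h => hPa (eval_coords_eq_zero_of_mem hd h ha), fun b hb => ?_⟩
      by_contra hbu
      have : b ∈ CProj.zeroLocus S := by rw [← hSu]; exact hbu
      exact hb (this P hPS)
    intro u v hu hv hau hav
    obtain ⟨P, m, hP, hPI, hPu⟩ := key u hu hau
    obtain ⟨Q, n, hQ, hQI, hQv⟩ := key v hv hav
    obtain ⟨a, ha, hne⟩ := exists_mem_of_notMem_ideal hd (hP.mul hQ) fun h =>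
      (Ideal.IsPrime.mem_or_mem inferInstance h).elim hPI hQI
    rw [map_mul, mul_ne_zero_iff] at hne
    exact ⟨a, ha, hPu a hne.1, hQv a hne.2⟩

/-- A nonempty open subset of `multipleLocus d` is, up to scalars, contained in the image of any
given nonempty open subset of the parameter space. -/
theorem exists_open_multipleLocus (hd : 4 ≤ d) {b : MvPolynomial (FlagParam d) ℂ} (hb : b ≠ 0) :
    ∃ U : Set (Param d), IsOpen U ∧ (multipleLocus d ∩ U).Nonempty ∧ ∀ a ∈ multipleLocus d ∩ U,
      ∃ l : ℂ, l ≠ 0 ∧ ∃ x, eval x b ≠ 0 ∧ l • a.coords = act (matrixOf x) (coeffsOf x) := by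
  obtain ⟨G, n, hn, hG0, hG, hI⟩ := exists_hyperflexIdeal_eq_span hd
  obtain ⟨h, hh, hlift⟩ := exists_forall_mem_image (pullback d) hb
  obtain ⟨k, hk⟩ : ∃ k, homogeneousComponent k h ∉ hyperflexIdeal d := by
    by_contra! hc
    apply hh
    rw [← sum_homogeneousComponent h]
    exact Ideal.sum_mem _ fun k _ => hc k
  have hhk := homogeneousComponent_isHomogeneous k h
  refine ⟨_, isOpen_ne_zero hhk, ?_, ?_⟩
  · obtain ⟨a, ha, hne⟩ := exists_mem_of_notMem_ideal hd hhk hk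
    exact ⟨a, subset_closure ha, hne⟩
  · rintro a ⟨ha, hak⟩
    rw [multipleLocus_eq_zeroLocus hd hG hI] at ha
    have hsc : ∀ (l : ℂ) (P : MvPolynomial (Exponent d) ℂ) (m : ℕ), P.IsHomogeneous m →
        eval (l • a.coords) P = l ^ m * eval a.coords P := by
      intro l P m hP
      have := aeval_smul_of_isHomogeneous hP l a.coords
      rwa [aeval_eq_eval, aeval_eq_eval] at this
    -- h need not be homogeneous, so its nonvanishing is not a condition on projective points. Q(l)
    -- is h at l times the coordinates of a; since the component of degree k is nonzero at a, Q is
    -- not zero and some nonzero multiple works. The factor `Polynomial.X` below ensures l ≠ 0.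
    let Q : Polynomial ℂ := ∑ j ∈ Finset.range (h.totalDegree + 1),
      Polynomial.C (eval a.coords (homogeneousComponent j h)) * Polynomial.X ^ j
    have hQ : ∀ l : ℂ, Q.eval l = eval (l • a.coords) h := by
      intro l
      conv_rhs => rw [← sum_homogeneousComponent h]
      rw [map_sum, Polynomial.eval_finsetSum]
      refine Finset.sum_congr rfl fun j _ => ?_
      rw [hsc l _ j (homogeneousComponent_isHomogeneous j h)]
      rw [Polynomial.eval_mul, Polynomial.eval_C, Polynomial.eval_pow, Polynomial.eval_X, mul_comm]
    have hQ0 : Q ≠ 0 := by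
      intro h0
      have hkd : k < h.totalDegree + 1 := by
        by_contra hc
        exact hak (by rw [homogeneousComponent_eq_zero _ _ (by omega), map_zero])
      have := congrArg (fun R => Polynomial.coeff R k) h0
      apply hak
      simpa [Q, Polynomial.finsetSum_coeff, Polynomial.coeff_C_mul_X_pow, Finset.sum_ite_eq,
        Finset.mem_range, hkd] using this
    obtain ⟨l, hl⟩ : ∃ l : ℂ, (Polynomial.X * Q).eval l ≠ 0 := by
      by_contra! hc
      exact mul_ne_zero Polynomial.X_ne_zero hQ0 (Polynomial.funext fun l => by simpa using hc l)
    rw [Polynomial.eval_mul, Polynomial.eval_X, mul_ne_zero_iff, hQ] at hl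
    obtain ⟨x, hx, hxP⟩ := hlift (l • a.coords) (fun P hP => by
      have hP' : P ∈ Ideal.span {G} := hI ▸ hP
      obtain ⟨R, rfl⟩ := Ideal.mem_span_singleton.mp hP'
      rw [map_mul, hsc l G n hG, ha G rfl, mul_zero, zero_mul]) hl.2
    refine ⟨l, hl.1, x, hx, funext fun e => ?_⟩
    have := hxP (X e)
    rw [eval_pullback, eval_X, eval_X] at this
    exact this.symm

theorem IsGenericHyperflex.const_mul {F : MvPolynomial (Fin 3) ℂ} {p q : Fin 3 → ℂ}
    (h : IsGenericHyperflex F p q) {l : ℂ} (hl : l ≠ 0) : IsGenericHyperflex (C l * F) p q := by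
  have key : ∀ (m : ℕ) (z w : Fin 3 → ℂ), Polynomial.X ^ m ∣ lineRestr (C l * F) z w ↔
      Polynomial.X ^ m ∣ lineRestr F z w := by
    intro m z w
    have h1 : lineRestr (C l * F) z w = Polynomial.C l * lineRestr F z w := by
      simp [lineRestr, algHom_C]
    rw [h1, (Polynomial.isUnit_C.mpr hl.isUnit).dvd_mul_left]
  exact ⟨fun z hz hs => h.nonsingular z hz fun w => (key 2 z w).mp (hs w),
    fun z w hzw hs => h.unique z w hzw ((key 4 z w).mp hs), (key 4 p q).mpr h.order_ge,
    fun hs => h.order_lt ((key 5 p q).mp hs)⟩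

theorem IsGenericHyperflex.subst {F : MvPolynomial (Fin 3) ℂ} {p q : Fin 3 → ℂ}
    (h : IsGenericHyperflex F p q) {A B : Matrix (Fin 3) (Fin 3) ℂ} (hAB : A * B = 1) :
    IsGenericHyperflex (subst A F) (B.mulVec p) (B.mulVec q) := by
  have hBA : B * A = 1 := mul_eq_one_comm.mp hAB
  have hp : ∀ v : Fin 3 → ℂ, A.mulVec (B.mulVec v) = v := fun v => by
    rw [Matrix.mulVec_mulVec, hAB, Matrix.one_mulVec]
  have hp' : ∀ v : Fin 3 → ℂ, B.mulVec (A.mulVec v) = v := fun v => by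
    rw [Matrix.mulVec_mulVec, hBA, Matrix.one_mulVec]
  refine ⟨fun z hz hs => h.nonsingular (A.mulVec z) ?_ fun w => ?_, fun z w hzw hs => ?_, ?_, ?_⟩
  · intro h0
    apply hz
    rw [← hp' z, h0, Matrix.mulVec_zero]
  · have := hs (B.mulVec w)
    rwa [lineRestr_subst, hp] at this
  · rw [lineRestr_subst] at hs
    obtain ⟨l, hl⟩ := h.unique _ _ (LinearIndependent.pair_iff.mp
      (linearIndependent_mulVec hBA (LinearIndependent.pair_iff.mpr hzw))) hs
    refine ⟨l, ?_⟩
    rw [← hp' z, hl, Matrix.mulVec_smul]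
  · rw [lineRestr_subst, hp, hp]
    exact h.order_ge
  · rw [lineRestr_subst, hp, hp]
    exact h.order_lt

/-- The general member of `multipleLocus d` has a single contact of order at least four. -/
theorem exists_open_isGenericHyperflex (hd : 4 ≤ d) :
    ∃ U : Set (Param d), IsOpen U ∧ (multipleLocus d ∩ U).Nonempty ∧ ∀ a ∈ multipleLocus d ∩ U,
      ∃ p q, LinearIndependent ℂ ![p, q] ∧ IsGenericHyperflex (form a) p q := by
  obtain ⟨b, hb0, hb⟩ := exists_isGenericHyperflex hd
  have hb' : rename Sum.inr b * flagDiscr hd ≠ 0 := mul_ne_zero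
    (fun h => hb0 (rename_injective _ Sum.inr_injective (by rw [h, map_zero])))
    (flagDiscr_ne_zero hd)
  obtain ⟨U, hU, hne, h⟩ := exists_open_multipleLocus hd hb'
  refine ⟨U, hU, hne, fun a ha => ?_⟩
  obtain ⟨l, hl, x, hx, hlx⟩ := h a ha
  rw [map_mul, mul_ne_zero_iff, eval_flagDiscr, eval_rename] at hx
  have hdet : (matrixOf x).det ≠ 0 := fun h0 => hx.2 (by rw [h0, zero_mul, zero_mul])
  have h1 : IsGenericHyperflex (ofCoeffs (coeffsOf x)) (Pi.single 0 1) (Pi.single 1 1) := by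
    refine hb _ (coeffsOf_supported x) ?_
    convert hx.1 using 3
    funext e
    exact extend_of_mem _ e.2
  have hgi := Matrix.mul_nonsing_inv _ hdet.isUnit
  have h2 := (h1.subst hgi).const_mul (inv_ne_zero hl)
  refine ⟨_, _, linearIndependent_mulVec hgi linearIndependent_single, ?_⟩
  convert h2 using 1
  rw [← ofCoeffs_act, ← hlx, ofCoeffs_smul, ← mul_assoc, ← map_mul, inv_mul_cancel₀ hl, map_one,
    one_mul, form_eq]


/-! ### Hensel's lemma for power series. -/

section PowerSeries

theorem smodEq_span_X_pow_iff {f g : PowerSeries ℂ} {n : ℕ} :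
    f ≡ g [SMOD ((Ideal.span {(PowerSeries.X : PowerSeries ℂ)}) ^ n • ⊤ :
      Submodule (PowerSeries ℂ) (PowerSeries ℂ))] ↔
      ∀ m < n, PowerSeries.coeff m f = PowerSeries.coeff m g := by
  rw [SModEq.sub_mem, smul_eq_mul, Ideal.mul_top, Ideal.span_singleton_pow,
    Ideal.mem_span_singleton, PowerSeries.X_pow_dvd_iff]
  simp only [map_sub, sub_eq_zero]

instance isAdicComplete_powerSeries :
    IsAdicComplete (Ideal.span {(PowerSeries.X : PowerSeries ℂ)}) (PowerSeries ℂ) where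
  haus' f hf := by
    ext n
    exact smodEq_span_X_pow_iff.mp (hf (n + 1)) n (Nat.lt_succ_self n)
  prec' f hf := by
    refine ⟨PowerSeries.mk fun n => PowerSeries.coeff n (f (n + 1)), fun n => ?_⟩
    rw [smodEq_span_X_pow_iff]
    intro m hm
    rw [PowerSeries.coeff_mk]
    exact (smodEq_span_X_pow_iff.mp (hf (Nat.succ_le_of_lt hm)) m (Nat.lt_succ_self m)).symm

/-- Hensel's lemma for power series. -/
theorem exists_powerSeries_root {f : Polynomial (PowerSeries ℂ)} (hf : f.Monic) (y : ℂ)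
    (h0 : PowerSeries.constantCoeff (f.eval (PowerSeries.C y)) = 0)
    (h1 : PowerSeries.constantCoeff (f.derivative.eval (PowerSeries.C y)) ≠ 0) :
    ∃ α, f.eval α = 0 ∧ PowerSeries.constantCoeff α = y := by
  have hmem : ∀ g : PowerSeries ℂ, g ∈ Ideal.span {(PowerSeries.X : PowerSeries ℂ)} ↔
      PowerSeries.constantCoeff g = 0 := fun g => by
    rw [Ideal.mem_span_singleton, PowerSeries.X_dvd_iff]
  obtain ⟨α, hα, hαy⟩ := HenselianRing.is_henselian
    (I := Ideal.span {(PowerSeries.X : PowerSeries ℂ)}) f hf (PowerSeries.C y) ((hmem _).mpr h0)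
    (IsUnit.map _ (PowerSeries.isUnit_iff_constantCoeff.mpr h1.isUnit))
  refine ⟨α, hα, ?_⟩
  have := (hmem _).mp hαy
  simpa [sub_eq_zero] using this

end PowerSeries

/-! ### The form as a polynomial in its last variable. -/

section Vertical

variable {R S : Type*} [CommRing R] [Algebra ℂ R] [CommRing S] [Algebra ℂ S]

/-- The polynomial `F(s, x, Y)` in `Y`. -/
def vert (F : MvPolynomial (Fin 3) ℂ) (s x : R) : Polynomial R :=
  aeval ![Polynomial.C s, Polynomial.C x, Polynomial.X] F

theorem eval_vert (F : MvPolynomial (Fin 3) ℂ) (s x y : R) :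
    (vert F s x).eval y = aeval ![s, x, y] F := by
  have h := comp_aeval_apply (R := ℂ) ![Polynomial.C s, Polynomial.C x, (Polynomial.X : Polynomial R)]
    ((Polynomial.aeval y : Polynomial R →ₐ[R] R).restrictScalars ℂ) F
  have h2 : (fun i => ((Polynomial.aeval y : Polynomial R →ₐ[R] R).restrictScalars ℂ)
      (![Polynomial.C s, Polynomial.C x, (Polynomial.X : Polynomial R)] i)) = ![s, x, y] := by
    funext i; fin_cases i <;> simp
  rw [h2] at h
  simpa [vert, Polynomial.coe_aeval_eq_eval] using h

theorem map_vert (φ : R →ₐ[ℂ] S) (F : MvPolynomial (Fin 3) ℂ) (s x : R) :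
    (vert F s x).map (φ : R →+* S) = vert F (φ s) (φ x) := by
  have h := comp_aeval_apply (R := ℂ) ![Polynomial.C s, Polynomial.C x, (Polynomial.X : Polynomial R)]
    (Polynomial.mapAlgHom φ) F
  have h2 : (fun i => (Polynomial.mapAlgHom φ)
      (![Polynomial.C s, Polynomial.C x, (Polynomial.X : Polynomial R)] i)) =
      ![Polynomial.C (φ s), Polynomial.C (φ x), Polynomial.X] := by
    funext i; fin_cases i <;> simp
  rw [h2] at h
  simpa [vert] using h

theorem derivative_vert (F : MvPolynomial (Fin 3) ℂ) (s x : R) :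
    (vert F s x).derivative = vert (pderiv 2 F) s x := by
  have hadd : ∀ f g, vert (f + g) s x = vert f s x + vert g s x := fun f g => map_add _ _ _
  have hmul : ∀ f g, vert (f * g) s x = vert f s x * vert g s x := fun f g => map_mul _ _ _
  induction F using MvPolynomial.induction_on with
  | C a =>
    rw [pderiv_C]
    simp [vert, algHom_C, IsScalarTower.algebraMap_apply ℂ R (Polynomial R)]
  | add f g hf hg => rw [map_add, hadd, hadd, Polynomial.derivative_add, hf, hg]
  | mul_X f i hf =>
    rw [Derivation.leibniz, hadd, smul_eq_mul, smul_eq_mul, hmul, hmul, hmul,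
      Polynomial.derivative_mul, hf, pderiv_X]
    fin_cases i <;> simp [vert] <;> ring

theorem vert_ofCoeffs {d : ℕ} (c : Exponent d → ℂ) (s x : R) :
    vert (ofCoeffs c) s x = ∑ e : Exponent d,
      Polynomial.C (algebraMap ℂ R (c e) * s ^ e.1 0 * x ^ e.1 1) * Polynomial.X ^ e.1 2 := by
  rw [vert, ofCoeffs, map_sum]
  refine Finset.sum_congr rfl fun e _ => ?_
  rw [aeval_monomial, Finsupp.prod_fintype _ _ (by simp), Fin.prod_univ_three]
  simp [IsScalarTower.algebraMap_apply ℂ R (Polynomial R)]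
  ring

theorem natDegree_vert_le {F : MvPolynomial (Fin 3) ℂ} {d : ℕ} (hF : F.IsHomogeneous d) (s x : R) :
    (vert F s x).natDegree ≤ d := by
  rw [← ofCoeffs_coeff hF, vert_ofCoeffs]
  refine Polynomial.natDegree_sum_le_of_forall_le _ _ fun e _ => ?_
  refine (Polynomial.natDegree_C_mul_X_pow_le _ _).trans ?_
  have := sum_exponent e
  omega

/-- By homogeneity only the monomial z₃^d reaches Y^d. Hence the polynomial is monic, for all s and
x, as soon as F(0,0,1) = 1. -/
theorem coeff_vert {F : MvPolynomial (Fin 3) ℂ} {d : ℕ} (hF : F.IsHomogeneous d) (s x : R) :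
    (vert F s x).coeff d = algebraMap ℂ R (eval (Pi.single 2 1) F) := by
  have h1 : ∀ (s x : R), (vert F s x).coeff d =
      algebraMap ℂ R (coeff (Finsupp.single 2 d) F) := by
    intro s x
    conv_lhs => rw [← ofCoeffs_coeff hF, vert_ofCoeffs, Polynomial.finsetSum_coeff]
    let e₀ : Exponent d := ⟨Finsupp.single 2 d, mem_exponent (by simp)⟩
    rw [Finset.sum_eq_single e₀]
    · simp [e₀]
    · intro e _ he
      rw [Polynomial.coeff_C_mul_X_pow, if_neg]
      intro h
      apply he
      have := sum_exponent e
      apply Subtype.ext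
      ext i
      fin_cases i
      · simp [e₀]; omega
      · simp [e₀]; omega
      · simp [e₀, ← h]
    · simp
  rw [h1]
  congr 1
  have h2 : aeval ![(0 : ℂ), 0, 1] F = coeff (Finsupp.single 2 d) F := by
    conv_lhs => rw [← ofCoeffs_coeff hF, ofCoeffs, map_sum]
    let e₀ : Exponent d := ⟨Finsupp.single 2 d, mem_exponent (by simp)⟩
    rw [Finset.sum_eq_single e₀]
    · rw [aeval_monomial, Finsupp.prod_fintype _ _ (by simp), Fin.prod_univ_three]
      simp [e₀]
    · intro e _ he
      rw [aeval_monomial, Finsupp.prod_fintype _ _ (by simp), Fin.prod_univ_three]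
      have := sum_exponent e
      by_cases h0 : e.1 0 = 0
      · by_cases h1 : e.1 1 = 0
        · exfalso
          apply he
          apply Subtype.ext
          ext i
          fin_cases i
          · simp [e₀, h0]
          · simp [e₀, h1]
          · simp [e₀]; omega
        · simp [h1]
      · simp [h0]
    · simp
  rw [← h2, aeval_eq_eval]
  congr 2
  ext i; fin_cases i <;> simp

theorem monic_vert {F : MvPolynomial (Fin 3) ℂ} {d : ℕ} (hF : F.IsHomogeneous d)
    (h1 : eval (Pi.single 2 1) F = 1) (s x : R) : (vert F s x).Monic :=
  Polynomial.monic_of_natDegree_le_of_coeff_eq_one d (natDegree_vert_le hF s x)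
    (by rw [coeff_vert hF, h1, map_one])

theorem natDegree_vert [Nontrivial R] {F : MvPolynomial (Fin 3) ℂ} {d : ℕ}
    (hF : F.IsHomogeneous d) (h1 : eval (Pi.single 2 1) F = 1) (s x : R) :
    (vert F s x).natDegree = d :=
  le_antisymm (natDegree_vert_le hF s x)
    (Polynomial.le_natDegree_of_ne_zero (by rw [coeff_vert hF, h1, map_one]; exact one_ne_zero))

end Vertical


/-! ### The Hessian and contact of order three. -/

section Hessian

/-- The chain rule for a derivation and a polynomial in three variables. -/
theorem derivation_aeval {A : Type*} [CommRing A] [Algebra ℂ A] (D : Derivation ℂ A A)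
    (v : Fin 3 → A) (F : MvPolynomial (Fin 3) ℂ) :
    D (aeval v F) = ∑ i, aeval v (pderiv i F) * D (v i) := by
  induction F using MvPolynomial.induction_on with
  | C a => simp [algHom_C]
  | add f g hf hg => simp only [map_add, hf, hg, add_mul, Finset.sum_add_distrib]
  | mul_X f j hf =>
    rw [map_mul, Derivation.leibniz, hf, aeval_X]
    simp only [Derivation.leibniz, pderiv_X, map_add, smul_eq_mul, map_mul, aeval_X, add_mul,
      Finset.sum_add_distrib]
    congr 1
    · rw [Finset.sum_eq_single j]
      · simp
      · intro i _ hi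
        simp [hi.symm]
      · simp
    · rw [Finset.mul_sum]
      exact Finset.sum_congr rfl fun i _ => (mul_assoc _ _ _).symm

theorem pderiv_comm (i j : Fin 3) (F : MvPolynomial (Fin 3) ℂ) :
    pderiv i (pderiv j F) = pderiv j (pderiv i F) := by
  induction F using MvPolynomial.induction_on with
  | C a => simp
  | add f g hf hg => simp only [map_add, hf, hg]
  | mul_X f k hf =>
    simp only [Derivation.leibniz, pderiv_X, smul_eq_mul, map_add, hf]
    have h : ∀ l m : Fin 3, pderiv m ((Pi.single l 1 : Fin 3 → MvPolynomial (Fin 3) ℂ) k) = 0 := by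
      intro l m
      rcases eq_or_ne k l with rfl | h
      · simp
      · simp [h]
    rw [h, h]
    ring

/-- The Hessian determinant. -/
def hess (F : MvPolynomial (Fin 3) ℂ) : MvPolynomial (Fin 3) ℂ :=
  (Matrix.of fun i j => pderiv i (pderiv j F)).det

theorem isHomogeneous_hess {F : MvPolynomial (Fin 3) ℂ} {d : ℕ} (hF : F.IsHomogeneous d) :
    (hess F).IsHomogeneous (3 * (d - 2)) := by
  have h : ∀ i j, (pderiv i (pderiv j F)).IsHomogeneous (d - 2) := fun i j => by
    have := (hF.pderiv (i := j)).pderiv (i := i)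
    rwa [Nat.sub_sub] at this
  have h3 : ∀ i j k l m n, (pderiv i (pderiv j F) * pderiv k (pderiv l F) *
      pderiv m (pderiv n F)).IsHomogeneous (3 * (d - 2)) := fun i j k l m n => by
    have := ((h i j).mul (h k l)).mul (h m n)
    convert this using 1
    ring
  rw [hess, Matrix.det_fin_three]
  simp only [Matrix.of_apply]
  exact (((((h3 _ _ _ _ _ _).sub (h3 _ _ _ _ _ _)).sub (h3 _ _ _ _ _ _)).add
    (h3 _ _ _ _ _ _)).add (h3 _ _ _ _ _ _)).sub (h3 _ _ _ _ _ _)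

theorem aeval_hess {A : Type*} [CommRing A] [Algebra ℂ A] (v : Fin 3 → A)
    (F : MvPolynomial (Fin 3) ℂ) :
    aeval v (hess F) = (Matrix.of fun i j => aeval v (pderiv i (pderiv j F))).det := by
  rw [hess, AlgHom.map_det]
  rfl

theorem euler {A : Type*} [CommRing A] [Algebra ℂ A] (v : Fin 3 → A)
    {F : MvPolynomial (Fin 3) ℂ} {d : ℕ} (hF : F.IsHomogeneous d) :
    ∑ i, v i * aeval v (pderiv i F) = d * aeval v F := by
  have := congrArg (aeval v) hF.sum_X_mul_pderiv
  simpa using this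

theorem derivative_lineRestr (F : MvPolynomial (Fin 3) ℂ) (p q : Fin 3 → ℂ) :
    (lineRestr F p q).derivative = ∑ i, Polynomial.C (q i) * lineRestr (pderiv i F) p q := by
  have h := derivation_aeval (Polynomial.derivative' (R := ℂ))
    (fun i => Polynomial.C (p i) + Polynomial.X * Polynomial.C (q i)) F
  refine h.trans (Finset.sum_congr rfl fun i _ => ?_)
  simp only [lineRestr]
  rw [mul_comm]
  congr 1
  simp

theorem two_mul_coeff_two_lineRestr (F : MvPolynomial (Fin 3) ℂ) (p q : Fin 3 → ℂ) :
    2 * (lineRestr F p q).coeff 2 =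
      ∑ j, ∑ i, q j * q i * eval p (pderiv i (pderiv j F)) := by
  have h := congrArg (fun P : Polynomial ℂ => P.coeff 1) (derivative_lineRestr F p q)
  simp only [Polynomial.coeff_derivative, Polynomial.finsetSum_coeff, Polynomial.coeff_C_mul,
    coeff_one_lineRestr] at h
  rw [show (2 : ℂ) * (lineRestr F p q).coeff 2 = (lineRestr F p q).coeff (1 + 1) * ((1 : ℕ) + 1) by
    push_cast; ring, h]
  refine Finset.sum_congr rfl fun j _ => ?_
  rw [Finset.mul_sum]
  refine Finset.sum_congr rfl fun i _ => ?_
  ring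

/-- The Hessian form in a frame adapted to a tangent line. -/
theorem det_sq_mul_hess {F : MvPolynomial (Fin 3) ℂ} {d : ℕ} (hF : F.IsHomogeneous d)
    (p q w : Fin 3 → ℂ) (h0 : eval p F = 0) (hq : ∑ i, eval p (pderiv i F) * q i = 0) :
    (Matrix.of ![p, q, w]).det ^ 2 * eval p (hess F) =
      - (((d - 1 : ℕ) : ℂ) * ∑ i, eval p (pderiv i F) * w i) ^ 2 *
        (2 * (lineRestr F p q).coeff 2) := by
  have e0 : ∑ i, p i * eval p (pderiv i F) = 0 := by
    have := euler p hF
    simp only [aeval_eq_eval] at this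
    rw [this, h0, mul_zero]
  have e1 : ∀ j, ∑ i, p i * eval p (pderiv i (pderiv j F)) =
      ((d - 1 : ℕ) : ℂ) * eval p (pderiv j F) := fun j => by
    have := euler p (hF.pderiv (i := j))
    simpa only [aeval_eq_eval] using this
  have hH : eval p (hess F) = (Matrix.of fun i j => eval p (pderiv i (pderiv j F))).det := by
    rw [← aeval_eq_eval, aeval_hess]
  set H : Matrix (Fin 3) (Fin 3) ℂ := Matrix.of fun i j => eval p (pderiv i (pderiv j F)) with hHdef
  set A : Matrix (Fin 3) (Fin 3) ℂ := Matrix.of ![p, q, w] with hA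
  have hsym : H.transpose = H := by
    ext i j
    simp only [hHdef, Matrix.transpose_apply, Matrix.of_apply]
    rw [pderiv_comm]
  -- Euler's relation for the partial derivatives turns the row of p into a multiple of the
  -- gradient. The Gram matrix in the frame p, q, w then has first row (0, 0, *), so only the entry
  -- at (q, q) and the square of * enter the determinant.
  have hAH : ∀ j, (A * H) 0 j = ((d - 1 : ℕ) : ℂ) * eval p (pderiv j F) := fun j => e1 j
  have hM0 : ∀ b, (A * H * A.transpose) 0 b =
      ((d - 1 : ℕ) : ℂ) * ∑ i, eval p (pderiv i F) * A b i := fun b => by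
    rw [Matrix.mul_apply, Finset.mul_sum]
    refine Finset.sum_congr rfl fun j _ => ?_
    rw [hAH, Matrix.transpose_apply, mul_assoc]
  have hMs : (A * H * A.transpose).transpose = A * H * A.transpose := by
    rw [Matrix.transpose_mul, Matrix.transpose_mul, Matrix.transpose_transpose, hsym,
      Matrix.mul_assoc]
  have h00 : (A * H * A.transpose) 0 0 = 0 := by
    rw [hM0]
    refine mul_eq_zero_of_right _ (Eq.trans (Finset.sum_congr rfl fun i _ => ?_) e0)
    rw [mul_comm]; rfl
  have h01 : (A * H * A.transpose) 0 1 = 0 := by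
    rw [hM0]
    exact mul_eq_zero_of_right _ hq
  have h02 := hM0 2
  have h10 : (A * H * A.transpose) 1 0 = 0 := by rw [← hMs]; exact h01
  have h20 := hM0 2
  rw [← hMs, Matrix.transpose_apply] at h20
  have h11 : (A * H * A.transpose) 1 1 = 2 * (lineRestr F p q).coeff 2 := by
    rw [two_mul_coeff_two_lineRestr, Matrix.mul_apply]
    refine Finset.sum_congr rfl fun j _ => ?_
    rw [Matrix.mul_apply, Finset.sum_mul]
    refine Finset.sum_congr rfl fun i _ => ?_
    simp only [hA, hHdef, Matrix.transpose_apply, Matrix.of_apply, Matrix.cons_val_one,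
      Matrix.cons_val_zero]
    ring
  have hdet : (A * H * A.transpose).det = A.det ^ 2 * H.det := by
    rw [Matrix.det_mul, Matrix.det_mul, Matrix.det_transpose]
    ring
  rw [hH, ← hdet, Matrix.det_fin_three, h00, h01, h10, h11, h02, h20]
  simp only [hA, Matrix.of_apply, Matrix.cons_val]
  ring

/-- Pure algebra behind the Hessian of a graph: the hypotheses are Euler's relations at (1, x, y)
and the first two derivatives of F(1, x, y(x)) = 0. They eliminate all other entries in favour of
F₂, F₁₂, F₂₂, y₁ and y₂. -/
theorem hessian_branch_identity {T : Type*} [CommRing T] {x y y₁ y₂ m F₀ F₁ F₂ F₀₀ F₀₁ F₀₂ F₁₁ F₁₂ F₂₂ : T}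
    (e : F₀ + x * F₁ + y * F₂ = 0) (e0 : F₀₀ + x * F₀₁ + y * F₀₂ = m * F₀)
    (e1 : F₀₁ + x * F₁₁ + y * F₁₂ = m * F₁) (e2 : F₀₂ + x * F₁₂ + y * F₂₂ = m * F₂)
    (h1 : F₁ + F₂ * y₁ = 0)
    (h2 : F₁₁ + F₁₂ * y₁ + ((F₁₂ + F₂₂ * y₁) * y₁ + F₂ * y₂) = 0) :
    (!![F₀₀, F₀₁, F₀₂; F₀₁, F₁₁, F₁₂; F₀₂, F₁₂, F₂₂]).det = m ^ 2 * F₂ ^ 3 * y₂ := by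
  obtain rfl : F₁₁ = - (F₁₂ * y₁ + ((F₁₂ + F₂₂ * y₁) * y₁ + F₂ * y₂)) := by linear_combination h2
  obtain rfl : F₁ = - (F₂ * y₁) := by linear_combination h1
  obtain rfl : F₀ = - (x * (- (F₂ * y₁)) + y * F₂) := by linear_combination e
  obtain rfl : F₀₂ = m * F₂ - (x * F₁₂ + y * F₂₂) := by linear_combination e2
  have a1 : F₀₁ = m * -(F₂ * y₁) -
      (x * -(F₁₂ * y₁ + ((F₁₂ + F₂₂ * y₁) * y₁ + F₂ * y₂)) + y * F₁₂) := by linear_combination e1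
  subst a1
  have a2 := eq_sub_of_add_eq ((add_assoc _ _ _).symm.trans e0)
  subst a2
  rw [Matrix.det_fin_three]
  simp
  ring

theorem X_cube_dvd_iff_hess {F : MvPolynomial (Fin 3) ℂ} {d : ℕ} (hF : F.IsHomogeneous d)
    (hd : 2 ≤ d) {p q w : Fin 3 → ℂ} (hq : Polynomial.X ^ 2 ∣ lineRestr F p q)
    (hpq : LinearIndependent ℂ ![p, q]) (hw : ¬ Polynomial.X ^ 2 ∣ lineRestr F p w) :
    Polynomial.X ^ 3 ∣ lineRestr F p q ↔ eval p (hess F) = 0 := by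
  have hq' := (X_sq_dvd_lineRestr_iff F p q).mp hq
  have hw' : ∑ i, eval p (pderiv i F) * w i ≠ 0 := fun h =>
    hw ((X_sq_dvd_lineRestr_iff F p w).mpr ⟨hq'.1, h⟩)
  have key := det_sq_mul_hess hF p q w hq'.1 hq'.2
  have h3 : Polynomial.X ^ 3 ∣ lineRestr F p q ↔ (lineRestr F p q).coeff 2 = 0 := by
    rw [Polynomial.X_pow_dvd_iff] at hq ⊢
    constructor
    · exact fun h => h 2 (by norm_num)
    · intro h k hk
      rcases Nat.lt_succ_iff_lt_or_eq.mp hk with h' | rfl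
      · exact hq k h'
      · exact h
  -- The gradient kills p by Euler and q by tangency, but not w, so w is outside their span.
  have hdet : (Matrix.of ![p, q, w]).det ≠ 0 := by
    intro h0
    obtain ⟨v, hv, hv0⟩ := Matrix.exists_vecMul_eq_zero_iff.mpr h0
    have hsum : ∀ i, v 0 * p i + v 1 * q i + v 2 * w i = 0 := fun i => by
      have := congrFun hv0 i
      simpa [Matrix.vecMul, dotProduct, Fin.sum_univ_three] using this
    have e0 : ∑ i, eval p (pderiv i F) * p i = 0 := by
      have := euler p hF
      simp only [aeval_eq_eval] at this
      rw [hq'.1, mul_zero] at this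
      rw [← this]
      exact Finset.sum_congr rfl fun i _ => mul_comm _ _
    have h2 : v 2 * ∑ i, eval p (pderiv i F) * w i = 0 := by
      have : ∑ i, eval p (pderiv i F) * (v 0 * p i + v 1 * q i + v 2 * w i) = 0 :=
        Finset.sum_eq_zero fun i _ => by rw [hsum, mul_zero]
      have hsplit : ∑ i, eval p (pderiv i F) * (v 0 * p i + v 1 * q i + v 2 * w i) =
          v 0 * ∑ i, eval p (pderiv i F) * p i + v 1 * ∑ i, eval p (pderiv i F) * q i +
          v 2 * ∑ i, eval p (pderiv i F) * w i := by
        simp only [Finset.mul_sum, ← Finset.sum_add_distrib]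
        exact Finset.sum_congr rfl fun i _ => by ring
      rw [hsplit, e0, hq'.2] at this
      simpa using this
    have hv2 : v 2 = 0 := (mul_eq_zero.mp h2).resolve_right hw'
    rw [LinearIndependent.pair_iff] at hpq
    have h01 := hpq (v 0) (v 1) (by
      ext i
      have := hsum i
      rw [hv2] at this
      simpa using this)
    apply hv
    ext i
    fin_cases i
    · exact h01.1
    · exact h01.2
    · exact hv2
  have hm : ((d - 1 : ℕ) : ℂ) ≠ 0 := by
    rw [Nat.cast_ne_zero]
    omega
  rw [h3]
  constructor
  · intro h
    rw [h, mul_zero, mul_zero] at key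
    exact (mul_eq_zero.mp key).resolve_left (pow_ne_zero 2 hdet)
  · intro h
    rw [h, mul_zero] at key
    have := (mul_eq_zero.mp key.symm).resolve_left
      (neg_ne_zero.mpr (pow_ne_zero 2 (mul_ne_zero hm hw')))
    simpa using this

end Hessian


/-! ### Branches: contact order against order of the Hessian. -/

section Branch

theorem constantCoeff_aeval (v : Fin 3 → PowerSeries ℂ) (G : MvPolynomial (Fin 3) ℂ) :
    PowerSeries.constantCoeff (aeval v G) =
      eval (fun i => PowerSeries.constantCoeff (v i)) G := by
  rw [map_aeval]
  have : (PowerSeries.constantCoeff (R := ℂ)).comp (algebraMap ℂ (PowerSeries ℂ)) =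
      RingHom.id ℂ := by
    ext; simp
  rw [this]
  rfl

theorem coe_lineRestr (F : MvPolynomial (Fin 3) ℂ) (p q : Fin 3 → ℂ) :
    ((lineRestr F p q : Polynomial ℂ) : PowerSeries ℂ) =
      aeval (fun i => PowerSeries.C (p i) + PowerSeries.X * PowerSeries.C (q i)) F := by
  have h := map_aeval (fun i => Polynomial.C (p i) + Polynomial.X * Polynomial.C (q i))
    (Polynomial.coeToPowerSeries.ringHom (R := ℂ)) F
  have h2 : (Polynomial.coeToPowerSeries.ringHom (R := ℂ)).comp (algebraMap ℂ (Polynomial ℂ)) =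
      algebraMap ℂ (PowerSeries ℂ) := by
    ext a : 1
    simp
  rw [h2] at h
  refine Eq.trans h ?_
  have h3 : (fun i => (Polynomial.coeToPowerSeries.ringHom (R := ℂ))
      (Polynomial.C (p i) + Polynomial.X * Polynomial.C (q i))) =
      fun i => PowerSeries.C (p i) + PowerSeries.X * PowerSeries.C (q i) := by
    funext i; simp [PowerSeries.X_mul]
  rw [h3]
  rfl

/-- `α` is the power series expansion at `x` of a branch of `F(1, X, Y) = 0`. -/
structure IsBranch (F : MvPolynomial (Fin 3) ℂ) (x y : ℂ) (α : PowerSeries ℂ) : Prop where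
  aeval_eq : aeval ![1, PowerSeries.C x + PowerSeries.X, α] F = 0
  constantCoeff_eq : PowerSeries.constantCoeff α = y
  deriv_ne : eval ![1, x, y] (pderiv 2 F) ≠ 0

theorem exists_isBranch {F : MvPolynomial (Fin 3) ℂ} {d : ℕ} (hF : F.IsHomogeneous d)
    (h1 : eval (Pi.single 2 1) F = 1) {x y : ℂ} (h0 : eval ![1, x, y] F = 0)
    (h2 : eval ![1, x, y] (pderiv 2 F) ≠ 0) : ∃ α, IsBranch F x y α := by
  have hv : (fun i => PowerSeries.constantCoeff
      ((![1, PowerSeries.C x + PowerSeries.X, PowerSeries.C y] : Fin 3 → PowerSeries ℂ) i)) =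
      ![1, x, y] := by
    funext i; fin_cases i <;> simp
  obtain ⟨α, hα, hy⟩ := exists_powerSeries_root
    (monic_vert hF h1 (1 : PowerSeries ℂ) (PowerSeries.C x + PowerSeries.X)) y
    (by rw [eval_vert, constantCoeff_aeval, hv, h0])
    (by rw [derivative_vert, eval_vert, constantCoeff_aeval, hv]; exact h2)
  exact ⟨α, by rwa [eval_vert] at hα, hy, h2⟩

variable {F : MvPolynomial (Fin 3) ℂ} {x y : ℂ} {α : PowerSeries ℂ}

theorem IsBranch.constantCoeff_aeval (h : IsBranch F x y α) (G : MvPolynomial (Fin 3) ℂ) :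
    PowerSeries.constantCoeff (aeval ![1, PowerSeries.C x + PowerSeries.X, α] G) =
      eval ![1, x, y] G := by
  rw [PlaneCurve.constantCoeff_aeval]
  have hv : (fun i => PowerSeries.constantCoeff
      ((![1, PowerSeries.C x + PowerSeries.X, α] : Fin 3 → PowerSeries ℂ) i)) =
      ![1, x, y] := by
    funext i; fin_cases i <;> simp [h.constantCoeff_eq]
  rw [hv]

theorem IsBranch.eval_eq (h : IsBranch F x y α) : eval ![1, x, y] F = 0 := by
  rw [← h.constantCoeff_aeval, h.aeval_eq, map_zero]

theorem IsBranch.isUnit_deriv (h : IsBranch F x y α) :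
    IsUnit (aeval ![1, PowerSeries.C x + PowerSeries.X, α] (pderiv 2 F)) := by
  rw [PowerSeries.isUnit_iff_constantCoeff, h.constantCoeff_aeval]
  exact h.deriv_ne.isUnit

theorem derivation_branch (G : MvPolynomial (Fin 3) ℂ) :
    PowerSeries.derivative ℂ (aeval ![1, PowerSeries.C x + PowerSeries.X, α] G) =
      aeval ![1, PowerSeries.C x + PowerSeries.X, α] (pderiv 1 G) +
      aeval ![1, PowerSeries.C x + PowerSeries.X, α] (pderiv 2 G) *
        PowerSeries.derivative ℂ α := by
  rw [derivation_aeval, Fin.sum_univ_three]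
  simp [PowerSeries.derivative_X, PowerSeries.derivative_C]

theorem IsBranch.aeval_hess (h : IsBranch F x y α) {d : ℕ} (hF : F.IsHomogeneous d) :
    aeval ![1, PowerSeries.C x + PowerSeries.X, α] (hess F) =
      ((d - 1 : ℕ) : PowerSeries ℂ) ^ 2 *
        aeval ![1, PowerSeries.C x + PowerSeries.X, α] (pderiv 2 F) ^ 3 *
        PowerSeries.derivative ℂ (PowerSeries.derivative ℂ α) := by
  have h1 := derivation_branch (x := x) (α := α) F
  rw [h.aeval_eq, map_zero] at h1
  have h2 := congrArg (PowerSeries.derivative ℂ) h1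
  rw [map_zero, map_add, Derivation.leibniz, derivation_branch, derivation_branch] at h2
  have e := euler ![1, PowerSeries.C x + PowerSeries.X, α] hF
  have e1 := fun j => euler ![1, PowerSeries.C x + PowerSeries.X, α] (hF.pderiv (i := j))
  rw [h.aeval_eq, mul_zero] at e
  have e10 := e1 0
  have e11 := e1 1
  have e12 := e1 2
  rw [PlaneCurve.aeval_hess]
  simp only [Fin.sum_univ_three, Matrix.cons_val, one_mul, smul_eq_mul] at e e10 e11 e12 h2
  rw [pderiv_comm 1 0, pderiv_comm 2 0] at e10
  rw [pderiv_comm 2 1] at e11 h2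
  have key := hessian_branch_identity e e10 e11 e12 h1.symm
    (y₂ := PowerSeries.derivative ℂ (PowerSeries.derivative ℂ α)) (by linear_combination -h2)
  rw [← key]
  congr 1
  ext1 i j
  fin_cases i <;> fin_cases j <;> simp [pderiv_comm 1 0, pderiv_comm 2 0, pderiv_comm 2 1]

/-- Factor F(1, x + X, Y) = (Y - α) f(Y). As f is a unit on the tangent line l, contact with l is
the order of l - α. This vanishes to order n + 2 exactly when α'' vanishes to order n, and α'' is
the Hessian up to a unit. -/
theorem IsBranch.X_pow_dvd_iff (h : IsBranch F x y α) {d : ℕ} (hd : 2 ≤ d)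
    (hF : F.IsHomogeneous d) (n : ℕ) :
    Polynomial.X ^ (n + 2) ∣ lineRestr F ![1, x, y] ![0, 1, PowerSeries.coeff 1 α] ↔
      PowerSeries.X ^ n ∣ aeval ![1, PowerSeries.C x + PowerSeries.X, α] (hess F) := by
  set l : PowerSeries ℂ := PowerSeries.C y + PowerSeries.X * PowerSeries.C (PowerSeries.coeff 1 α)
    with hl
  have hcl : PowerSeries.constantCoeff l = y := by simp [hl]
  have hv : (fun i => PowerSeries.C ((![1, x, y] : Fin 3 → ℂ) i) + PowerSeries.X *
      PowerSeries.C ((![0, 1, PowerSeries.coeff 1 α] : Fin 3 → ℂ) i)) =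
      ![1, PowerSeries.C x + PowerSeries.X, l] := by
    funext i; fin_cases i <;> simp [hl]
  obtain ⟨f, hf⟩ := Polynomial.dvd_iff_isRoot.mpr
    (show (vert F 1 (PowerSeries.C x + PowerSeries.X)).IsRoot α by
      rw [Polynomial.IsRoot, eval_vert, h.aeval_eq])
  have hder : f.eval α = aeval ![1, PowerSeries.C x + PowerSeries.X, α] (pderiv 2 F) := by
    rw [← eval_vert, ← derivative_vert, hf]
    simp
  have hunit : IsUnit (f.eval l) := by
    have h3 : ∀ β, PowerSeries.constantCoeff β = y → PowerSeries.constantCoeff (f.eval β) =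
        (f.map PowerSeries.constantCoeff).eval y := fun β hβ => by
      rw [← hβ, Polynomial.eval_map_apply]
    rw [PowerSeries.isUnit_iff_constantCoeff, h3 l hcl, ← h3 α h.constantCoeff_eq, hder,
      h.constantCoeff_aeval]
    exact h.deriv_ne.isUnit
  have hm : IsUnit (((d - 1 : ℕ) : PowerSeries ℂ) ^ 2 *
      aeval ![1, PowerSeries.C x + PowerSeries.X, α] (pderiv 2 F) ^ 3) := by
    refine IsUnit.mul (IsUnit.pow _ ?_) (h.isUnit_deriv.pow _)
    rw [PowerSeries.isUnit_iff_constantCoeff, map_natCast]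
    have : ((d - 1 : ℕ) : ℂ) ≠ 0 := by
      rw [Nat.cast_ne_zero]
      omega
    exact this.isUnit
  rw [h.aeval_hess hF, hm.dvd_mul_left, ← coe_X_pow_dvd_iff, coe_lineRestr, hv, ← eval_vert, hf,
    Polynomial.eval_mul, hunit.dvd_mul_right, PowerSeries.X_pow_dvd_iff, PowerSeries.X_pow_dvd_iff]
  simp only [Polynomial.eval_sub, Polynomial.eval_X, Polynomial.eval_C]
  have hc : ∀ m, PowerSeries.coeff m (PowerSeries.derivative ℂ (PowerSeries.derivative ℂ α)) = 0 ↔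
      PowerSeries.coeff (m + 2) (l - α) = 0 := fun m => by
    have h1 : ((m : ℂ) + 1) ≠ 0 := Nat.cast_add_one_ne_zero m
    have h2 : ((m : ℂ) + 1 + 1) ≠ 0 := by
      exact_mod_cast Nat.succ_ne_zero (m + 1)
    have h3 : PowerSeries.coeff (m + 2) l = 0 := by
      rw [hl, map_add, show m + 2 = (m + 1) + 1 from rfl, PowerSeries.coeff_succ_X_mul,
        PowerSeries.coeff_C, PowerSeries.coeff_C]
      simp
    rw [PowerSeries.coeff_derivative, PowerSeries.coeff_derivative, map_sub, h3]
    simp [h1, h2]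
  simp only [hc]
  constructor
  · exact fun H m hm => H (m + 2) (by omega)
  · intro H m hm
    rcases m with _ | _ | m
    · simp [hcl, h.constantCoeff_eq]
    · rw [map_sub, hl, map_add, PowerSeries.coeff_succ_X_mul]
      simp [PowerSeries.coeff_C]
    · exact H m (by omega)

/-- Since ∂F/∂z₃ ≠ 0, the gradient has a two-dimensional kernel, so every tangent direction comes
from the branch. -/
theorem IsBranch.exists_tangent (h : IsBranch F x y α) {d : ℕ} (hd : 2 ≤ d)
    (hF : F.IsHomogeneous d) {q : Fin 3 → ℂ} (hq : LinearIndependent ℂ ![![1, x, y], q])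
    (hX : Polynomial.X ^ 2 ∣ lineRestr F ![1, x, y] q) :
    ∃ a b : ℂ, b ≠ 0 ∧ q = a • ![1, x, y] + b • ![0, 1, PowerSeries.coeff 1 α] := by
  have h0 := ((X_sq_dvd_lineRestr_iff _ _ _).mp ((h.X_pow_dvd_iff hd hF 0).mpr (by simp))).2
  have h1 := ((X_sq_dvd_lineRestr_iff _ _ _).mp hX).2
  have h2 := euler ![1, x, y] hF
  simp only [aeval_eq_eval, h.eval_eq, mul_zero] at h2
  simp only [Fin.sum_univ_three, Matrix.cons_val, mul_zero, mul_one, one_mul, zero_add] at h0 h1 h2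
  have h3 : q 2 - q 0 * y = (q 1 - q 0 * x) * PowerSeries.coeff 1 α := by
    apply mul_left_cancel₀ h.deriv_ne
    linear_combination h1 - q 0 * h2 - (q 1 - q 0 * x) * h0
  have hEq : q = q 0 • ![1, x, y] + (q 1 - q 0 * x) • ![0, 1, PowerSeries.coeff 1 α] := by
    ext i
    fin_cases i
    · simp
    · simp
    · simp [← h3]
  refine ⟨q 0, q 1 - q 0 * x, fun hb => ?_, hEq⟩
  rw [hb, zero_smul, add_zero] at hEq
  have := (LinearIndependent.pair_iff.mp hq) (q 0) (-1) (by rw [← hEq]; simp)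
  simp at this

theorem linearIndependent_tangent (x y c : ℂ) :
    LinearIndependent ℂ ![![1, x, y], ![0, 1, c]] := by
  rw [LinearIndependent.pair_iff]
  intro s t hst
  have e0 := congrFun hst 0
  have e1 := congrFun hst 1
  simp at e0 e1
  rw [e0] at e1
  exact ⟨e0, by simpa using e1⟩

theorem IsBranch.isFlex_iff (h : IsBranch F x y α) {d : ℕ} (hd : 2 ≤ d)
    (hF : F.IsHomogeneous d) (r : ℕ) :
    IsFlex F r ![1, x, y] ↔ 1 ≤ r ∧
      PowerSeries.X ^ r ∣ aeval ![1, PowerSeries.C x + PowerSeries.X, α] (hess F) ∧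
      ¬ PowerSeries.X ^ (r + 1) ∣ aeval ![1, PowerSeries.C x + PowerSeries.X, α] (hess F) := by
  rw [← h.X_pow_dvd_iff hd hF r, ← h.X_pow_dvd_iff hd hF (r + 1)]
  constructor
  · rintro ⟨hr, -, q, hq, h1, h2⟩
    obtain ⟨a, b, hb, rfl⟩ := h.exists_tangent hd hF hq
      ((pow_dvd_pow _ (by omega)).trans h1)
    have key := fun m => X_pow_dvd_lineRestr_iff (m := m) (p := ![1, x, y])
      (q := ![0, 1, PowerSeries.coeff 1 α]) hF (one_ne_zero (α := ℂ)) a hb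
    simp only [one_smul] at key
    rw [key] at h1 h2
    exact ⟨hr, h1, h2⟩
  · rintro ⟨hr, h1, h2⟩
    refine ⟨hr, ?_, _, ?_, h1, h2⟩
    · rw [exists_not_X_sq_dvd_iff _ _ h.eval_eq]
      exact fun H => h.deriv_ne (congrFun H 2)
    · exact linearIndependent_tangent x y _

end Branch


/-! ### Elimination of the last variable. -/

section Resultant

variable {R S : Type*} [CommRing R] [Algebra ℂ R] [CommRing S] [Algebra ℂ S]

/-- The resultant of `F(s, x, Y)` and `H(s, x, Y)`, regarded as polynomials of degrees `d`, `e`. -/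
def elim (F H : MvPolynomial (Fin 3) ℂ) (d e : ℕ) (s x : R) : R :=
  (vert F s x).resultant (vert H s x) d e

theorem map_elim (φ : R →ₐ[ℂ] S) (F H : MvPolynomial (Fin 3) ℂ) (d e : ℕ) (s x : R) :
    φ (elim F H d e s x) = elim F H d e (φ s) (φ x) := by
  have h := Polynomial.resultant_map_map (vert F s x) (vert H s x) d e (φ : R →+* S)
  rw [map_vert, map_vert] at h
  exact h.symm

variable {F H : MvPolynomial (Fin 3) ℂ} {d e : ℕ}

theorem elim_eq_prod (hF : F.IsHomogeneous d) (h1 : eval (Pi.single 2 1) F = 1)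
    (hH : H.IsHomogeneous e) (s x : ℂ) :
    elim F H d e s x = ((vert F s x).roots.map fun y => eval ![s, x, y] H).prod := by
  have h := Polynomial.resultant_eq_prod_eval (vert F s x) (vert H s x) e
    (natDegree_vert_le hH s x) (IsAlgClosed.splits _)
  rw [natDegree_vert hF h1, (monic_vert hF h1 s x).leadingCoeff, one_pow, one_mul] at h
  rw [elim, h]
  simp only [eval_vert, aeval_eq_eval]

theorem mem_roots_vert (hF : F.IsHomogeneous d) (h1 : eval (Pi.single 2 1) F = 1) {s x y : ℂ} :
    y ∈ (vert F s x).roots ↔ eval ![s, x, y] F = 0 := by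
  rw [Polynomial.mem_roots (monic_vert hF h1 s x).ne_zero, Polynomial.IsRoot, eval_vert,
    aeval_eq_eval]

theorem elim_eq_zero_iff (hF : F.IsHomogeneous d) (h1 : eval (Pi.single 2 1) F = 1)
    (hH : H.IsHomogeneous e) (s x : ℂ) :
    elim F H d e s x = 0 ↔ ∃ y, eval ![s, x, y] F = 0 ∧ eval ![s, x, y] H = 0 := by
  rw [elim_eq_prod hF h1 hH, Multiset.prod_eq_zero_iff, Multiset.mem_map]
  simp only [mem_roots_vert hF h1]

theorem vert_smul (hF : F.IsHomogeneous d) (h1 : eval (Pi.single 2 1) F = 1) {l : ℂ} (hl : l ≠ 0)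
    (s x : ℂ) : vert F (l * s) (l * x) =
      (((vert F s x).roots.map (l * ·)).map fun y => Polynomial.X - Polynomial.C y).prod := by
  have hcard : (vert F s x).roots.card = d := by
    rw [← (IsAlgClosed.splits (vert F s x)).natDegree_eq_card_roots, natDegree_vert hF h1]
  apply Polynomial.funext
  intro y
  have hv : (![l * s, l * x, y] : Fin 3 → ℂ) = fun i => l * (![s, x, l⁻¹ * y] : Fin 3 → ℂ) i := by
    funext i
    fin_cases i
    · simp
    · simp
    · simp [hl]
  rw [eval_vert, hv, aeval_smul_of_isHomogeneous hF, ← eval_vert,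
    (IsAlgClosed.splits (vert F s x)).eq_prod_roots_of_monic (monic_vert hF h1 s x),
    Polynomial.roots_multiset_prod_X_sub_C, Polynomial.eval_multiset_prod,
    Polynomial.eval_multiset_prod, Multiset.map_map, Multiset.map_map, Multiset.map_map,
    ← hcard, ← Multiset.prod_replicate, ← Multiset.map_const', ← Multiset.prod_map_mul]
  refine congrArg Multiset.prod (Multiset.map_congr rfl fun z _ => ?_)
  simp [mul_sub, hl]

/-- Scaling s and x by l scales the d roots by l, hence each factor H(s, x, y) by l ^ e. -/
theorem elim_smul (hF : F.IsHomogeneous d) (h1 : eval (Pi.single 2 1) F = 1)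
    (hH : H.IsHomogeneous e) {l : ℂ} (hl : l ≠ 0) (s x : ℂ) :
    elim F H d e (l * s) (l * x) = l ^ (d * e) * elim F H d e s x := by
  have hcard : (vert F s x).roots.card = d := by
    rw [← (IsAlgClosed.splits (vert F s x)).natDegree_eq_card_roots, natDegree_vert hF h1]
  rw [elim_eq_prod hF h1 hH, elim_eq_prod hF h1 hH, vert_smul hF h1 hl,
    Polynomial.roots_multiset_prod_X_sub_C, Multiset.map_map, mul_comm d e, pow_mul]
  conv_rhs => rw [← hcard, ← Multiset.prod_replicate, ← Multiset.map_const',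
    ← Multiset.prod_map_mul]
  refine congrArg Multiset.prod (Multiset.map_congr rfl fun y _ => ?_)
  have hv : (![l * s, l * x, l * y] : Fin 3 → ℂ) = fun i => l * (![s, x, y] : Fin 3 → ℂ) i := by
    funext i
    fin_cases i <;> simp
  simp only [Function.comp_apply]
  rw [hv, ← aeval_eq_eval, aeval_smul_of_isHomogeneous hH, aeval_eq_eval]

/-- The eliminant, as a polynomial in the affine coordinate `x`. -/
def eliminant (F H : MvPolynomial (Fin 3) ℂ) (d e : ℕ) : Polynomial ℂ :=
  elim F H d e 1 Polynomial.X

theorem aeval_eliminant (w : R) : Polynomial.aeval w (eliminant F H d e) = elim F H d e 1 w := by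
  rw [eliminant, map_elim, map_one, Polynomial.aeval_X]

theorem natDegree_eliminant (hF : F.IsHomogeneous d) (h1 : eval (Pi.single 2 1) F = 1)
    (hH : H.IsHomogeneous e) (h0 : elim F H d e (0 : ℂ) 1 ≠ 0) :
    (eliminant F H d e).natDegree = d * e := by
  set r : Polynomial ℂ := elim F H d e Polynomial.X 1 with hr
  have hr_eval : ∀ t : ℂ, r.eval t = elim F H d e t 1 := fun t => by
    rw [← Polynomial.coe_aeval_eq_eval, hr, map_elim, map_one, Polynomial.aeval_X]
  have hr0 : r.coeff 0 ≠ 0 := by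
    rw [Polynomial.coeff_zero_eq_eval_zero, hr_eval]
    exact h0
  -- Homogeneity says E(x) = x^(de) r(1/x) for the restriction r to x = 1, written here without
  -- negative powers. As r(0) ≠ 0, reversal preserves the degree of r, and E has full degree de.
  have key : Polynomial.X ^ r.natDegree * eliminant F H d e = Polynomial.X ^ (d * e) * r.reverse := by
    refine Polynomial.eq_of_infinite_eval_eq _ _ ((Set.finite_singleton (0 : ℂ)).infinite_compl.mono
      fun x hx => ?_)
    have hx : x ≠ 0 := hx
    have hE : (eliminant F H d e).eval x = x ^ (d * e) * r.eval x⁻¹ := by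
      rw [← Polynomial.coe_aeval_eq_eval, aeval_eliminant, hr_eval, ← elim_smul hF h1 hH hx,
        mul_inv_cancel₀ hx, mul_one]
    let _ : Invertible x⁻¹ := invertibleOfNonzero (inv_ne_zero hx)
    have hrev := Polynomial.eval₂_reverse_mul_pow (RingHom.id ℂ) x⁻¹ r
    rw [invOf_eq_inv, inv_inv] at hrev
    change r.reverse.eval x * _ = r.eval x⁻¹ at hrev
    simp only [Set.mem_ofPred_eq, Polynomial.eval_mul, Polynomial.eval_pow, Polynomial.eval_X, hE,
      ← hrev]
    rw [inv_pow]
    field_simp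
  have hr_ne : r ≠ 0 := fun h => hr0 (by rw [h, Polynomial.coeff_zero])
  have hE_ne : eliminant F H d e ≠ 0 := by
    intro h
    rw [h, mul_zero] at key
    exact mul_ne_zero (pow_ne_zero _ Polynomial.X_ne_zero)
      (Polynomial.reverse_eq_zero.not.mpr hr_ne) key.symm
  have hdeg := congrArg Polynomial.natDegree key
  rw [Polynomial.natDegree_mul (pow_ne_zero _ Polynomial.X_ne_zero) hE_ne,
    Polynomial.natDegree_mul (pow_ne_zero _ Polynomial.X_ne_zero)
      (Polynomial.reverse_eq_zero.not.mpr hr_ne), Polynomial.natDegree_X_pow,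
    Polynomial.natDegree_X_pow, Polynomial.reverse_natDegree,
    Polynomial.natTrailingDegree_eq_zero.mpr (Or.inr hr0)] at hdeg
  omega

/-- With F = (Y - α) f, the resultant is H(α) times the resultant of f and H. The latter is a unit:
at X = 0 a common root could only be y, but y is a simple root of F(1, x, Y) and so not a root of f.
-/
theorem X_pow_dvd_elim_iff (hF : F.IsHomogeneous d) (h1 : eval (Pi.single 2 1) F = 1)
    (hH : H.IsHomogeneous e) {x y : ℂ} {α : PowerSeries ℂ} (h : IsBranch F x y α)
    (hu : ∀ z, eval ![1, x, z] F = 0 → eval ![1, x, z] H = 0 → z = y) (n : ℕ) :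
    PowerSeries.X ^ n ∣ elim F H d e 1 (PowerSeries.C x + PowerSeries.X) ↔
      PowerSeries.X ^ n ∣ aeval ![1, PowerSeries.C x + PowerSeries.X, α] H := by
  set x' : PowerSeries ℂ := PowerSeries.C x + PowerSeries.X with hx'
  obtain ⟨f, hf⟩ := Polynomial.dvd_iff_isRoot.mpr
    (show (vert F 1 x').IsRoot α by rw [Polynomial.IsRoot, eval_vert, h.aeval_eq])
  have hfm : f.Monic := (Polynomial.monic_X_sub_C α).of_mul_monic_left
    (by rw [← hf]; exact monic_vert hF h1 _ _)
  have hdeg : 1 + f.natDegree = d := by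
    rw [← natDegree_vert hF h1 (1 : PowerSeries ℂ) x', hf, (Polynomial.monic_X_sub_C α).natDegree_mul hfm,
      Polynomial.natDegree_X_sub_C]
  have hmul := Polynomial.resultant_mul_left (Polynomial.X - Polynomial.C α) f (vert H 1 x') e
    (natDegree_vert_le hH _ _)
  rw [Polynomial.natDegree_X_sub_C, hdeg, ← hf,
    Polynomial.resultant_X_sub_C_left _ _ _ (natDegree_vert_le hH _ _), eval_vert] at hmul
  have hunit : IsUnit (f.resultant (vert H 1 x') f.natDegree e) := by
    let c : PowerSeries ℂ →ₐ[ℂ] ℂ := { PowerSeries.constantCoeff (R := ℂ) with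
      commutes' := fun r => by simp }
    have hcx : c x' = x := by
      change PowerSeries.constantCoeff x' = x
      simp [hx']
    have hmapF : ∀ G, (vert G 1 x').map (c : PowerSeries ℂ →+* ℂ) = vert G 1 x := fun G => by
      rw [map_vert, map_one, hcx]
    have hfc := congrArg (Polynomial.map (c : PowerSeries ℂ →+* ℂ)) hf
    rw [hmapF, Polynomial.map_mul, Polynomial.map_sub, Polynomial.map_X, Polynomial.map_C] at hfc
    have hcα : (c : PowerSeries ℂ →+* ℂ) α = y := h.constantCoeff_eq
    rw [hcα] at hfc
    have hfcm : (f.map (c : PowerSeries ℂ →+* ℂ)).natDegree = f.natDegree := hfm.natDegree_map _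
    rw [PowerSeries.isUnit_iff_constantCoeff, isUnit_iff_ne_zero]
    change (c : PowerSeries ℂ →+* ℂ) _ ≠ 0
    rw [← Polynomial.resultant_map_map, hmapF, ← hfcm,
      Polynomial.resultant_eq_prod_eval _ _ _ (natDegree_vert_le hH _ _) (IsAlgClosed.splits _),
      (hfm.map _).leadingCoeff, one_pow, one_mul, Ne, Multiset.prod_eq_zero_iff, Multiset.mem_map]
    rintro ⟨z, hz, hz0⟩
    rw [Polynomial.mem_roots (hfm.map _).ne_zero, Polynomial.IsRoot] at hz
    rw [eval_vert, aeval_eq_eval] at hz0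
    have hzF : eval ![1, x, z] F = 0 := by
      rw [← aeval_eq_eval, ← eval_vert, hfc, Polynomial.eval_mul, hz, mul_zero]
    obtain rfl := hu z hzF hz0
    apply h.deriv_ne
    rw [← aeval_eq_eval, ← eval_vert, ← derivative_vert, hfc]
    simp [hz]
  rw [elim, hmul, hunit.dvd_mul_right]

theorem X_sub_C_pow_dvd_eliminant_iff {x : ℂ} {n : ℕ} :
    (Polynomial.X - Polynomial.C x) ^ n ∣ eliminant F H d e ↔
      PowerSeries.X ^ n ∣ elim F H d e 1 (PowerSeries.C x + PowerSeries.X) := by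
  have h := Polynomial.dvd_comp_X_add_C_iff (Polynomial.X ^ n) (eliminant F H d e) x
  rw [Polynomial.pow_comp, Polynomial.X_comp] at h
  rw [← h, ← coe_X_pow_dvd_iff]
  have h2 : (((eliminant F H d e).comp (Polynomial.X + Polynomial.C x) : Polynomial ℂ) :
      PowerSeries ℂ) = elim F H d e 1 (PowerSeries.C x + PowerSeries.X) := by
    rw [← aeval_eliminant, Polynomial.aeval_def, Polynomial.comp]
    have := Polynomial.hom_eval₂ (eliminant F H d e) Polynomial.C
      (Polynomial.coeToPowerSeries.ringHom (R := ℂ)) (Polynomial.X + Polynomial.C x)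
    refine this.trans ?_
    have h3 : (Polynomial.coeToPowerSeries.ringHom (R := ℂ)).comp Polynomial.C =
        algebraMap ℂ (PowerSeries ℂ) := by
      ext a : 1
      simp
    rw [h3]
    congr 1
    simp [add_comm]
  rw [h2]

theorem X_sub_C_pow_dvd_eliminant_iff_of_isBranch (hF : F.IsHomogeneous d)
    (h1 : eval (Pi.single 2 1) F = 1)
    (hH : H.IsHomogeneous e) {x y : ℂ} {α : PowerSeries ℂ} (h : IsBranch F x y α)
    (hu : ∀ z, eval ![1, x, z] F = 0 → eval ![1, x, z] H = 0 → z = y) (n : ℕ) :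
    (Polynomial.X - Polynomial.C x) ^ n ∣ eliminant F H d e ↔
      PowerSeries.X ^ n ∣ aeval ![1, PowerSeries.C x + PowerSeries.X, α] H :=
  X_sub_C_pow_dvd_eliminant_iff.trans (X_pow_dvd_elim_iff hF h1 hH h hu n)

end Resultant


/-! ### The Hessian shares no component with the curve. -/

section CommonFactor

/-- Vanishing of the resultant gives a common irreducible factor over ℂ(x), which Gauss's lemma
makes monic over ℂ[x]. In characteristic zero it is separable, so it has a simple root above any x
where the resultant of P and its derivative is nonzero. -/
theorem exists_common_factor {f h : Polynomial (Polynomial ℂ)} (hf : f.Monic) {e : ℕ}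
    (he : h.natDegree ≤ e) (hres : f.resultant h f.natDegree e = 0) :
    ∃ P : Polynomial (Polynomial ℂ), P.Monic ∧ P ∣ f ∧ P ∣ h ∧ ∃ x y : ℂ,
      (P.map (Polynomial.evalRingHom x)).eval y = 0 ∧
      (P.derivative.map (Polynomial.evalRingHom x)).eval y ≠ 0 := by
  let K := FractionRing (Polynomial ℂ)
  let ι : Polynomial ℂ →+* K := algebraMap (Polynomial ℂ) K
  have hι : Function.Injective ι := IsFractionRing.injective (Polynomial ℂ) K
  have hfK : (f.map ι).Monic := hf.map ι
  have hfd : (f.map ι).natDegree = f.natDegree := hf.natDegree_map ι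
  have hhd : (h.map ι).natDegree ≤ e := Polynomial.natDegree_map_le.trans he
  have h1 : (f.map ι).resultant (h.map ι) = 0 := by
    have h2 := Polynomial.resultant_add_right_deg (f.map ι) (h.map ι) f.natDegree
      (h.map ι).natDegree (e - (h.map ι).natDegree) le_rfl
    rw [Nat.add_sub_cancel' hhd, Polynomial.resultant_map_map, hres, map_zero, ← hfd,
      hfK.coeff_natDegree, one_pow, one_mul] at h2
    exact h2.symm
  have h2 := (Polynomial.resultant_eq_zero_iff.mp h1).2
  obtain ⟨z, hz, hzf, hzh⟩ : ∃ z, Irreducible z ∧ z ∣ f.map ι ∧ z ∣ h.map ι := by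
    by_contra! hcon
    exact h2 (isCoprime_of_irreducible_dvd (fun h => hfK.ne_zero h.1) hcon)
  obtain ⟨P, hP⟩ := IsIntegrallyClosed.eq_map_mul_C_of_dvd K hf hzf
  change P.map ι * _ = z at hP
  have hlc : z.leadingCoeff ≠ 0 := Polynomial.leadingCoeff_ne_zero.mpr hz.ne_zero
  have hunit : IsUnit (Polynomial.C z.leadingCoeff) := Polynomial.isUnit_C.mpr hlc.isUnit
  have hPm : P.Monic := by
    apply Polynomial.monic_of_injective hι
    have := congrArg Polynomial.leadingCoeff hP
    rw [Polynomial.leadingCoeff_mul, Polynomial.leadingCoeff_C] at this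
    exact mul_right_cancel₀ hlc (this.trans (one_mul _).symm)
  have hass : Associated (P.map ι) z := ⟨hunit.unit, hP⟩
  have hirr : Irreducible (P.map ι) := hass.irreducible_iff.mpr hz
  have hPf : P ∣ f := (Polynomial.map_dvd_map ι hι hPm).mp (hass.dvd.trans hzf)
  have hPh : P ∣ h := (Polynomial.map_dvd_map ι hι hPm).mp (hass.dvd.trans hzh)
  have hsep : IsCoprime (P.map ι) (P.map ι).derivative := hirr.separable
  have hδ : P.resultant P.derivative ≠ 0 := by
    intro h0
    apply Polynomial.resultant_ne_zero _ _ hsep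
    rw [Polynomial.derivative_map, Polynomial.natDegree_map_eq_of_injective hι,
      Polynomial.natDegree_map_eq_of_injective hι, Polynomial.resultant_map_map, h0, map_zero]
  have hdeg : 0 < P.natDegree := by
    rw [← hPm.natDegree_map ι]
    exact hirr.natDegree_pos
  obtain ⟨a, b, -, -, hab⟩ := Polynomial.exists_mul_add_mul_eq_C_resultant P P.derivative le_rfl
    le_rfl (Or.inl hdeg.ne')
  obtain ⟨x, hx⟩ : ∃ x : ℂ, (P.resultant P.derivative).eval x ≠ 0 := by
    by_contra! hcon
    exact hδ (Polynomial.funext fun x => by rw [hcon, Polynomial.eval_zero])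
  have hPx : (P.map (Polynomial.evalRingHom x)).degree ≠ 0 := by
    rw [hPm.degree_map, Polynomial.degree_eq_natDegree hPm.ne_zero]
    exact_mod_cast hdeg.ne'
  obtain ⟨y, hy⟩ := IsAlgClosed.exists_root _ hPx
  refine ⟨P, hPm, hPf, hPh, x, y, hy, fun hy' => hx ?_⟩
  have := congrArg (fun Q => (Polynomial.map (Polynomial.evalRingHom x) Q).eval y) hab
  simp only [Polynomial.map_add, Polynomial.map_mul, Polynomial.eval_add, Polynomial.eval_mul,
    Polynomial.map_C, Polynomial.eval_C] at this
  rw [hy, hy', zero_mul, zero_mul, add_zero] at this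
  exact this.symm

end CommonFactor

section Eliminant

variable {F : MvPolynomial (Fin 3) ℂ} {d : ℕ}

theorem lineRestr_eq_eval_map (F : MvPolynomial (Fin 3) ℂ) (x y a b : ℂ) :
    lineRestr F ![1, x, y] ![0, a, b] =
      ((vert F 1 Polynomial.X).map ((Polynomial.aeval (Polynomial.C x + Polynomial.X *
        Polynomial.C a) : Polynomial ℂ →ₐ[ℂ] Polynomial ℂ) : Polynomial ℂ →+* Polynomial ℂ)).eval
      (Polynomial.C y + Polynomial.X * Polynomial.C b) := by
  rw [map_vert, eval_vert, map_one, Polynomial.aeval_X, lineRestr]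
  have hv : (fun i => Polynomial.C ((![1, x, y] : Fin 3 → ℂ) i) + Polynomial.X *
      Polynomial.C ((![0, a, b] : Fin 3 → ℂ) i)) =
      ![1, Polynomial.C x + Polynomial.X * Polynomial.C a,
        Polynomial.C y + Polynomial.X * Polynomial.C b] := by
    funext i; fin_cases i <;> simp
  rw [hv]

/-- A common factor would give a branch of the curve along which the Hessian vanishes identically.
Its tangent line would then have infinite contact and be a component. Smoothness ensures that the
cofactor does not vanish at the chosen point, so the branch is one of F. -/
theorem eliminant_hess_ne_zero (hd : 2 ≤ d) (hF : F.IsHomogeneous d)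
    (h1 : eval (Pi.single 2 1) F = 1)
    (hns : ∀ z : Fin 3 → ℂ, z ≠ 0 → ¬ ∀ w, Polynomial.X ^ 2 ∣ lineRestr F z w)
    (hline : ∀ p q, LinearIndependent ℂ ![p, q] → lineRestr F p q ≠ 0) :
    eliminant F (hess F) d (3 * (d - 2)) ≠ 0 := by
  intro h0
  have hfm := monic_vert hF h1 (1 : Polynomial ℂ) Polynomial.X
  obtain ⟨P, hPm, ⟨Q, hQ⟩, ⟨Q', hQ'⟩, x, y, hy, hy'⟩ := exists_common_factor hfm
    (natDegree_vert_le (isHomogeneous_hess hF) (1 : Polynomial ℂ) Polynomial.X)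
    (by rw [natDegree_vert hF h1]; exact h0)
  have hmap : ∀ G, (vert G 1 Polynomial.X).map (Polynomial.evalRingHom x) = vert G 1 x :=
    fun G => by
      have := map_vert (Polynomial.aeval x : Polynomial ℂ →ₐ[ℂ] ℂ) G 1 Polynomial.X
      rw [map_one, Polynomial.aeval_X] at this
      exact this
  have hFx : vert F 1 x = P.map (Polynomial.evalRingHom x) * Q.map (Polynomial.evalRingHom x) := by
    rw [← hmap, hQ, Polynomial.map_mul]
  -- the factor `P` is reduced at the point since the curve is nonsingular
  have hQ0 : (Q.map (Polynomial.evalRingHom x)).eval y ≠ 0 := by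
    intro hQ0
    refine hns ![1, x, y] (fun h => by simpa using congrFun h 0) fun w => ?_
    have hw : w = w 0 • ![1, x, y] + (1 : ℂ) • ![0, w 1 - w 0 * x, w 2 - w 0 * y] := by
      ext i; fin_cases i <;> simp
    have hdvd : Polynomial.X ^ 2 ∣
        lineRestr F ![1, x, y] ![0, w 1 - w 0 * x, w 2 - w 0 * y] := by
      rw [lineRestr_eq_eval_map, hQ, Polynomial.map_mul, Polynomial.eval_mul, pow_two]
      have hX : ∀ G : Polynomial (Polynomial ℂ), ∀ a b : ℂ,
          (G.map (Polynomial.evalRingHom x)).eval y = 0 →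
          Polynomial.X ∣ (G.map ((Polynomial.aeval (Polynomial.C x + Polynomial.X *
            Polynomial.C a) : Polynomial ℂ →ₐ[ℂ] Polynomial ℂ) : Polynomial ℂ →+* Polynomial ℂ)).eval
            (Polynomial.C y + Polynomial.X * Polynomial.C b) := by
        intro G a b hG
        rw [Polynomial.X_dvd_iff, Polynomial.coeff_zero_eq_eval_zero,
          ← Polynomial.coe_evalRingHom, ← Polynomial.eval_map_apply, Polynomial.map_map]
        have e1 : (Polynomial.evalRingHom 0).comp ((Polynomial.aeval (Polynomial.C x +
            Polynomial.X * Polynomial.C a) : Polynomial ℂ →ₐ[ℂ] Polynomial ℂ) :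
            Polynomial ℂ →+* Polynomial ℂ) = Polynomial.evalRingHom x := by
          ext <;> simp
        rw [e1]
        simpa using hG
      exact mul_dvd_mul (hX P _ _ hy) (hX Q _ _ hQ0)
    have := X_pow_dvd_lineRestr hF hdvd (one_ne_zero (α := ℂ)) (w 0) 1
    rwa [one_smul, ← hw] at this
  have hder : eval ![1, x, y] (pderiv 2 F) ≠ 0 := by
    rw [← aeval_eq_eval, ← eval_vert, ← derivative_vert, hFx]
    simp only [Polynomial.derivative_mul, Polynomial.eval_add, Polynomial.eval_mul, hy, zero_mul,
      add_zero, Polynomial.derivative_map]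
    exact mul_ne_zero hy' hQ0
  let φ : Polynomial ℂ →ₐ[ℂ] PowerSeries ℂ := Polynomial.aeval (PowerSeries.C x + PowerSeries.X)
  have hφ : (PowerSeries.constantCoeff (R := ℂ)).comp (φ : Polynomial ℂ →+* PowerSeries ℂ) =
      Polynomial.evalRingHom x := by
    ext <;> simp [φ]
  have hc : ∀ G : Polynomial (Polynomial ℂ), PowerSeries.constantCoeff
      ((G.map (φ : Polynomial ℂ →+* PowerSeries ℂ)).eval (PowerSeries.C y)) =
      (G.map (Polynomial.evalRingHom x)).eval y := fun G => by
    rw [← Polynomial.eval_map_apply, Polynomial.map_map, hφ]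
    simp
  obtain ⟨α, hα, hαy⟩ := exists_powerSeries_root (hPm.map (φ : Polynomial ℂ →+* PowerSeries ℂ)) y
    (by rw [hc, hy]) (by rw [Polynomial.derivative_map, hc]; exact hy')
  have hmapφ : ∀ G, aeval ![1, PowerSeries.C x + PowerSeries.X, α] G =
      ((vert G 1 Polynomial.X).map (φ : Polynomial ℂ →+* PowerSeries ℂ)).eval α := fun G => by
    rw [map_vert, map_one, eval_vert, Polynomial.aeval_X]
  have hB : IsBranch F x y α :=
    ⟨by rw [hmapφ, hQ, Polynomial.map_mul, Polynomial.eval_mul, hα, zero_mul], hαy, hder⟩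
  have hH : aeval ![1, PowerSeries.C x + PowerSeries.X, α] (hess F) = 0 := by
    rw [hmapφ, hQ', Polynomial.map_mul, Polynomial.eval_mul, hα, zero_mul]
  refine hline ![1, x, y] ![0, 1, PowerSeries.coeff 1 α] ?_ ?_
  · exact linearIndependent_tangent x y _
  · ext n
    have := (hB.X_pow_dvd_iff hd hF n).mpr (by rw [hH]; exact dvd_zero _)
    rw [Polynomial.X_pow_dvd_iff] at this
    simpa using this n (by omega)

end Eliminant


/-! ### Coordinates in general position. -/

section Frames

theorem exists_forall_eval_ne_zero {ι : Type*} (s : Finset ι) (f : ι → MvPolynomial (Fin 3) ℂ)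
    (hf : ∀ i ∈ s, f i ≠ 0) : ∃ c, ∀ i ∈ s, eval c (f i) ≠ 0 := by
  have h : ∏ i ∈ s, f i ≠ 0 := Finset.prod_ne_zero_iff.mpr hf
  obtain ⟨c, hc⟩ : ∃ c, eval c (∏ i ∈ s, f i) ≠ 0 := by
    by_contra! hcon
    exact h (MvPolynomial.funext fun c => by rw [hcon, map_zero])
  rw [map_prod] at hc
  exact ⟨c, Finset.prod_ne_zero_iff.mp hc⟩

/-- The linear form with coefficients `u`. -/
def linForm (u : Fin 3 → ℂ) : MvPolynomial (Fin 3) ℂ := ∑ i, C (u i) * X i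

theorem eval_linForm (u c : Fin 3 → ℂ) : eval c (linForm u) = u ⬝ᵥ c := by
  simp [linForm, dotProduct]

theorem linForm_ne_zero {u : Fin 3 → ℂ} (hu : u ≠ 0) : linForm u ≠ 0 := by
  obtain ⟨i, hi⟩ := Function.ne_iff.mp hu
  intro h
  have := eval_linForm u (Pi.single i 1)
  rw [h, map_zero] at this
  exact hi (by simpa using this.symm)

/-- A frame in general position with respect to finitely many smooth points of a curve. -/
theorem exists_frame {F : MvPolynomial (Fin 3) ℂ} {d : ℕ} (hd : d ≠ 0) (hF : F.IsHomogeneous d)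
    (hF0 : F ≠ 0) (V : Finset (Fin 3 → ℂ))
    (hV : ∀ v ∈ V, v ≠ 0 ∧ eval v F = 0 ∧ (fun i => eval v (pderiv i F)) ≠ 0) :
    ∃ a b c : Fin 3 → ℂ, eval c F = 1 ∧ crossProduct c a ⬝ᵥ b ≠ 0 ∧
      (∀ v ∈ V, crossProduct c v ⬝ᵥ b ≠ 0 ∧ (fun i => eval v (pderiv i F)) ⬝ᵥ c ≠ 0) ∧
      ∀ v ∈ V, ∀ w ∈ V, crossProduct v w ≠ 0 → crossProduct v w ⬝ᵥ c ≠ 0 := by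
  classical
  -- The projection centre must avoid the curve, the tangents at the points of V and the chords of
  -- V. It is then rescaled by a d-th root to get F(c) = 1.
  obtain ⟨c₀, hc₀⟩ := exists_forall_eval_ne_zero
    (insert F (V.image (fun v => linForm fun i => eval v (pderiv i F)) ∪
      ((V ×ˢ V).filter fun x => crossProduct x.1 x.2 ≠ 0).image
        fun x => linForm (crossProduct x.1 x.2))) id (by
    intro f hf
    simp only [Finset.mem_insert, Finset.mem_union, Finset.mem_image, Finset.mem_filter] at hf
    rcases hf with rfl | ⟨v, hv, rfl⟩ | ⟨x, hx, rfl⟩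
    · exact hF0
    · exact linForm_ne_zero (hV v hv).2.2
    · exact linForm_ne_zero hx.2)
  obtain ⟨l, hl⟩ := IsAlgClosed.exists_pow_nat_eq (eval c₀ F)⁻¹ (Nat.pos_of_ne_zero hd)
  have hc₀F : eval c₀ F ≠ 0 := hc₀ F (Finset.mem_insert_self _ _)
  have hl0 : l ≠ 0 := by
    rintro rfl
    rw [zero_pow hd] at hl
    exact inv_ne_zero hc₀F hl.symm
  have hcF : eval (l • c₀) F = 1 := by
    have := aeval_smul_of_isHomogeneous hF l c₀
    rw [aeval_eq_eval, hl, aeval_eq_eval, inv_mul_cancel₀ hc₀F] at this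
    exact this
  have hc0 : l • c₀ ≠ 0 := by
    intro h
    have : eval (0 : Fin 3 → ℂ) F = 0 := by
      have := aeval_smul_of_isHomogeneous hF (0 : ℂ) (0 : Fin 3 → ℂ)
      simp only [zero_mul, zero_pow hd, aeval_eq_eval] at this
      exact this
    rw [h, this] at hcF
    exact zero_ne_one hcF
  obtain ⟨a, ha⟩ : ∃ a, crossProduct (l • c₀) a ≠ 0 := by
    by_contra! hcon
    apply hc0
    have h0 := hcon (Pi.single 0 1)
    have h1 := hcon (Pi.single 1 1)
    rw [cross_apply] at h0 h1
    have e1 := congrFun h0 1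
    have e2 := congrFun h0 2
    have e0 := congrFun h1 2
    ext i
    fin_cases i
    · simpa using e0
    · simpa using e2
    · simpa using e1
  obtain ⟨b, hb⟩ := exists_forall_eval_ne_zero (insert a V)
    (fun v => linForm (crossProduct (l • c₀) v)) (by
    intro v hv
    apply linForm_ne_zero
    rcases Finset.mem_insert.mp hv with rfl | hv
    · exact ha
    · intro h0
      have hdep : ¬ LinearIndependent ℂ ![l • c₀, v] := by
        rw [← crossProduct_ne_zero_iff_linearIndependent, not_not]
        exact h0
      obtain ⟨hv0, hvF, -⟩ := hV v hv
      rw [LinearIndependent.pair_iff' hc0] at hdep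
      push Not at hdep
      obtain ⟨s, hs⟩ := hdep
      have hs0 : s ≠ 0 := by
        rintro rfl
        exact hv0 (by rw [← hs, zero_smul])
      have := aeval_smul_of_isHomogeneous hF s (l • c₀)
      rw [aeval_eq_eval, aeval_eq_eval, hcF, mul_one] at this
      have h2 : (fun i => s * (l • c₀) i) = v := hs
      rw [h2, hvF] at this
      exact pow_ne_zero d hs0 this.symm)
  simp only [eval_linForm] at hb
  refine ⟨a, b, l • c₀, hcF, hb a (Finset.mem_insert_self _ _), fun v hv =>
    ⟨hb v (Finset.mem_insert_of_mem hv), ?_⟩, fun v hv w hw hvw => ?_⟩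
  · rw [dotProduct_smul, smul_eq_mul]
    refine mul_ne_zero hl0 ?_
    have := hc₀ (linForm fun i => eval v (pderiv i F)) (by
      simp only [Finset.mem_insert, Finset.mem_union, Finset.mem_image]
      exact Or.inr (Or.inl ⟨v, hv, rfl⟩))
    rwa [id, eval_linForm] at this
  · rw [dotProduct_smul, smul_eq_mul]
    refine mul_ne_zero hl0 ?_
    have := hc₀ (linForm (crossProduct v w)) (by
      simp only [Finset.mem_insert, Finset.mem_union, Finset.mem_image, Finset.mem_filter]
      exact Or.inr (Or.inr ⟨(v, w), ⟨Finset.mem_product.mpr ⟨hv, hw⟩, hvw⟩, rfl⟩))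
    rwa [id, eval_linForm] at this

end Frames

/-! ### Flexes as intersections with the Hessian curve. -/

section FlexPoints

variable {F : MvPolynomial (Fin 3) ℂ} {d : ℕ}

/-- A point at which some line has contact of order at least three with the curve. -/
def IsFlexPoint (F : MvPolynomial (Fin 3) ℂ) (p : Fin 3 → ℂ) : Prop :=
  ∃ q, LinearIndependent ℂ ![p, q] ∧ Polynomial.X ^ 3 ∣ lineRestr F p q

theorem IsFlexPoint.ne_zero {p : Fin 3 → ℂ} (h : IsFlexPoint F p) : p ≠ 0 := by
  obtain ⟨q, hq, -⟩ := h
  exact hq.ne_zero 0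

theorem IsFlexPoint.smul (hF : F.IsHomogeneous d) {p : Fin 3 → ℂ} (h : IsFlexPoint F p) {l : ℂ}
    (hl : l ≠ 0) : IsFlexPoint F (l • p) := by
  obtain ⟨q, hq, hX⟩ := h
  refine ⟨q, by simpa using linearIndependent_pair_smul hl one_ne_zero hq, ?_⟩
  have := X_pow_dvd_lineRestr hF hX hl 0 1
  simpa using this

theorem IsFlexPoint.of_subst {A B : Matrix (Fin 3) (Fin 3) ℂ} (hBA : B * A = 1) {p : Fin 3 → ℂ}
    (h : IsFlexPoint (subst A F) p) : IsFlexPoint F (A.mulVec p) := by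
  obtain ⟨q, hq, hX⟩ := h
  rw [lineRestr_subst] at hX
  exact ⟨_, linearIndependent_mulVec hBA hq, hX⟩

/-- Nonsingular curves: no point has all its lines tangent. -/
def IsSmooth (F : MvPolynomial (Fin 3) ℂ) : Prop :=
  ∀ z : Fin 3 → ℂ, z ≠ 0 → ¬ ∀ w, Polynomial.X ^ 2 ∣ lineRestr F z w

theorem IsSmooth.subst (hs : IsSmooth F) {A B : Matrix (Fin 3) (Fin 3) ℂ} (hBA : B * A = 1) :
    IsSmooth (subst A F) := by
  intro z hz h
  have hAB : A * B = 1 := mul_eq_one_comm.mp hBA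
  refine hs (A.mulVec z) (fun h0 => hz ?_) fun w => ?_
  · have := congrArg B.mulVec h0
    rwa [Matrix.mulVec_mulVec, hBA, Matrix.one_mulVec, Matrix.mulVec_zero] at this
  · have := h (B.mulVec w)
    rwa [lineRestr_subst, Matrix.mulVec_mulVec, hAB, Matrix.one_mulVec] at this

theorem IsSmooth.grad_ne_zero (hs : IsSmooth F) {p : Fin 3 → ℂ} (hp : p ≠ 0)
    (h0 : eval p F = 0) : (fun i => eval p (pderiv i F)) ≠ 0 :=
  (exists_not_X_sq_dvd_iff F p h0).mp (not_forall.mp (hs p hp))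

theorem isFlexPoint_iff (hd : 2 ≤ d) (hF : F.IsHomogeneous d) (hs : IsSmooth F) {p : Fin 3 → ℂ}
    (hp : p ≠ 0) : IsFlexPoint F p ↔ eval p F = 0 ∧ eval p (hess F) = 0 := by
  obtain ⟨w, hw⟩ := not_forall.mp (hs p hp)
  constructor
  · rintro ⟨q, hpq, hX⟩
    have h2 : Polynomial.X ^ 2 ∣ lineRestr F p q := (pow_dvd_pow _ (by norm_num)).trans hX
    exact ⟨((X_sq_dvd_lineRestr_iff F p q).mp h2).1, (X_cube_dvd_iff_hess hF hd h2 hpq hw).mp hX⟩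
  · rintro ⟨h0, hH⟩
    have hg : (fun i => eval p (pderiv i F)) ⬝ᵥ w ≠ 0 := fun h =>
      hw ((X_sq_dvd_lineRestr_iff F p w).mpr ⟨h0, h⟩)
    have hgp : (fun i => eval p (pderiv i F)) ⬝ᵥ p = 0 := by
      have := euler p hF
      simp only [aeval_eq_eval, h0, mul_zero] at this
      rw [← this]
      exact Finset.sum_congr rfl fun i _ => mul_comm _ _
    have hpw : LinearIndependent ℂ ![p, w] := by
      rw [LinearIndependent.pair_iff' hp]
      rintro s rfl
      rw [dotProduct_smul, hgp, smul_zero] at hg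
      exact hg rfl
    obtain ⟨A, B, hAB, hBA, hA0, hA1⟩ := exists_matrix_of_pair hpw
    set u := A.mulVec (Pi.single 2 1) with hu
    -- Chosen so that u - c w pairs to zero with the gradient; together with p it spans the tangent
    -- line.
    set c : ℂ := ((fun i => eval p (pderiv i F)) ⬝ᵥ u) / ((fun i => eval p (pderiv i F)) ⬝ᵥ w)
      with hc
    have hpq : LinearIndependent ℂ ![p, u - c • w] := by
      rw [LinearIndependent.pair_iff]
      intro s t hst
      have h1 : A.mulVec ![s, -(t * c), t] = 0 := by
        have : (![s, -(t * c), t] : Fin 3 → ℂ) = s • Pi.single 0 1 + (-(t * c)) • Pi.single 1 1 +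
            t • Pi.single 2 1 := by
          ext i; fin_cases i <;> simp
        rw [this, Matrix.mulVec_add, Matrix.mulVec_add, Matrix.mulVec_smul, Matrix.mulVec_smul,
          Matrix.mulVec_smul, hA0, hA1, ← hu, ← hst, smul_sub, smul_smul, neg_smul]
        abel
      have h2 := congrArg B.mulVec h1
      rw [Matrix.mulVec_mulVec, hBA, Matrix.one_mulVec, Matrix.mulVec_zero] at h2
      exact ⟨by simpa using congrFun h2 0, by simpa using congrFun h2 2⟩
    have hX2 : Polynomial.X ^ 2 ∣ lineRestr F p (u - c • w) := by
      refine (X_sq_dvd_lineRestr_iff F p _).mpr ⟨h0, ?_⟩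
      change (fun i => eval p (pderiv i F)) ⬝ᵥ (u - c • w) = 0
      rw [dotProduct_sub, dotProduct_smul, smul_eq_mul, hc, div_mul_cancel₀ _ hg, sub_self]
    exact ⟨_, hpq, (X_cube_dvd_iff_hess hF hd hX2 hpq hw).mpr hH⟩

end FlexPoints


/-! ### Coordinates adapted to the finitely many flexes. -/

section Coordinates

variable {F : MvPolynomial (Fin 3) ℂ} {d : ℕ}

theorem eval_subst (A : Matrix (Fin 3) (Fin 3) ℂ) (F : MvPolynomial (Fin 3) ℂ) (z : Fin 3 → ℂ) :
    eval z (subst A F) = eval (A.mulVec z) F := by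
  rw [← coeff_zero_lineRestr _ z 0, lineRestr_subst, coeff_zero_lineRestr]

/-- The third basis vector is the projection centre and the line z₁ = 0 joins it to the second.
Points of V are then finite with nonvertical tangents, and independent ones have different
abscissas. -/
theorem exists_coordinates (hd : d ≠ 0) (hF : F.IsHomogeneous d)
    (hF0 : F ≠ 0) (V : Finset (Fin 3 → ℂ))
    (hV : ∀ v ∈ V, v ≠ 0 ∧ eval v F = 0 ∧ (fun i => eval v (pderiv i F)) ≠ 0) :
    ∃ A B : Matrix (Fin 3) (Fin 3) ℂ, A * B = 1 ∧ B * A = 1 ∧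
      eval (Pi.single 2 1) (subst A F) = 1 ∧
      (∀ z, A.mulVec z ∈ V → z 0 ≠ 0 ∧ eval z (pderiv 2 (subst A F)) ≠ 0) ∧
      ∀ z w, A.mulVec z ∈ V → A.mulVec w ∈ V → LinearIndependent ℂ ![z, w] →
        z 0 * w 1 - z 1 * w 0 ≠ 0 := by
  obtain ⟨a, b, c, hc, habc, hV1, hV2⟩ := exists_frame hd hF hF0 V hV
  let A : Matrix (Fin 3) (Fin 3) ℂ := (Matrix.of ![a, b, c]).transpose
  have hA : ∀ z i, A.mulVec z i = a i * z 0 + b i * z 1 + c i * z 2 := fun z i => by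
    simp [A, Matrix.mulVec, dotProduct, Fin.sum_univ_three]
  have hA2 : A.mulVec (Pi.single 2 1) = c := by
    ext i
    rw [hA]
    simp
  have hdet : A.det ≠ 0 := by
    intro h
    apply habc
    have : A.det = crossProduct c a ⬝ᵥ b := by
      simp [A, Matrix.det_fin_three, cross_apply, dotProduct, Fin.sum_univ_three]
      ring
    rw [← this, h]
  have hBA : A⁻¹ * A = 1 := Matrix.nonsing_inv_mul _ hdet.isUnit
  refine ⟨A, A⁻¹, Matrix.mul_nonsing_inv _ hdet.isUnit, hBA, ?_, ?_, ?_⟩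
  · rw [eval_subst, hA2, hc]
  · intro z hz
    constructor
    · intro h0
      apply (hV1 _ hz).1
      simp only [cross_apply, dotProduct, Fin.sum_univ_three, hA, h0, Matrix.cons_val]
      ring
    · have h1 := coeff_one_lineRestr (subst A F) z (Pi.single 2 1)
      rw [lineRestr_subst, hA2, coeff_one_lineRestr] at h1
      have h2 : ∑ i, eval z (pderiv i (subst A F)) * (Pi.single 2 1 : Fin 3 → ℂ) i =
          eval z (pderiv 2 (subst A F)) := by
        simp [Fin.sum_univ_three]
      rw [← h2, ← h1]
      exact (hV1 _ hz).2
  · intro z w hz hw hzw h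
    refine hV2 _ hz _ hw (crossProduct_ne_zero_iff_linearIndependent.mpr
      (linearIndependent_mulVec hBA hzw)) ?_
    have : crossProduct (A.mulVec z) (A.mulVec w) ⬝ᵥ c =
        (z 0 * w 1 - z 1 * w 0) * (crossProduct c a ⬝ᵥ b) := by
      simp only [cross_apply, dotProduct, Fin.sum_univ_three, hA, Matrix.cons_val]
      ring
    rw [this, h, zero_mul]

/-- Curves without a line as a component. -/
def HasNoLine (F : MvPolynomial (Fin 3) ℂ) : Prop :=
  ∀ p q, LinearIndependent ℂ ![p, q] → lineRestr F p q ≠ 0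

theorem HasNoLine.subst (h : HasNoLine F) {A B : Matrix (Fin 3) (Fin 3) ℂ} (hBA : B * A = 1) :
    HasNoLine (subst A F) := fun p q hpq => by
  rw [lineRestr_subst]
  exact h _ _ (linearIndependent_mulVec hBA hpq)

theorem IsSmooth.ne_zero (hs : IsSmooth F) : F ≠ 0 := by
  rintro rfl
  refine hs (Pi.single 0 1) (fun h => by simpa using congrFun h 0) fun w => ?_
  simp [lineRestr]

theorem exists_smul_normalized {z : Fin 3 → ℂ} (hF : F.IsHomogeneous d)
    (h1 : eval (Pi.single 2 1) F = 1) (hz : z ≠ 0) (h0 : eval z F = 0) :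
    ∃ l : ℂ, l ≠ 0 ∧ ((∃ x y, l • z = ![1, x, y]) ∨ ∃ y, l • z = ![0, 1, y]) := by
  by_cases hz0 : z 0 = 0
  · by_cases hz1 : z 1 = 0
    · exfalso
      have hzv : z = fun i => z 2 * (Pi.single 2 1 : Fin 3 → ℂ) i := by
        funext i; fin_cases i <;> simp [hz0, hz1]
      have hz2 : z 2 ≠ 0 := by
        intro h
        apply hz
        ext i; fin_cases i <;> simp [hz0, hz1, h]
      have := aeval_smul_of_isHomogeneous hF (z 2) (Pi.single 2 1)
      rw [← hzv, aeval_eq_eval, aeval_eq_eval, h0, h1, mul_one] at this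
      exact pow_ne_zero d hz2 this.symm
    · refine ⟨(z 1)⁻¹, inv_ne_zero hz1, Or.inr ⟨(z 1)⁻¹ * z 2, ?_⟩⟩
      ext i; fin_cases i <;> simp [hz0, hz1]
  · refine ⟨(z 0)⁻¹, inv_ne_zero hz0, Or.inl ⟨(z 0)⁻¹ * z 1, (z 0)⁻¹ * z 2, ?_⟩⟩
    ext i; fin_cases i <;> simp [hz0]

/-- First pass in coordinates with no condition at the flexes, needed because good coordinates can
only be chosen once the flexes are known to be finite in number. Affine flexes lie over roots of the
eliminant; the curve has finitely many points at infinity. -/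
theorem exists_finset_isFlexPoint (hd : 2 ≤ d) (hF : F.IsHomogeneous d) (hs : IsSmooth F)
    (hline : HasNoLine F) : ∃ V : Finset (Fin 3 → ℂ), (∀ v ∈ V, IsFlexPoint F v) ∧
      ∀ p, IsFlexPoint F p → ∃ l : ℂ, l ≠ 0 ∧ l • p ∈ V := by
  classical
  obtain ⟨A, B, hAB, hBA, h1, -, -⟩ := exists_coordinates (by omega) hF hs.ne_zero ∅ (by simp)
  set G := subst A F with hG
  have hGF : subst B G = F := by rw [hG, subst_subst, hAB, subst_one]
  have hGh : G.IsHomogeneous d := isHomogeneous_subst hF A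
  have hGs : IsSmooth G := hs.subst hBA
  have hE := eliminant_hess_ne_zero hd hGh h1 hGs (hline.subst hBA)
  let W : Finset (Fin 3 → ℂ) :=
    ((eliminant G (hess G) d (3 * (d - 2))).roots.toFinset.biUnion fun x =>
      (vert G 1 x).roots.toFinset.image fun y => ![1, x, y]) ∪
    (vert G 0 1).roots.toFinset.image fun y => ![0, 1, y]
  refine ⟨(W.image A.mulVec).filter (IsFlexPoint F), fun v hv => (Finset.mem_filter.mp hv).2,
    fun p hp => ?_⟩
  have hz : IsFlexPoint G (B.mulVec p) := by
    apply IsFlexPoint.of_subst hAB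
    rwa [hGF]
  have hz0 := hz.ne_zero
  obtain ⟨hzG, hzH⟩ := (isFlexPoint_iff hd hGh hGs hz0).mp hz
  obtain ⟨l, hl, hcase⟩ := exists_smul_normalized hGh h1 hz0 hzG
  have hlz := (isFlexPoint_iff hd hGh hGs (smul_ne_zero hl hz0)).mp (hz.smul hGh hl)
  refine ⟨l, hl, Finset.mem_filter.mpr ⟨Finset.mem_image.mpr ⟨l • B.mulVec p, ?_, ?_⟩,
    hp.smul hF hl⟩⟩
  · rcases hcase with ⟨x, y, hxy⟩ | ⟨y, hy⟩
    · rw [hxy] at hlz ⊢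
      apply Finset.mem_union_left
      refine Finset.mem_biUnion.mpr ⟨x, ?_, Finset.mem_image_of_mem _ ?_⟩
      · rw [Multiset.mem_toFinset, Polynomial.mem_roots hE, Polynomial.IsRoot,
          ← Polynomial.coe_aeval_eq_eval, aeval_eliminant,
          elim_eq_zero_iff hGh h1 (isHomogeneous_hess hGh)]
        exact ⟨y, hlz⟩
      · rw [Multiset.mem_toFinset, mem_roots_vert hGh h1]
        exact hlz.1
    · rw [hy] at hlz ⊢
      apply Finset.mem_union_right
      refine Finset.mem_image_of_mem _ ?_
      rw [Multiset.mem_toFinset, mem_roots_vert hGh h1]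
      exact hlz.1
  · rw [Matrix.mulVec_smul, Matrix.mulVec_mulVec, hAB, Matrix.one_mulVec]

/-- Coordinates in which the flexes of a curve are in general position. -/
theorem exists_flex_coordinates (hd : 2 ≤ d) (hF : F.IsHomogeneous d) (hs : IsSmooth F)
    (hline : HasNoLine F) : ∃ A B : Matrix (Fin 3) (Fin 3) ℂ, A * B = 1 ∧ B * A = 1 ∧
      eval (Pi.single 2 1) (subst A F) = 1 ∧
      (∀ z, IsFlexPoint (subst A F) z → z 0 ≠ 0 ∧ eval z (pderiv 2 (subst A F)) ≠ 0) ∧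
      ∀ x y y', IsFlexPoint (subst A F) ![1, x, y] → IsFlexPoint (subst A F) ![1, x, y'] →
        y = y' := by
  obtain ⟨V, hV1, hV2⟩ := exists_finset_isFlexPoint hd hF hs hline
  obtain ⟨A, B, hAB, hBA, h1, h2, h3⟩ := exists_coordinates (by omega) hF hs.ne_zero V
    (fun v hv => by
      have hv0 := (hV1 v hv).ne_zero
      have := ((isFlexPoint_iff hd hF hs hv0).mp (hV1 v hv)).1
      exact ⟨hv0, this, hs.grad_ne_zero hv0 this⟩)
  have key : ∀ z, IsFlexPoint (subst A F) z → ∃ l : ℂ, l ≠ 0 ∧ A.mulVec (l • z) ∈ V :=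
    fun z hz => by
      obtain ⟨l, hl, hlV⟩ := hV2 _ (hz.of_subst hBA)
      exact ⟨l, hl, by rwa [Matrix.mulVec_smul]⟩
  refine ⟨A, B, hAB, hBA, h1, fun z hz => ?_, fun x y y' hy hy' => ?_⟩
  · obtain ⟨l, hl, hlV⟩ := key z hz
    obtain ⟨h0, hp⟩ := h2 _ hlV
    refine ⟨fun h => h0 (by simp [h]), fun h => hp ?_⟩
    have := aeval_smul_of_isHomogeneous ((isHomogeneous_subst hF A).pderiv (i := 2)) l z
    rw [aeval_eq_eval, aeval_eq_eval, h, mul_zero] at this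
    exact this
  · obtain ⟨l, hl, hlV⟩ := key _ hy
    obtain ⟨l', hl', hlV'⟩ := key _ hy'
    by_contra hne
    refine h3 _ _ hlV hlV' (linearIndependent_pair_smul hl hl' ?_) ?_
    · rw [LinearIndependent.pair_iff]
      intro s t hst
      have e0 := congrFun hst 0
      have e2 := congrFun hst 2
      simp at e0 e2
      have hs' : s * (y - y') = 0 := by linear_combination e2 - y' * e0
      have hs0 : s = 0 := (mul_eq_zero.mp hs').resolve_right (sub_ne_zero.mpr hne)
      exact ⟨hs0, by simpa [hs0] using e0⟩
    · simp
      ring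

end Coordinates

/-! ### Counting flexes with multiplicity. -/

section Count

variable {F : MvPolynomial (Fin 3) ℂ} {d : ℕ}

theorem IsFlex.isFlexPoint {r : ℕ} {p : Fin 3 → ℂ} (h : IsFlex F r p) : IsFlexPoint F p := by
  obtain ⟨hr, -, q, hq, hX, -⟩ := h
  exact ⟨q, hq, (pow_dvd_pow _ (by omega)).trans hX⟩

/-- The flexes of a nonsingular curve of degree `d`, counted with multiplicity, are `3 d (d - 2)`
in number. -/
theorem exists_flexes (hd : 3 ≤ d) (hF : F.IsHomogeneous d) (hs : IsSmooth F)
    (hline : HasNoLine F) : ∃ (s : Finset ℂ) (P : ℂ → Plane) (m : ℂ → ℕ),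
      Set.InjOn P s ∧ (∀ p r, IsFlex F r p.coords ↔ ∃ x ∈ s, P x = p ∧ m x = r) ∧
      ∑ x ∈ s, m x = 3 * d * (d - 2) := by
  classical
  have hd2 : 2 ≤ d := by omega
  obtain ⟨A, B, hAB, hBA, h1, hz0, hinj⟩ := exists_flex_coordinates hd2 hF hs hline
  have hGF : subst B (subst A F) = F := by rw [subst_subst, hAB, subst_one]
  have hGh : (subst A F).IsHomogeneous d := isHomogeneous_subst hF A
  have hGs : IsSmooth (subst A F) := hs.subst hBA
  have hflexG : ∀ r z, IsFlex (subst A F) r z ↔ IsFlex F r (A.mulVec z) :=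
    fun r z => isFlex_subst_iff hBA
  set G := subst A F with hG
  have hHh := isHomogeneous_hess hGh
  have hcone : ∀ x y : ℂ, (![1, x, y] : Fin 3 → ℂ) ≠ 0 :=
    fun x y h => by simpa using congrFun h 0
  have hflex : ∀ x y, IsFlexPoint G ![1, x, y] ↔
      eval ![1, x, y] G = 0 ∧ eval ![1, x, y] (hess G) = 0 :=
    fun x y => isFlexPoint_iff hd2 hGh hGs (hcone x y)
  -- No flex lies on z₁ = 0, so the eliminant has its full degree 3d(d-2).
  have hinfty : elim G (hess G) d (3 * (d - 2)) (0 : ℂ) 1 ≠ 0 := by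
    rw [Ne, elim_eq_zero_iff hGh h1 hHh]
    rintro ⟨y, hy⟩
    have hne : (![0, 1, y] : Fin 3 → ℂ) ≠ 0 := fun h => by simpa using congrFun h 1
    exact (hz0 _ ((isFlexPoint_iff hd2 hGh hGs hne).mpr hy)).1 (by simp)
  set E := eliminant G (hess G) d (3 * (d - 2)) with hEdef
  have hdeg : E.natDegree = d * (3 * (d - 2)) := natDegree_eliminant hGh h1 hHh hinfty
  have hE : E ≠ 0 := eliminant_hess_ne_zero hd2 hGh h1 hGs (hline.subst hBA)
  have hroot : ∀ x, x ∈ E.roots ↔ ∃ y, IsFlexPoint G ![1, x, y] := fun x => by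
    simp only [hflex]
    rw [Polynomial.mem_roots hE, Polynomial.IsRoot, ← Polynomial.coe_aeval_eq_eval,
      hEdef, aeval_eliminant, elim_eq_zero_iff hGh h1 hHh]
  have hex : ∀ x, ∃ y, x ∈ E.roots → IsFlexPoint G ![1, x, y] := fun x => by
    by_cases hx : x ∈ E.roots
    · obtain ⟨y, hy⟩ := (hroot x).mp hx
      exact ⟨y, fun _ => hy⟩
    · exact ⟨0, fun h => absurd h hx⟩
  choose Y hY using hex
  -- Only one flex lies above each root, so the root multiplicity is the order of the Hessian on its
  -- branch, which is r.
  have hmult : ∀ x ∈ E.roots, ∀ r, IsFlex G r ![1, x, Y x] ↔ E.rootMultiplicity x = r := by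
    intro x hx r
    have hf := (hflex _ _).mp (hY x hx)
    obtain ⟨α, hα⟩ := exists_isBranch hGh h1 hf.1 (hz0 _ (hY x hx)).2
    have hdvd := X_sub_C_pow_dvd_eliminant_iff_of_isBranch hGh h1 hHh hα
      (fun z hz hz' => hinj x z (Y x) ((hflex _ _).mpr ⟨hz, hz'⟩) (hY x hx))
    rw [hα.isFlex_iff hd2 hGh, ← hdvd, ← hdvd, ← hEdef, ← Polynomial.le_rootMultiplicity_iff hE,
      ← Polynomial.le_rootMultiplicity_iff hE]
    have : 0 < E.rootMultiplicity x := (Polynomial.rootMultiplicity_pos hE).mpr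
      ((Polynomial.mem_roots hE).mp hx)
    omega
  have hAne : ∀ z : Fin 3 → ℂ, z ≠ 0 → A.mulVec z ≠ 0 := fun z hz h => hz (by
    have := congrArg B.mulVec h
    rwa [Matrix.mulVec_mulVec, hBA, Matrix.one_mulVec, Matrix.mulVec_zero] at this)
  refine ⟨E.roots.toFinset, fun x => CProj.mk (A.mulVec ![1, x, Y x]) (hAne _ (hcone _ _)),
    fun x => E.rootMultiplicity x, ?_, fun p r => ⟨fun hp => ?_, ?_⟩, ?_⟩
  · intro x _ x' _ hxx
    obtain ⟨l, hl⟩ := (CProj.mk_eq_mk_iff _ _).mp hxx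
    have h2 := congrArg B.mulVec hl
    rw [Matrix.mulVec_smul, Matrix.mulVec_mulVec, Matrix.mulVec_mulVec, hBA, Matrix.one_mulVec,
      Matrix.one_mulVec] at h2
    have e0 := congrFun h2 0
    have e1 := congrFun h2 1
    simp at e0 e1
    rw [e0, one_mul] at e1
    exact e1.symm
  · have hz : IsFlex G r (B.mulVec p.coords) := by
      rw [hflexG, Matrix.mulVec_mulVec, hAB, Matrix.one_mulVec]
      exact hp
    obtain ⟨h0, -⟩ := hz0 _ hz.isFlexPoint
    set z := B.mulVec p.coords with hzdef
    have hsm : (z 0)⁻¹ • z = ![1, (z 0)⁻¹ * z 1, (z 0)⁻¹ * z 2] := by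
      ext i; fin_cases i <;> simp [h0]
    have hz' := hz.smul hGh (inv_ne_zero h0)
    rw [hsm] at hz'
    have hx : (z 0)⁻¹ * z 1 ∈ E.roots := (hroot _).mpr ⟨_, hz'.isFlexPoint⟩
    have hYx := hinj _ _ _ hz'.isFlexPoint (hY _ hx)
    rw [hYx] at hz' hsm
    refine ⟨_, Multiset.mem_toFinset.mpr hx, ?_, (hmult _ hx r).mp hz'⟩
    rw [← CProj.mk_coords p]
    refine (CProj.mk_eq_mk_iff _ _).mpr ⟨(z 0)⁻¹, ?_⟩
    rw [← hsm, Matrix.mulVec_smul, hzdef, Matrix.mulVec_mulVec, hAB, Matrix.one_mulVec]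
  · rintro ⟨x, hx, rfl, hr⟩
    have hx' := Multiset.mem_toFinset.mp hx
    have hfl := (hmult x hx' r).mpr hr
    rw [hflexG] at hfl
    obtain ⟨l, hl, hlc⟩ := CProj.exists_coords_mk (A.mulVec ![1, x, Y x]) (hAne _ (hcone _ _))
    rw [hlc]
    exact hfl.smul hF hl
  · have h2 := Multiset.toFinset_sum_count_eq E.roots
    simp only [Polynomial.count_roots] at h2
    rw [h2, ← (IsAlgClosed.splits E).natDegree_eq_card_roots, hdeg]
    ring

end Count

/-! ### The general member has one double flex. -/

section Conclusion

variable {d : ℕ}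

/-- On a line component every point is a hyperflex. Two distinct points of it, z and z + w, would
both be multiples of p. -/
theorem IsGenericHyperflex.hasNoLine {F : MvPolynomial (Fin 3) ℂ} {p q : Fin 3 → ℂ}
    (h : IsGenericHyperflex F p q) : HasNoLine F := by
  intro z w hzw h0
  have hpt : ∀ t : ℂ, eval (fun i => z i + t * w i) F = 0 := fun t => by
    rw [eval_line, h0, Polynomial.eval_zero]
  rw [LinearIndependent.pair_iff] at hzw
  obtain ⟨l, hl⟩ := h.unique z w hzw (by rw [h0]; exact dvd_zero _)
  have h1 : lineRestr F (z + w) w = 0 := by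
    apply Polynomial.funext
    intro t
    rw [← eval_line, Polynomial.eval_zero, ← hpt (1 + t)]
    have : (fun i => (z + w) i + t * w i) = fun i => z i + (1 + t) * w i := by
      funext i
      simp only [Pi.add_apply]
      ring
    rw [this]
  obtain ⟨l', hl'⟩ := h.unique (z + w) w (fun s t hst => by
    have := hzw s (s + t) (by rw [← hst, smul_add, add_smul]; abel)
    exact ⟨this.1, by simpa [this.1] using this.2⟩) (by rw [h1]; exact dvd_zero _)
  have h2 := hzw (l' - l) (-l) (by
    have : w = (l' - l) • p := by rw [sub_smul, ← hl', ← hl]; abel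
    rw [this]
    nth_rewrite 1 [hl]
    rw [smul_smul, smul_smul, ← add_smul, show (l' - l) * l + -l * (l' - l) = 0 by ring, zero_smul])
  have hl0 : l = 0 := by simpa using h2.2
  have := hzw 1 0 (by rw [hl, hl0]; simp)
  exact one_ne_zero this.1

theorem IsGenericHyperflex.isFlex {F : MvPolynomial (Fin 3) ℂ} {p q : Fin 3 → ℂ}
    (h : IsGenericHyperflex F p q) (hpq : LinearIndependent ℂ ![p, q]) : IsFlex F 2 p :=
  ⟨by norm_num, not_forall.mp (h.nonsingular p (hpq.ne_zero 0)), q, hpq, h.order_ge, h.order_lt⟩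

/-- The multiplicities sum to 3d(d-2). One of them is 2, and uniqueness of the hyperflex forces the
others to be 1, which lowers the number of points by one. -/
theorem inflectionPoints_of_isGenericHyperflex (hd : 3 ≤ d) (a : Param d) {p q : Fin 3 → ℂ}
    (hpq : LinearIndependent ℂ ![p, q]) (h : IsGenericHyperflex (form a) p q) :
    IsNonsingular a ∧ (inflectionPoints a).Finite ∧
      (inflectionPoints a).ncard = 3 * d * (d - 2) - 1 ∧
      ∃ p : Plane, IsInflection a 2 p ∧ multipleInflectionPoints a = {p} := by
  classical
  have hF := isHomogeneous_form a
  have hs : IsSmooth (form a) := h.nonsingular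
  have hp : p ≠ 0 := hpq.ne_zero 0
  obtain ⟨s, P, m, hinj, hflex, hsum⟩ := exists_flexes hd hF hs h.hasNoLine
  have hflexp : IsFlex (form a) 2 (CProj.mk p hp).coords := by
    obtain ⟨l, hl, hlc⟩ := CProj.exists_coords_mk p hp
    rw [hlc]
    exact (h.isFlex hpq).smul hF hl
  have huniq : ∀ z r, 2 ≤ r → IsFlex (form a) r z.coords → z = CProj.mk p hp := by
    rintro z r hr ⟨-, -, w, hzw, hX, -⟩
    obtain ⟨l, hl⟩ := h.unique z.coords w (LinearIndependent.pair_iff.mp hzw)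
      ((pow_dvd_pow _ (by omega)).trans hX)
    rw [← CProj.mk_coords z]
    exact (CProj.mk_eq_mk_iff _ _).mpr ⟨l, hl.symm⟩
  obtain ⟨x₀, hx₀, hPx₀, hmx₀⟩ := (hflex _ _).mp hflexp
  have hm : ∀ x ∈ s, IsFlex (form a) (m x) (P x).coords :=
    fun x hx => (hflex _ _).mpr ⟨x, hx, rfl, rfl⟩
  have hset : inflectionPoints a = P '' s := by
    ext z
    simp only [inflectionPoints, Set.mem_ofPred_eq, isInflection_iff, hflex]
    constructor
    · rintro ⟨r, x, hx, hxz, -⟩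
      exact ⟨x, hx, hxz⟩
    · rintro ⟨x, hx, hxz⟩
      exact ⟨m x, x, hx, hxz, rfl⟩
  have hone : ∀ x ∈ s.erase x₀, m x = 1 := by
    intro x hx
    obtain ⟨hne, hxs⟩ := Finset.mem_erase.mp hx
    have h1 := (hm x hxs).1
    by_contra hcon
    exact hne (hinj hxs hx₀ ((huniq _ _ (by omega) (hm x hxs)).trans hPx₀.symm))
  have hcard : s.card = 3 * d * (d - 2) - 1 := by
    rw [← Finset.add_sum_erase s m hx₀, hmx₀, Finset.sum_congr rfl hone] at hsum
    simp only [Finset.sum_const, smul_eq_mul, mul_one, Finset.card_erase_of_mem hx₀] at hsum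
    have := Finset.card_pos.mpr ⟨x₀, hx₀⟩
    omega
  refine ⟨fun z hz => ⟨hz, hs.grad_ne_zero z.coords_ne_zero hz⟩, ?_, ?_, CProj.mk p hp,
    (isInflection_iff _ _ _).mpr hflexp, ?_⟩
  · rw [hset]
    exact s.finite_toSet.image P
  · rw [hset, hinj.ncard_image, Set.ncard_coe_finset, hcard]
  · ext z
    simp only [multipleInflectionPoints, Set.mem_ofPred_eq, Set.mem_singleton_iff]
    constructor
    · rintro ⟨r, hr, hz⟩
      exact huniq z r hr ((isInflection_iff _ _ _).mp hz)
    · rintro rfl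
      exact ⟨2, le_rfl, (isInflection_iff _ _ _).mpr hflexp⟩

end Conclusion

end PlaneCurve

end

theorem proposition1p1 (d : ℕ) (hd : 4 ≤ d) :
    (IsIrreducible (PlaneCurve.multipleLocus d) ∧
      CProj.IsHypersurface (PlaneCurve.multipleLocus d)) ∧
    ∃ M : Set (PlaneCurve.Param d),
      M.Nonempty ∧
      (∃ U : Set (PlaneCurve.Param d), IsOpen U ∧ M = PlaneCurve.multipleLocus d ∩ U) ∧
      ∀ a ∈ M,
        PlaneCurve.IsNonsingular a ∧
        (PlaneCurve.inflectionPoints a).Finite ∧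
        (PlaneCurve.inflectionPoints a).ncard = 3 * d * (d - 2) - 1 ∧
        ∃ p : PlaneCurve.Plane, PlaneCurve.IsInflection a 2 p ∧
          PlaneCurve.multipleInflectionPoints a = {p} := by
  obtain ⟨U, hU, hne, hgen⟩ := PlaneCurve.exists_open_isGenericHyperflex hd
  refine ⟨⟨PlaneCurve.isIrreducible_multipleLocus hd, PlaneCurve.isHypersurface_multipleLocus hd⟩,
    PlaneCurve.multipleLocus d ∩ U, hne, ⟨U, hU, rfl⟩, fun a ha => ?_⟩
  obtain ⟨p, q, hpq, h⟩ := hgen a ha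
  exact PlaneCurve.inflectionPoints_of_isGenericHyperflex (by omega) a hpq h
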